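/- Let $d\ge 1$, let $I=[0,1]^d\subset\mathbb R^d$ with the Euclidean norm $|\cdot|$, and let $(X_k)_{k\ge1}$ be a sequence of independent, centered, real random fields on $I$ with continuous sample paths, defined on a probability space $(\Omega,\mathbb P)$. Assume the following. (1) (Locally log-correlated structure.) $\sup_{x\in I}\mathbb E X_k(x)^2\to0$ as $k\to\infty$, $\sum_{k=1}^\infty\mathbb E X_k(0)^2=\infty$, and there are constants $\delta,C>0$ such that for all $n\ge1$ and all $x,y\in I$ with $|x-y|\le\delta$ $$\Big|\sum_{k=1}^n\mathbb E X_k(x)X_k(y)-\min\Big(\log\frac1{|x-y|},\ \sum_{k=1}^n\mathbb E X_k(0)^2\Big)\Big|\le C,$$ where $\log\frac10=+\infty$. (2) For some $\varepsilon>0$, $\ \sup_{x\in I}\sum_{k=1}^\infty\big(\mathbb E|X_k(x)|^{3+\varepsilon}\big)^{\frac3{3+\varepsilon}}<\infty$. (3) There is $r_0>0$ such that for every real $r\ge r_0$ there is $C_r>0$ with $$\mathbb E\Big|\sum_{k=1}^n(X_k(x)-X_k(y))\Big|^r\le C_r\,e^{r\sum_{k=1}^n\mathbb E X_k(0)^2}\,|x-y|^r\qquad\text{for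 all } n\ge1,\ x,y\in I.$$ (4) $\sup_{k\ge1}\sup_{x\in I}\mathbb E e^{\lambda X_k(x)}<\infty$ for every $\lambda\in\mathbb R$. For $\beta\in\mathbb C$ and $f\in C(I,\mathbb C)$ put $$\mu_n(f;\beta)=\int_I f(x)\,\frac{e^{\beta\sum_{k=1}^nX_k(x)}}{\mathbb E e^{\beta\sum_{k=1}^nX_k(x)}}\,dx .$$ Then there is an open set $U\subset\mathbb C$ containing the interval $(0,\sqrt{2d})$ such that $\mathbb E e^{\beta\sum_{k=1}^nX_k(x)}\neq0$ for all $\beta\in U$, $n$ and $x\in I$; for all $\beta\in U$ and $f\in C(I,\mathbb C)$ the sequence $(\mu_n(f;\beta))_n$ is a martingale with respect to the filtration $(\sigma(X_1,\dots,X_n))_n$; and there are random variables $\mu(f;\beta)$ ($f\in C(I,\mathbb C)$, $\beta\in U$) with the following properties. (a) For every compact $K\subset U$ there is $p>1$ such that, for every $f\in C(I,\mathbb C)$, $\sup_{\beta\in K}\sup_n\|\mu_n(f;\beta)\|_{L^p(\Omega)}<\infty$, and $\mu_n(f;\beta)\to\mu(f;\beta)$ in $L^p(\Omega)$ for all $\beta\in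 K$ and $f\in C(I,\mathbb C)$. (b) For every fixed $f\in C(I,\mathbb C)$, almost surely the map $\beta\mapsto\mu(f;\beta)$ is analytic on $U$ and the maps $\beta\mapsto\mu_n(f;\beta)$ converge to it uniformly on every compact subset of $U$. -/

import Mathlib

open MeasureTheory ProbabilityTheory Filter Topology
open scoped ENNReal NNReal

namespace Chaos

/-- The closed unit cube `I = [0,1]^d` in `ℝ^d` with the Euclidean metric. -/
def unitCube (d : ℕ) : Set (EuclideanSpace ℝ (Fin d)) :=
  {x | ∀ i, x i ∈ Set.Icc (0 : ℝ) 1}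

/-- Lebesgue measure on the unit cube. -/
noncomputable def cubeVolume (d : ℕ) : Measure (unitCube d) :=
  (volume : Measure (EuclideanSpace ℝ (Fin d))).comap Subtype.val

/-- The corner `0` of the unit cube. -/
def origin (d : ℕ) : unitCube d :=
  ⟨0, fun _ => ⟨le_refl _, zero_le_one⟩⟩

variable {d : ℕ} {Ω : Type*} [mΩ : MeasurableSpace Ω]

/-- A sequence of continuous random fields on the unit cube: each `X k x` is a random variable
and every sample path `x ↦ X k x ω` is continuous. The sequence `X_1, X_2, …` is indexed by
`k = 0, 1, …`, so that the sum of the first `n` fields is the sum over `Finset.range n`. -/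
structure IsContinuousFields (X : ℕ → unitCube d → Ω → ℝ) : Prop where
  measurable : ∀ k x, Measurable (X k x)
  continuous : ∀ k ω, Continuous (fun x => X k x ω)

/-- The sum of the variances at the origin of the first `n` fields. -/
noncomputable def varSum (P : Measure Ω) (X : ℕ → unitCube d → Ω → ℝ) (n : ℕ) : ℝ :=
  ∑ k ∈ Finset.range n, ∫ ω, X k (origin d) ω ^ 2 ∂P

/-- `min (log (1 / |x - y|), s)`, where `log (1 / 0) = +∞`. -/
noncomputable def truncLog (x y : unitCube d) (s : ℝ) : ℝ :=
  open scoped Classical in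
  if x = y then s else min (Real.log (1 / dist x y)) s

/-- The locally log-correlated structure. -/
structure IsLocallyLogCorrelated (P : Measure Ω) (X : ℕ → unitCube d → Ω → ℝ) : Prop where
  memLp_two : ∀ k x, MemLp (X k x) 2 P
  /-- The supremum over `x` of `E X_k(x)^2` tends to `0`. -/
  sup_variance : TendstoUniformly (fun k x => ∫ ω, X k x ω ^ 2 ∂P) (fun _ => 0) atTop
  /-- The series of the `E X_k(0)^2` diverges. -/
  variance_diverges : Tendsto (varSum P X) atTop atTop
  covariance : ∃ δ > 0, ∃ C > 0, ∀ n ≥ 1, ∀ x y : unitCube d, dist x y ≤ δ →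
    |(∑ k ∈ Finset.range n, ∫ ω, X k x ω * X k y ω ∂P) - truncLog x y (varSum P X n)| ≤ C

/-- The `(3+ε)`-moment condition. -/
def MomentCondition (P : Measure Ω) (X : ℕ → unitCube d → Ω → ℝ) : Prop :=
  ∃ ε : ℝ, 0 < ε ∧
    ⨆ x, ∑' k, (∫⁻ ω, ‖X k x ω‖ₑ ^ (3 + ε) ∂P) ^ (3 / (3 + ε)) < ∞

/-- The Hölder-type increment condition in `L^r` for all large real `r`. -/
def IncrementCondition (P : Measure Ω) (X : ℕ → unitCube d → Ω → ℝ) : Prop :=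
  ∃ r₀ : ℝ, 0 < r₀ ∧ ∀ r ≥ r₀, ∃ C > 0, ∀ n ≥ 1, ∀ x y : unitCube d,
    ∫⁻ ω, ‖∑ k ∈ Finset.range n, (X k x ω - X k y ω)‖ₑ ^ r ∂P
      ≤ ENNReal.ofReal (C * Real.exp (r * varSum P X n) * dist x y ^ r)

/-- Exponential moments of all orders, bounded uniformly in the index and in the point. -/
def UniformExpMoments (P : Measure Ω) (X : ℕ → unitCube d → Ω → ℝ) : Prop :=
  ∀ l : ℝ, ⨆ k, ⨆ x, ∫⁻ ω, ENNReal.ofReal (Real.exp (l * X k x ω)) ∂P < ∞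

/-- `E exp (β (X_1(x) + … + X_n(x)))`. -/
noncomputable def normalizer (P : Measure Ω) (X : ℕ → unitCube d → Ω → ℝ)
    (n : ℕ) (β : ℂ) (x : unitCube d) : ℂ :=
  ∫ ω, Complex.exp (β * ((∑ k ∈ Finset.range n, X k x ω : ℝ) : ℂ)) ∂P

/-- The chaos `μ_n(f; β)`, as a random variable. -/
noncomputable def chaos (P : Measure Ω) (X : ℕ → unitCube d → Ω → ℝ)
    (n : ℕ) (f : C(unitCube d, ℂ)) (β : ℂ) (ω : Ω) : ℂ :=
  ∫ x : unitCube d,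
    f x * (Complex.exp (β * ((∑ k ∈ Finset.range n, X k x ω : ℝ) : ℂ)) / normalizer P X n β x)
      ∂(cubeVolume d)

/-- The filtration whose `n`-th term is generated by the first `n` fields. -/
def fieldFiltration {X : ℕ → unitCube d → Ω → ℝ} (hX : IsContinuousFields X) :
    Filtration ℕ mΩ where
  seq n := ⨆ k, ⨆ _ : k < n, ⨆ x, MeasurableSpace.comap (X k x) inferInstance
  mono' := fun _ _ hmn => iSup_mono fun _ => iSup_le fun hk =>
    le_iSup_of_le (lt_of_lt_of_le hk hmn) le_rfl
  le' := fun _ => iSup_le fun k => iSup_le fun _ => iSup_le fun x =>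
    (hX.measurable k x).comap_le

end Chaos

/-! The heart of the matter is a bound in `L^p`, for some `p > 1`, uniform in `n` and in `β` near a
real point `b` with `0 < b < √(2d)`. Write `S_n(x)` for the sum of the first `n` fields at `x`. For
`b² ≥ d` the second moment of the chaos diverges, because of rare paths `n ↦ S_n(x)` that climb too
high; the proof isolates these paths.

The fields need not be Gaussian, but their third moments are summable in a uniform sense, so Laplace
transforms of block sums at one or two points agree with Gaussian ones up to multiplicative
constants, and near the real axis they do not vanish (`exists_blockBounds`). Time is measured in
levels `N j`, at which the variance is about `j`: two points at distance `r` move together up to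
level `log (1/r)` and are decorrelated afterwards.

Take a line of slope `α = b + η`, slightly steeper than the typical slope `b` of paths seen by the
chaos. `blockExp_eq_sum` splits the exponential according to the level `l` at which `S - α ·
variance` first attains its maximum. The part before `l` ends above the line, which is exponentially
unlikely in `l` after tilting by the exponential. The part after `l` is independent of it and stays
below the line; its two-point function is at most a constant times `|x - y|^(-κ) e^(-κ l)`, with `κ
< d` available because `b² / 2 < d` (`exists_truncExp_bound`). For non-real `β` absolute values lose
a factor `e^(β.im² · variance)`, so there the barrier event is telescoped and each later block is
kept inside the norm, where its oscillation cancels.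

The cube is cut into cells of mesh about `e^(-(1+θ) l)`, on which the first `l` levels are nearly
constant by the increment condition. On a cell, `lintegral_rpow_weighted_le` combines a `p`-th
moment of the early part with a second moment of the late part. The triangle inequality over cells
leaves a bound geometric in `l` (`exists_eLpNorm_level_le`), which is summed over `l`; the
martingale property extends it from the levels to all `n`.

Analyticity in `β` is a Vitali argument. The mean of `|μ_n|` over a circle of parameters is a single
`L¹`-bounded submartingale, hence almost surely bounded (`ae_exists_integral_norm_le`); together
with almost sure convergence on a countable dense set this gives uniform convergence near the centre
(`uniformCauchySeqOn_of_integral_circle_le`). Boundedness in `L^q` and almost sure convergence yield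
convergence in `L^p` for `p < q`. -/

namespace Chaos

/-! ### Block sums of fields and independence of disjoint blocks. -/

section SigmaAlgebra

variable {d : ℕ} {Ω : Type*} {X : ℕ → unitCube d → Ω → ℝ}

/-- The σ-algebra generated by the fields with index in `s`. -/
@[reducible] def fieldSigma (X : ℕ → unitCube d → Ω → ℝ) (s : Set ℕ) : MeasurableSpace Ω :=
  ⨆ k ∈ s, ⨆ x, MeasurableSpace.comap (X k x) inferInstance

/-- The sum of the fields with index in the finite set `s`. -/
def fieldSum (X : ℕ → unitCube d → Ω → ℝ) (s : Finset ℕ) (x : unitCube d) (ω : Ω) : ℝ :=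
  ∑ k ∈ s, X k x ω

lemma fieldSigma_mono {s t : Set ℕ} (h : s ⊆ t) : fieldSigma X s ≤ fieldSigma X t :=
  iSup₂_le fun k hk => le_iSup₂_of_le k (h hk) le_rfl

lemma measurable_fieldSigma {s : Set ℕ} {k : ℕ} (hk : k ∈ s) (x : unitCube d) :
    Measurable[fieldSigma X s] (X k x) :=
  measurable_iff_comap_le.2
    (le_iSup₂_of_le (f := fun k (_ : k ∈ s) => ⨆ x, MeasurableSpace.comap (X k x) inferInstance)
      k hk (le_iSup (fun x => MeasurableSpace.comap (X k x) inferInstance) x))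

lemma measurable_fieldSum {s : Finset ℕ} {t : Set ℕ} (h : (s : Set ℕ) ⊆ t) (x : unitCube d) :
    Measurable[fieldSigma X t] (fieldSum X s x) :=
  Finset.measurable_fun_sum s fun _ hk => measurable_fieldSigma (h hk) x

lemma exp_fieldSum (β : ℂ) (s : Finset ℕ) (x : unitCube d) (ω : Ω) :
    Complex.exp (β * (fieldSum X s x ω : ℂ)) = ∏ k ∈ s, Complex.exp (β * (X k x ω : ℂ)) := by
  rw [fieldSum, ← Complex.exp_sum, Complex.ofReal_sum, Finset.mul_sum]

lemma measurable_cexp_mul {m : MeasurableSpace Ω} (β : ℂ) {f : Ω → ℝ} (hf : Measurable f) :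
    Measurable (fun ω => Complex.exp (β * (f ω : ℂ))) := by
  fun_prop

/-- A function continuous in one variable and measurable in the other is jointly measurable. The
σ-algebra on `Ω` is left free so that it can be that of a block. -/
lemma measurable_uncurry_fieldSum_of {m : MeasurableSpace Ω} {s : Finset ℕ}
    (hc : ∀ ω, Continuous (fun x => fieldSum X s x ω)) (hm : ∀ x, Measurable (fieldSum X s x)) :
    Measurable (fun q : unitCube d × Ω => fieldSum X s q.1 q.2) :=
  measurable_uncurry_of_continuous_of_measurable (u := fun x ω => fieldSum X s x ω) hc hm

end SigmaAlgebra

section Independence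

variable {d : ℕ} {Ω : Type*} [mΩ : MeasurableSpace Ω]

/-- The Laplace transform of the sum of the fields with index in the finite set `s`. -/
noncomputable def laplace (P : Measure Ω) (X : ℕ → unitCube d → Ω → ℝ)
    (s : Finset ℕ) (β : ℂ) (x : unitCube d) : ℂ :=
  ∫ ω, Complex.exp (β * (fieldSum X s x ω : ℂ)) ∂P

variable {P : Measure Ω} {X : ℕ → unitCube d → Ω → ℝ} {s t : Set ℕ}

lemma fieldSigma_le (hX : IsContinuousFields X) : fieldSigma X s ≤ mΩ :=
  iSup₂_le fun k _ => iSup_le fun x => (hX.measurable k x).comap_le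

/-- The product σ-algebra on paths pulls back to the supremum of the σ-algebras of the evaluations,
so independence of the paths passes to suprema over disjoint index sets. -/
lemma indep_fieldSigma (hX : IsContinuousFields X) (hindep : iIndepFun (fun k ω x => X k x ω) P)
    (hst : Disjoint s t) : Indep (fieldSigma X s) (fieldSigma X t) P := by
  have key : ∀ k, MeasurableSpace.comap (fun ω x => X k x ω) MeasurableSpace.pi
      = ⨆ x, MeasurableSpace.comap (X k x) inferInstance := by
    intro k
    simp only [MeasurableSpace.pi, MeasurableSpace.comap_iSup, MeasurableSpace.comap_comp]
    rfl
  have h := (iIndepFun_iff_iIndep _ _ _).1 hindep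
  simp only [key] at h
  exact indep_iSup_of_disjoint (fun k => iSup_le fun x => (hX.measurable k x).comap_le) h hst

/-- Functions of disjoint families of fields are uncorrelated. -/
lemma integral_mul_of_disjoint {𝕜 : Type*} [RCLike 𝕜] (hX : IsContinuousFields X)
    (hindep : iIndepFun (fun k ω x => X k x ω) P) (hst : Disjoint s t) {F G : Ω → 𝕜}
    (hF : Measurable[fieldSigma X s] F) (hG : Measurable[fieldSigma X t] G) :
    ∫ ω, F ω * G ω ∂P = (∫ ω, F ω ∂P) * ∫ ω, G ω ∂P := by
  have hFG : IndepFun F G P := by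
    rw [IndepFun_iff_Indep]
    exact indep_of_indep_of_le_left (indep_of_indep_of_le_right (indep_fieldSigma hX hindep hst)
      hG.comap_le) hF.comap_le
  exact hFG.integral_fun_mul_eq_mul_integral
    (hF.mono (fieldSigma_le hX) le_rfl).aestronglyMeasurable
    (hG.mono (fieldSigma_le hX) le_rfl).aestronglyMeasurable

lemma lintegral_mul_of_disjoint (hX : IsContinuousFields X)
    (hindep : iIndepFun (fun k ω x => X k x ω) P) (hst : Disjoint s t) {F G : Ω → ℝ≥0∞}
    (hF : Measurable[fieldSigma X s] F) (hG : Measurable[fieldSigma X t] G) :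
    ∫⁻ ω, F ω * G ω ∂P = (∫⁻ ω, F ω ∂P) * ∫⁻ ω, G ω ∂P :=
  lintegral_mul_eq_lintegral_mul_lintegral_of_independent_measurableSpace (fieldSigma_le hX)
    (fieldSigma_le hX) (indep_fieldSigma hX hindep hst) hF hG

lemma integral_prod_of_disjoint [IsProbabilityMeasure P] (hX : IsContinuousFields X)
    (hindep : iIndepFun (fun k ω x => X k x ω) P) {F : ℕ → Ω → ℂ}
    (hF : ∀ k, Measurable[fieldSigma X {k}] (F k)) (s : Finset ℕ) :
    ∫ ω, ∏ k ∈ s, F k ω ∂P = ∏ k ∈ s, ∫ ω, F k ω ∂P := by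
  classical
  induction s using Finset.induction_on with
  | empty => simp
  | insert a s ha ih =>
    simp only [Finset.prod_insert ha]
    rw [integral_mul_of_disjoint hX hindep (s := {a}) (t := (s : Set ℕ)) (by simpa using ha)
      (hF a), ih]
    exact Finset.measurable_fun_prod s fun k hk =>
      (hF k).mono (fieldSigma_mono (by simpa using hk)) le_rfl

lemma measurable_fieldSum' (hX : IsContinuousFields X) (s : Finset ℕ) (x : unitCube d) :
    Measurable (fieldSum X s x) :=
  Finset.measurable_fun_sum s fun k _ => hX.measurable k x

lemma continuous_fieldSum (hX : IsContinuousFields X) (s : Finset ℕ) (ω : Ω) :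
    Continuous (fun x => fieldSum X s x ω) :=
  continuous_finsetSum s fun k _ => hX.continuous k ω

lemma measurable_uncurry_fieldSum (hX : IsContinuousFields X) {s : Finset ℕ} {t : Set ℕ}
    (h : (s : Set ℕ) ⊆ t) :
    Measurable[Prod.instMeasurableSpace (m₂ := fieldSigma X t)]
      (fun q : unitCube d × Ω => fieldSum X s q.1 q.2) := by
  exact measurable_uncurry_fieldSum_of (fun ω => continuous_fieldSum hX s ω)
    (fun x => measurable_fieldSum h x)

lemma measurable_uncurry_fieldSum' (hX : IsContinuousFields X) (s : Finset ℕ) :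
    Measurable (fun q : unitCube d × Ω => fieldSum X s q.1 q.2) :=
  measurable_uncurry_of_continuous_of_measurable (u := fun x ω => fieldSum X s x ω)
    (fun ω => continuous_fieldSum hX s ω) (fun x => measurable_fieldSum' hX s x)

lemma normalizer_eq_laplace (n : ℕ) (β : ℂ) (x : unitCube d) :
    normalizer P X n β x = laplace P X (Finset.range n) β x := rfl

lemma laplace_eq_prod [IsProbabilityMeasure P] (hX : IsContinuousFields X)
    (hindep : iIndepFun (fun k ω x => X k x ω) P) (s : Finset ℕ) (β : ℂ) (x : unitCube d) :
    laplace P X s β x = ∏ k ∈ s, ∫ ω, Complex.exp (β * (X k x ω : ℂ)) ∂P := by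
  simp only [laplace, exp_fieldSum]
  refine integral_prod_of_disjoint hX hindep (fun k => ?_) s
  exact measurable_cexp_mul β (measurable_fieldSigma (Set.mem_singleton k) x)

lemma measurable_laplace (hX : IsContinuousFields X) [SFinite P] (s : Finset ℕ) (β : ℂ) :
    Measurable (laplace P X s β) := by
  have h := measurable_uncurry_fieldSum' hX s
  have : StronglyMeasurable (Function.uncurry fun (x : unitCube d) (ω : Ω) =>
      Complex.exp (β * (fieldSum X s x ω : ℂ))) := by
    refine Measurable.stronglyMeasurable ?_
    simp only [Function.uncurry_def]
    fun_prop
  exact this.integral_prod_right.measurable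

end Independence

/-! ### Moment control of a single field. -/

section Moments

variable {d : ℕ} {Ω : Type*} [mΩ : MeasurableSpace Ω] {P : Measure Ω}
  {X : ℕ → unitCube d → Ω → ℝ}

/-- Pointwise `e^(l|X|) ≤ e^(lX) + e^(-lX)`, and both suprema are finite. -/
lemma UniformExpMoments.exists_bound (hX : IsContinuousFields X) (hexp : UniformExpMoments P X) (l : ℝ) :
    ∃ K : ℝ, 0 ≤ K ∧ ∀ k x,
      ∫⁻ ω, ENNReal.ofReal (Real.exp (l * |X k x ω|)) ∂P ≤ ENNReal.ofReal K := by
  have h1 := hexp l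
  have h2 := hexp (-l)
  set a := ⨆ k, ⨆ x, ∫⁻ ω, ENNReal.ofReal (Real.exp (l * X k x ω)) ∂P
  set b := ⨆ k, ⨆ x, ∫⁻ ω, ENNReal.ofReal (Real.exp (-l * X k x ω)) ∂P
  refine ⟨(a + b).toReal, ENNReal.toReal_nonneg, fun k x => ?_⟩
  rw [ENNReal.ofReal_toReal (ENNReal.add_lt_top.2 ⟨h1, h2⟩).ne]
  calc ∫⁻ ω, ENNReal.ofReal (Real.exp (l * |X k x ω|)) ∂P
      ≤ ∫⁻ ω, (ENNReal.ofReal (Real.exp (l * X k x ω))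
          + ENNReal.ofReal (Real.exp (-l * X k x ω))) ∂P := by
        refine lintegral_mono fun ω => ?_
        rcases abs_cases (X k x ω) with h | h
        · rw [h.1]; exact le_self_add
        · rw [h.1, mul_neg, ← neg_mul]; exact le_add_self
    _ = _ := lintegral_add_left (by have := hX.measurable k x; fun_prop) _
    _ ≤ a + b := add_le_add
        (le_iSup₂ (f := fun k x => ∫⁻ ω, ENNReal.ofReal (Real.exp (l * X k x ω)) ∂P) k x)
        (le_iSup₂ (f := fun k x => ∫⁻ ω, ENNReal.ofReal (Real.exp (-l * X k x ω)) ∂P) k x)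

end Moments

end Chaos

namespace Chaos

/-- A sequence of independent centered continuous fields satisfying the log-correlation and moment
conditions. -/
structure IsLogCorrelatedSequence {d : ℕ} {Ω : Type*} [MeasurableSpace Ω] (P : Measure Ω)
    (X : ℕ → unitCube d → Ω → ℝ) : Prop where
  fields : IsContinuousFields X
  indep : iIndepFun (fun k ω x => X k x ω) P
  centered : ∀ k x, ∫ ω, X k x ω ∂P = 0
  log : IsLocallyLogCorrelated P X
  moment : MomentCondition P X
  incr : IncrementCondition P X
  expMoment : UniformExpMoments P X

section Laplace

variable {d : ℕ} {Ω : Type*} [mΩ : MeasurableSpace Ω] {P : Measure Ω}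
  {X : ℕ → unitCube d → Ω → ℝ}

/-- The covariance `E X_k(x) X_k(y)`. -/
noncomputable def cov (P : Measure Ω) (X : ℕ → unitCube d → Ω → ℝ) (k : ℕ) (x y : unitCube d) : ℝ :=
  ∫ ω, X k x ω * X k y ω ∂P

lemma cov_self_nonneg (k : ℕ) (x : unitCube d) : 0 ≤ cov P X k x x :=
  integral_nonneg fun _ => mul_self_nonneg _

/-- A summable control of the third moments, which also controls squares of variances and
exponentially weighted third moments. -/
lemma IsLogCorrelatedSequence.exists_control [IsProbabilityMeasure P]
    (h : IsLogCorrelatedSequence P X) :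
    ∃ (ρ : ℕ → unitCube d → ℝ) (R : ℝ), 0 ≤ R ∧ (∀ k x, 0 ≤ ρ k x) ∧
      (∀ (s : Finset ℕ) x, ∑ k ∈ s, ρ k x ≤ R) ∧
      (∀ k x, cov P X k x x ≤ R) ∧ (∀ k x, cov P X k x x ^ 2 ≤ R * ρ k x) ∧
      ∀ B : ℝ, 0 ≤ B → ∃ K : ℝ, 0 ≤ K ∧ ∀ k x,
        Integrable (fun ω => |X k x ω| ^ 3 * Real.exp (B * |X k x ω|)) P ∧
        ∫ ω, |X k x ω| ^ 3 * Real.exp (B * |X k x ω|) ∂P ≤ K * ρ k x := by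
  obtain ⟨ε, hε, hsup⟩ := h.moment
  have h3 : 0 < 3 + ε := by linarith
  set m : ℕ → unitCube d → ℝ≥0∞ := fun k x => ∫⁻ ω, ‖X k x ω‖ₑ ^ (3 + ε) ∂P with hm
  set S := ⨆ x, ∑' k, m k x ^ (3 / (3 + ε)) with hS
  have hle : ∀ (s : Finset ℕ) x, ∑ k ∈ s, m k x ^ (3 / (3 + ε)) ≤ S := fun s x =>
    (ENNReal.sum_le_tsum s).trans (le_iSup (fun x => ∑' k, m k x ^ (3 / (3 + ε))) x)
  have hle1 : ∀ k x, m k x ^ (3 / (3 + ε)) ≤ S := fun k x => by simpa using hle {k} x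
  have hfin : ∀ k x, m k x ^ (3 / (3 + ε)) ≠ ∞ := fun k x => ((hle1 k x).trans_lt hsup).ne
  have hmeas : ∀ k x, Measurable fun ω => ‖X k x ω‖ₑ := fun k x =>
    (h.fields.measurable k x).enorm
  -- Jensen: the variance is at most the `(3+ε)`-moment to the power `2/(3+ε)`, which is `ρ^(2/3)`.
  have hcov : ∀ k x, cov P X k x x ≤ (m k x ^ (3 / (3 + ε))).toReal ^ (2 / 3 : ℝ) := by
    intro k x
    have h1 : ∫⁻ ω, ‖X k x ω‖ₑ ^ (2 : ℝ) ∂P ≤ m k x ^ (2 / (3 + ε)) := by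
      have := ENNReal.lintegral_mul_norm_pow_le (μ := P) (f := fun ω => ‖X k x ω‖ₑ ^ (3 + ε))
        (g := fun _ => 1) ((hmeas k x).pow_const _).aemeasurable aemeasurable_const
        (p := 2 / (3 + ε)) (q := 1 - 2 / (3 + ε)) (by positivity)
        (by rw [sub_nonneg, div_le_one h3]; linarith) (by ring)
      simp only [ENNReal.one_rpow, mul_one, ← ENNReal.rpow_mul, lintegral_const, measure_univ] at this
      rwa [mul_div_cancel₀ _ h3.ne'] at this
    have h2 : cov P X k x x = (∫⁻ ω, ‖X k x ω‖ₑ ^ (2 : ℝ) ∂P).toReal := by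
      rw [cov, integral_eq_lintegral_of_nonneg_ae (ae_of_all _ fun _ => mul_self_nonneg _)
        ((h.fields.measurable k x).mul (h.fields.measurable k x)).aestronglyMeasurable]
      congr 1
      refine lintegral_congr fun ω => ?_
      rw [Real.enorm_eq_ofReal_abs, ENNReal.ofReal_rpow_of_nonneg (abs_nonneg _) (by norm_num)]
      norm_num [← pow_two]
    rw [h2, ENNReal.toReal_rpow, ← ENNReal.rpow_mul]
    rw [show 3 / (3 + ε) * (2 / 3) = 2 / (3 + ε) by field_simp]
    refine ENNReal.toReal_mono ?_ h1
    have := hfin k x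
    have h3' : (m k x) ^ (2 / (3 + ε)) = ((m k x) ^ (3 / (3 + ε))) ^ (2 / 3 : ℝ) := by
      rw [← ENNReal.rpow_mul]; congr 1; field_simp
    rw [h3']
    exact ENNReal.rpow_ne_top_of_nonneg (by norm_num) this
  set R₀ := S.toReal
  have hR₀ : 0 ≤ R₀ := ENNReal.toReal_nonneg
  have hρR : ∀ k x, (m k x ^ (3 / (3 + ε))).toReal ≤ R₀ := fun k x =>
    ENNReal.toReal_mono hsup.ne (hle1 k x)
  -- Here `ρ` is the cube of the `L^(3+ε)` norm. The three summands of the constant bound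
  -- respectively the sum of the `ρ`, the variance, and the factor `ρ^(1/3)` left over in
  -- `(ρ^(2/3))^2 = ρ^(1/3) * ρ`.
  refine ⟨fun k x => (m k x ^ (3 / (3 + ε))).toReal, R₀ + R₀ ^ (2 / 3 : ℝ) + R₀ ^ (1 / 3 : ℝ),
    by positivity, fun k x => ENNReal.toReal_nonneg, fun s x => ?_, fun k x => ?_, fun k x => ?_,
    fun B hB => ?_⟩
  · rw [← ENNReal.toReal_sum fun k _ => hfin k x]
    have := ENNReal.toReal_mono hsup.ne (hle s x)
    have h1 : 0 ≤ R₀ ^ (2 / 3 : ℝ) := by positivity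
    have h2 : 0 ≤ R₀ ^ (1 / 3 : ℝ) := by positivity
    linarith
  · have h1 : (m k x ^ (3 / (3 + ε))).toReal ^ (2 / 3 : ℝ) ≤ R₀ ^ (2 / 3 : ℝ) :=
      Real.rpow_le_rpow ENNReal.toReal_nonneg (hρR k x) (by norm_num)
    have h2 : 0 ≤ R₀ ^ (1 / 3 : ℝ) := by positivity
    linarith [hcov k x]
  · set r := (m k x ^ (3 / (3 + ε))).toReal with hr
    have hr0 : 0 ≤ r := ENNReal.toReal_nonneg
    have h1 : cov P X k x x ^ 2 ≤ (r ^ (2 / 3 : ℝ)) ^ 2 :=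
      pow_le_pow_left₀ (cov_self_nonneg k x) (hcov k x) 2
    have h2 : (r ^ (2 / 3 : ℝ)) ^ 2 = r ^ (1 / 3 : ℝ) * r := by
      rw [← Real.rpow_natCast, ← Real.rpow_mul hr0]
      conv_rhs => rw [← Real.rpow_one r, ← Real.rpow_mul hr0,
        ← Real.rpow_add_of_nonneg hr0 (by norm_num) (by norm_num)]
      norm_num
    have h3 : r ^ (1 / 3 : ℝ) ≤ R₀ ^ (1 / 3 : ℝ) := Real.rpow_le_rpow hr0 (hρR k x) (by norm_num)
    have h4 : 0 ≤ R₀ ^ (2 / 3 : ℝ) := by positivity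
    calc _ ≤ r ^ (1 / 3 : ℝ) * r := h1.trans_eq h2
      _ ≤ _ := mul_le_mul_of_nonneg_right (by linarith) hr0
  -- The exponent conjugate to `(3 + ε) / 3`: in Hölder's inequality the surplus `ε` of
  -- integrability pays for the exponential weight.
  · set q := (3 + ε) / ε with hq
    have hq0 : 0 < q := by positivity
    obtain ⟨K, hK0, hK⟩ := UniformExpMoments.exists_bound h.fields h.expMoment (q * B)
    have key : ∀ k x, ∫⁻ ω, ENNReal.ofReal (|X k x ω| ^ 3 * Real.exp (B * |X k x ω|)) ∂P
        ≤ m k x ^ (3 / (3 + ε)) * ENNReal.ofReal K ^ (1 / q) := by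
      intro k x
      have h1 := ENNReal.lintegral_mul_norm_pow_le (μ := P) (f := fun ω => ‖X k x ω‖ₑ ^ (3 + ε))
        (g := fun ω => ENNReal.ofReal (Real.exp (q * B * |X k x ω|)))
        ((hmeas k x).pow_const _).aemeasurable
        (by have := h.fields.measurable k x; fun_prop)
        (p := 3 / (3 + ε)) (q := 1 / q) (by positivity) (by positivity)
        (by rw [hq]; field_simp)
      refine le_trans (le_of_eq (lintegral_congr fun ω => ?_)) (h1.trans ?_)
      · rw [ENNReal.ofReal_mul (by positivity), ← ENNReal.rpow_mul, mul_div_cancel₀ _ h3.ne',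
          ENNReal.ofReal_rpow_of_pos (Real.exp_pos _), ← Real.exp_mul, Real.enorm_eq_ofReal_abs,
          ENNReal.ofReal_rpow_of_nonneg (abs_nonneg _) (by norm_num)]
        congr 2
        · norm_cast
        · rw [show q * B * |X k x ω| * (1 / q) = B * |X k x ω| by field_simp]
      · exact mul_le_mul_right (ENNReal.rpow_le_rpow (hK k x) (by positivity)) _
    refine ⟨(ENNReal.ofReal K ^ (1 / q)).toReal, ENNReal.toReal_nonneg, fun k x => ?_⟩
    have hm1 : Measurable fun ω => |X k x ω| ^ 3 * Real.exp (B * |X k x ω|) := by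
      have := h.fields.measurable k x; fun_prop
    have htop : m k x ^ (3 / (3 + ε)) * ENNReal.ofReal K ^ (1 / q) ≠ ∞ :=
      ENNReal.mul_ne_top (hfin k x) (ENNReal.rpow_ne_top_of_nonneg (by positivity)
        ENNReal.ofReal_ne_top)
    refine ⟨⟨hm1.aestronglyMeasurable, ?_⟩, ?_⟩
    · rw [hasFiniteIntegral_iff_ofReal (ae_of_all _ fun _ => by positivity)]
      exact (key k x).trans_lt htop.lt_top
    · rw [integral_eq_lintegral_of_nonneg_ae (ae_of_all _ fun _ => by positivity)
        hm1.aestronglyMeasurable]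
      exact (ENNReal.toReal_mono htop (key k x)).trans_eq (by rw [ENNReal.toReal_mul, mul_comm])

/-- Exponential integrability of a single field. -/
lemma IsLogCorrelatedSequence.integrable_exp_abs (h : IsLogCorrelatedSequence P X) (l : ℝ) (k : ℕ)
    (x : unitCube d) : Integrable (fun ω => Real.exp (l * |X k x ω|)) P := by
  obtain ⟨K, -, hK⟩ := UniformExpMoments.exists_bound h.fields h.expMoment l
  have hm := h.fields.measurable k x
  refine ⟨by fun_prop, ?_⟩
  rw [hasFiniteIntegral_iff_ofReal (ae_of_all _ fun _ => by positivity)]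
  exact (hK k x).trans_lt ENNReal.ofReal_lt_top

end Laplace

end Chaos

namespace Chaos

/-! ### Second order expansion of the Laplace transform of one field at two points. -/

section LaplaceExpansion

variable {d : ℕ} {Ω : Type*} [mΩ : MeasurableSpace Ω] {P : Measure Ω}
  {X : ℕ → unitCube d → Ω → ℝ}

/-- The second moment of `w₁ X_k(x) + w₂ X_k(y)`. -/
noncomputable def quad (P : Measure Ω) (X : ℕ → unitCube d → Ω → ℝ) (k : ℕ) (w₁ w₂ : ℂ)
    (x y : unitCube d) : ℂ :=
  w₁ ^ 2 * cov P X k x x + 2 * w₁ * w₂ * cov P X k x y + w₂ ^ 2 * cov P X k y y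

/-- The linear combination has modulus at most `2 * B * max |a| |b|`, so the two-point Taylor
remainder is dominated by one-point terms, which `exists_control` handles. -/
lemma norm_cube_mul_exp_le {B a b : ℝ} (hB : 0 ≤ B) {w₁ w₂ : ℂ} (h₁ : ‖w₁‖ ≤ B) (h₂ : ‖w₂‖ ≤ B) :
    ‖w₁ * a + w₂ * b‖ ^ 3 * Real.exp ‖w₁ * a + w₂ * b‖ ≤
      (2 * B) ^ 3 * (|a| ^ 3 * Real.exp (2 * B * |a|) + |b| ^ 3 * Real.exp (2 * B * |b|)) := by
  have hV : ‖w₁ * a + w₂ * b‖ ≤ B * |a| + B * |b| := by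
    refine (norm_add_le _ _).trans ?_
    rw [norm_mul, norm_mul, Complex.norm_real, Complex.norm_real, Real.norm_eq_abs,
      Real.norm_eq_abs]
    gcongr
  have key : ∀ c : ℝ, 0 ≤ c → ‖w₁ * a + w₂ * b‖ ≤ 2 * B * c →
      ‖w₁ * a + w₂ * b‖ ^ 3 * Real.exp ‖w₁ * a + w₂ * b‖
        ≤ (2 * B) ^ 3 * (c ^ 3 * Real.exp (2 * B * c)) := by
    intro c hc h
    calc _ ≤ (2 * B * c) ^ 3 * Real.exp (2 * B * c) := by gcongr
      _ = _ := by ring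
  have p1 : 0 ≤ |a| ^ 3 * Real.exp (2 * B * |a|) := by positivity
  have p2 : 0 ≤ |b| ^ 3 * Real.exp (2 * B * |b|) := by positivity
  rcases le_total |a| |b| with hab | hab
  · refine (key |b| (abs_nonneg _) ?_).trans ?_
    · nlinarith
    · gcongr; linarith
  · refine (key |a| (abs_nonneg _) ?_).trans ?_
    · nlinarith
    · gcongr; linarith

lemma norm_exp_sub_quadratic_le (V : ℂ) :
    ‖Complex.exp V - (1 + V + V ^ 2 / 2)‖ ≤ ‖V‖ ^ 3 * Real.exp ‖V‖ := by
  have := Complex.norm_exp_sub_sum_le_norm_mul_exp V 3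
  simpa [Finset.sum_range_succ, Nat.factorial] using this

lemma IsLogCorrelatedSequence.integrable_mul (h : IsLogCorrelatedSequence P X) (k : ℕ)
    (x y : unitCube d) : Integrable (fun ω => X k x ω * X k y ω) P :=
  (h.log.memLp_two k x).integrable_mul (h.log.memLp_two k y)

lemma abs_cov_le (h : IsLogCorrelatedSequence P X) (k : ℕ) (x y : unitCube d) :
    |cov P X k x y| ≤ (cov P X k x x + cov P X k y y) / 2 := by
  have hi := ((h.integrable_mul k x x).add (h.integrable_mul k y y)).div_const 2
  have e : (cov P X k x x + cov P X k y y) / 2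
      = ∫ ω, (X k x ω * X k x ω + X k y ω * X k y ω) / 2 ∂P := by
    rw [integral_div, integral_add (h.integrable_mul k x x) (h.integrable_mul k y y)]; rfl
  rw [e, cov]
  refine (abs_integral_le_integral_abs).trans (integral_mono (h.integrable_mul k x y).abs hi ?_)
  intro ω
  rw [abs_le]
  constructor <;> nlinarith [sq_nonneg (X k x ω + X k y ω), sq_nonneg (X k x ω - X k y ω),
    abs_le.1 (le_refl |X k x ω * X k y ω|), neg_abs_le (X k x ω * X k y ω),
    le_abs_self (X k x ω * X k y ω), abs_nonneg (X k x ω * X k y ω),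
    abs_mul_abs_self (X k x ω), abs_mul_abs_self (X k y ω), abs_mul (X k x ω) (X k y ω),
    sq_nonneg (|X k x ω| - |X k y ω|)]

lemma norm_quad_le (h : IsLogCorrelatedSequence P X) {B : ℝ} {w₁ w₂ : ℂ}
    (h₁ : ‖w₁‖ ≤ B) (h₂ : ‖w₂‖ ≤ B) (k : ℕ) (x y : unitCube d) :
    ‖quad P X k w₁ w₂ x y‖ ≤ 2 * B ^ 2 * (cov P X k x x + cov P X k y y) := by
  have hB : 0 ≤ B := (norm_nonneg _).trans h₁
  have hx := cov_self_nonneg (P := P) (X := X) k x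
  have hy := cov_self_nonneg (P := P) (X := X) k y
  have hxy := abs_cov_le h k x y
  have hb : ∀ w w' : ℂ, ‖w‖ ≤ B → ‖w'‖ ≤ B → ‖w * w'‖ ≤ B ^ 2 := fun w w' hw hw' => by
    rw [norm_mul, pow_two]; gcongr
  calc ‖quad P X k w₁ w₂ x y‖ ≤ ‖w₁ * w₁‖ * cov P X k x x + 2 * ‖w₁ * w₂‖ * |cov P X k x y|
        + ‖w₂ * w₂‖ * cov P X k y y := by
        refine (norm_add₃_le).trans (le_of_eq ?_)
        simp only [norm_mul, Complex.norm_real, Real.norm_eq_abs, abs_of_nonneg hx,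
          abs_of_nonneg hy, pow_two, Complex.norm_ofNat]
        ring
    _ ≤ B ^ 2 * cov P X k x x + 2 * B ^ 2 * ((cov P X k x x + cov P X k y y) / 2)
        + B ^ 2 * cov P X k y y := by
        gcongr
        exacts [hb _ _ h₁ h₁, hb _ _ h₁ h₂, hb _ _ h₂ h₂]
    _ = _ := by ring

lemma IsLogCorrelatedSequence.integral_quadratic [IsProbabilityMeasure P]
    (h : IsLogCorrelatedSequence P X) (k : ℕ) (w₁ w₂ : ℂ) (x y : unitCube d) :
    Integrable (fun ω => 1 + (w₁ * X k x ω + w₂ * X k y ω)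
      + (w₁ * X k x ω + w₂ * X k y ω) ^ 2 / 2) P ∧
    ∫ ω, (1 + (w₁ * X k x ω + w₂ * X k y ω) + (w₁ * X k x ω + w₂ * X k y ω) ^ 2 / 2) ∂P
      = 1 + quad P X k w₁ w₂ x y / 2 := by
  have hi : ∀ z, Integrable (fun ω => (X k z ω : ℂ)) P := fun z =>
    ((h.log.memLp_two k z).integrable (by norm_num)).ofReal
  have hm : ∀ z z', Integrable (fun ω => ((X k z ω * X k z' ω : ℝ) : ℂ)) P := fun z z' =>
    (h.integrable_mul k z z').ofReal
  have e : ∀ ω, 1 + (w₁ * X k x ω + w₂ * X k y ω) + (w₁ * X k x ω + w₂ * X k y ω) ^ 2 / 2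
      = (1 + (w₁ * X k x ω + w₂ * X k y ω)) + (w₁ ^ 2 / 2 * ((X k x ω * X k x ω : ℝ) : ℂ)
        + w₁ * w₂ * ((X k x ω * X k y ω : ℝ) : ℂ) + w₂ ^ 2 / 2 * ((X k y ω * X k y ω : ℝ) : ℂ)) := by
    intro ω; push_cast; ring
  have a1 := (hi x).const_mul w₁
  have a2 := (hi y).const_mul w₂
  have b1 := (hm x x).const_mul (w₁ ^ 2 / 2)
  have b2 := (hm x y).const_mul (w₁ * w₂)
  have b3 := (hm y y).const_mul (w₂ ^ 2 / 2)
  have c1 : Integrable (fun _ : Ω => (1 : ℂ)) P := integrable_const _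
  simp only [e]
  have a3 : Integrable (fun ω => w₁ * (X k x ω : ℂ) + w₂ * X k y ω) P := a1.add a2
  have a4 : Integrable (fun ω => 1 + (w₁ * (X k x ω : ℂ) + w₂ * X k y ω)) P := c1.add a3
  have b4 : Integrable (fun ω => w₁ ^ 2 / 2 * ((X k x ω * X k x ω : ℝ) : ℂ)
        + w₁ * w₂ * ((X k x ω * X k y ω : ℝ) : ℂ)) P := b1.add b2
  have b5 : Integrable (fun ω => w₁ ^ 2 / 2 * ((X k x ω * X k x ω : ℝ) : ℂ)
        + w₁ * w₂ * ((X k x ω * X k y ω : ℝ) : ℂ)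
        + w₂ ^ 2 / 2 * ((X k y ω * X k y ω : ℝ) : ℂ)) P := b4.add b3
  refine ⟨a4.add b5, ?_⟩
  rw [integral_add a4 b5, integral_add c1 a3, integral_add a1 a2, integral_add b4 b3,
    integral_add b1 b2]
  simp only [integral_const_mul, integral_complex_ofReal, h.centered, quad, cov]
  simp
  ring

lemma norm_exp_neg_mul_one_add_sub_one_le (s : ℂ) :
    ‖Complex.exp (-s) * (1 + s) - 1‖ ≤ ‖s‖ ^ 2 * Real.exp (2 * ‖s‖) := by
  have h1 := Complex.norm_exp_sub_sum_le_norm_mul_exp s 2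
  simp only [Finset.sum_range_succ, Finset.range_zero, Finset.sum_empty, pow_zero, pow_one,
    Nat.factorial] at h1
  have e : Complex.exp (-s) * (1 + s) - 1 = -(Complex.exp (-s) * (Complex.exp s - (1 + s))) := by
    rw [mul_sub, ← Complex.exp_add]; simp
  rw [e, norm_neg, norm_mul, two_mul, Real.exp_add]
  have h2 : ‖Complex.exp (-s)‖ ≤ Real.exp ‖s‖ := by
    rw [Complex.norm_exp]
    exact Real.exp_le_exp.2 ((Complex.re_le_norm _).trans_eq (norm_neg s))
  have h3 : ‖Complex.exp s - (1 + s)‖ ≤ ‖s‖ ^ 2 * Real.exp ‖s‖ := by simpa using h1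
  calc _ ≤ Real.exp ‖s‖ * (‖s‖ ^ 2 * Real.exp ‖s‖) := by gcongr
    _ = _ := by ring

/-- The Laplace transform of a single field is Gaussian up to a summable relative error. -/
lemma IsLogCorrelatedSequence.exists_gaussian_error [IsProbabilityMeasure P]
    (h : IsLogCorrelatedSequence P X) :
    ∃ (ρ : ℕ → unitCube d → ℝ) (R : ℝ), 0 ≤ R ∧ (∀ k x, 0 ≤ ρ k x) ∧
      (∀ (s : Finset ℕ) x, ∑ k ∈ s, ρ k x ≤ R) ∧ (∀ k x, cov P X k x x ≤ R) ∧
      ∀ B : ℝ, 0 ≤ B → ∃ K : ℝ, 0 ≤ K ∧ ∀ k x y (w₁ w₂ : ℂ), ‖w₁‖ ≤ B → ‖w₂‖ ≤ B →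
        ‖Complex.exp (-(quad P X k w₁ w₂ x y / 2))
          * (∫ ω, Complex.exp (w₁ * X k x ω + w₂ * X k y ω) ∂P) - 1‖ ≤ K * (ρ k x + ρ k y) := by
  obtain ⟨ρ, R, hR, hρ, hsum, hcov, hcov2, hexp⟩ := h.exists_control
  refine ⟨ρ, R, hR, hρ, hsum, hcov, fun B hB => ?_⟩
  obtain ⟨K, hK, hK'⟩ := hexp (2 * B) (by positivity)
  set T := B ^ 2 * (2 * R) with hT
  -- With `s` half of the second moment, `‖s‖ ≤ T`. The first summand comes from the cubic Taylor
  -- remainder of the exponential, the second from replacing `1 + s` by `e^s`, an error of order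
  -- `‖s‖²`, hence of the order of squared variances.
  refine ⟨Real.exp T * ((2 * B) ^ 3 * K) + 2 * B ^ 4 * R * Real.exp (2 * T), by positivity,
    fun k x y w₁ w₂ h₁ h₂ => ?_⟩
  obtain ⟨hpi, hpe⟩ := h.integral_quadratic k w₁ w₂ x y
  set s := quad P X k w₁ w₂ x y / 2 with hs
  have hx := cov_self_nonneg (P := P) (X := X) k x
  have hy := cov_self_nonneg (P := P) (X := X) k y
  have hs1 : ‖s‖ ≤ B ^ 2 * (cov P X k x x + cov P X k y y) := by
    have := norm_quad_le h h₁ h₂ k x y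
    rw [hs, norm_div, Complex.norm_ofNat]; linarith
  have hsT : ‖s‖ ≤ T := hs1.trans (by
    rw [hT]; exact mul_le_mul_of_nonneg_left (by linarith [hcov k x, hcov k y]) (by positivity))
  have hs2 : ‖s‖ ^ 2 ≤ 2 * B ^ 4 * R * (ρ k x + ρ k y) := by
    calc ‖s‖ ^ 2 ≤ (B ^ 2 * (cov P X k x x + cov P X k y y)) ^ 2 := by gcongr
      _ = B ^ 4 * (cov P X k x x + cov P X k y y) ^ 2 := by ring
      _ ≤ B ^ 4 * (2 * (cov P X k x x ^ 2 + cov P X k y y ^ 2)) := by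
        gcongr; nlinarith [sq_nonneg (cov P X k x x - cov P X k y y)]
      _ ≤ B ^ 4 * (2 * (R * ρ k x + R * ρ k y)) := by
        gcongr
        exacts [hcov2 k x, hcov2 k y]
      _ = _ := by ring
  -- the remainder of the Taylor expansion
  set D := ∫ ω, (Complex.exp (w₁ * X k x ω + w₂ * X k y ω) - (1 + (w₁ * X k x ω + w₂ * X k y ω)
      + (w₁ * X k x ω + w₂ * X k y ω) ^ 2 / 2)) ∂P with hD
  have hdom : Integrable (fun ω => (2 * B) ^ 3 * (|X k x ω| ^ 3 * Real.exp (2 * B * |X k x ω|)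
      + |X k y ω| ^ 3 * Real.exp (2 * B * |X k y ω|))) P :=
    ((hK' k x).1.add (hK' k y).1).const_mul _
  have hbd : ∀ ω, ‖Complex.exp (w₁ * X k x ω + w₂ * X k y ω) - (1 + (w₁ * X k x ω + w₂ * X k y ω)
      + (w₁ * X k x ω + w₂ * X k y ω) ^ 2 / 2)‖ ≤ (2 * B) ^ 3 *
      (|X k x ω| ^ 3 * Real.exp (2 * B * |X k x ω|)
      + |X k y ω| ^ 3 * Real.exp (2 * B * |X k y ω|)) := fun ω =>
    (norm_exp_sub_quadratic_le _).trans (norm_cube_mul_exp_le hB h₁ h₂)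
  have hmx := h.fields.measurable k x
  have hmy := h.fields.measurable k y
  have hDi : Integrable (fun ω => Complex.exp (w₁ * X k x ω + w₂ * X k y ω)
      - (1 + (w₁ * X k x ω + w₂ * X k y ω) + (w₁ * X k x ω + w₂ * X k y ω) ^ 2 / 2)) P :=
    hdom.mono' (by fun_prop) (ae_of_all _ hbd)
  have hDn : ‖D‖ ≤ (2 * B) ^ 3 * K * (ρ k x + ρ k y) := by
    refine (norm_integral_le_of_norm_le hdom (ae_of_all _ hbd)).trans ?_
    rw [integral_const_mul, integral_add (hK' k x).1 (hK' k y).1, mul_assoc]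
    refine mul_le_mul_of_nonneg_left ?_ (by positivity)
    linarith [(hK' k x).2, (hK' k y).2]
  have hE : ∫ ω, Complex.exp (w₁ * X k x ω + w₂ * X k y ω) ∂P = D + (1 + s) := by
    rw [hD, ← hpe, ← integral_add hDi hpi]
    simp
  have hes : ‖Complex.exp (-s)‖ ≤ Real.exp T := by
    rw [Complex.norm_exp]
    exact Real.exp_le_exp.2 (((Complex.re_le_norm _).trans_eq (norm_neg s)).trans hsT)
  rw [hE]
  calc ‖Complex.exp (-s) * (D + (1 + s)) - 1‖
      = ‖Complex.exp (-s) * D + (Complex.exp (-s) * (1 + s) - 1)‖ := by congr 1; ring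
    _ ≤ ‖Complex.exp (-s)‖ * ‖D‖ + ‖s‖ ^ 2 * Real.exp (2 * ‖s‖) :=
        (norm_add_le _ _).trans (add_le_add (norm_mul _ _).le
          (norm_exp_neg_mul_one_add_sub_one_le s))
    _ ≤ Real.exp T * ((2 * B) ^ 3 * K * (ρ k x + ρ k y))
        + 2 * B ^ 4 * R * (ρ k x + ρ k y) * Real.exp (2 * T) := by
        have := hρ k x
        have := hρ k y
        gcongr
    _ = _ := by ring

end LaplaceExpansion

end Chaos

namespace Chaos

/-! ### Two-sided Gaussian bounds for Laplace transforms of sums. -/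

section LaplaceBounds

variable {d : ℕ} {Ω : Type*} [mΩ : MeasurableSpace Ω] {P : Measure Ω}
  {X : ℕ → unitCube d → Ω → ℝ}

lemma IsLogCorrelatedSequence.integrable_exp_mul (h : IsLogCorrelatedSequence P X) (l : ℝ) (k : ℕ)
    (x : unitCube d) : Integrable (fun ω => Real.exp (l * X k x ω)) P := by
  have hm := h.fields.measurable k x
  refine (h.integrable_exp_abs |l| k x).mono' (by fun_prop) (ae_of_all _ fun ω => ?_)
  rw [Real.norm_eq_abs, Real.abs_exp, Real.exp_le_exp, ← abs_mul]
  exact le_abs_self _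

lemma IsLogCorrelatedSequence.integrable_exp_fieldSum [IsProbabilityMeasure P]
    (h : IsLogCorrelatedSequence P X) (l : ℝ) (s : Finset ℕ) (x : unitCube d) :
    Integrable (fun ω => Real.exp (l * fieldSum X s x ω)) P := by
  have hi : iIndepFun (fun k => X k x) P :=
    h.indep.comp (fun _ f => f x) fun _ => measurable_pi_apply x
  have := hi.integrable_exp_mul_sum (t := l) (s := s) (fun k => h.fields.measurable k x)
    fun k _ => h.integrable_exp_mul l k x
  simpa [fieldSum] using this

lemma IsLogCorrelatedSequence.integrable_exp_pair [IsProbabilityMeasure P]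
    (h : IsLogCorrelatedSequence P X) (a b : ℝ) (s t : Finset ℕ) (x y : unitCube d) :
    Integrable (fun ω => Real.exp (a * fieldSum X s x ω + b * fieldSum X t y ω)) P := by
  have h1 := measurable_fieldSum' h.fields s x
  have h2 := measurable_fieldSum' h.fields t y
  refine ((h.integrable_exp_fieldSum (2 * a) s x).add
    (h.integrable_exp_fieldSum (2 * b) t y)).mono' (by fun_prop) (ae_of_all _ fun ω => ?_)
  rw [Real.norm_eq_abs, Real.abs_exp, Real.exp_add]
  have e : ∀ u : ℝ, Real.exp (2 * u) = Real.exp u ^ 2 := fun u => by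
    rw [two_mul, Real.exp_add, pow_two]
  simp only [Pi.add_apply, mul_assoc, e]
  nlinarith [sq_nonneg (Real.exp (a * fieldSum X s x ω) - Real.exp (b * fieldSum X t y ω)),
    sq_nonneg (Real.exp (a * fieldSum X s x ω)), sq_nonneg (Real.exp (b * fieldSum X t y ω))]

lemma integral_exp_pair_eq_prod [IsProbabilityMeasure P] (h : IsLogCorrelatedSequence P X)
    (w₁ w₂ : ℂ) (s : Finset ℕ) (x y : unitCube d) :
    ∫ ω, Complex.exp (w₁ * (fieldSum X s x ω : ℂ) + w₂ * (fieldSum X s y ω : ℂ)) ∂P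
      = ∏ k ∈ s, ∫ ω, Complex.exp (w₁ * X k x ω + w₂ * X k y ω) ∂P := by
  simp only [Complex.exp_add, exp_fieldSum, ← Finset.prod_mul_distrib]
  refine integral_prod_of_disjoint h.fields h.indep (fun k => ?_) s
  exact (measurable_cexp_mul w₁ (measurable_fieldSigma (Set.mem_singleton k) x)).mul
    (measurable_cexp_mul w₂ (measurable_fieldSigma (Set.mem_singleton k) y))

/-- By independence the transform is a product of Gaussian factors and of factors within `K * (ρ k x
+ ρ k y)` of `1`. Since `1 + t ≤ e^t` and the `ρ` have uniformly bounded sums, the latter contribute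
a bounded constant. -/
lemma IsLogCorrelatedSequence.exists_laplace_upper [IsProbabilityMeasure P]
    (h : IsLogCorrelatedSequence P X) {B : ℝ} (hB : 0 ≤ B) :
    ∃ C : ℝ, 0 < C ∧ ∀ (s : Finset ℕ) x y (w₁ w₂ : ℂ), ‖w₁‖ ≤ B → ‖w₂‖ ≤ B →
      ‖∫ ω, Complex.exp (w₁ * (fieldSum X s x ω : ℂ) + w₂ * (fieldSum X s y ω : ℂ)) ∂P‖
        ≤ C * Real.exp ((∑ k ∈ s, quad P X k w₁ w₂ x y).re / 2) := by
  obtain ⟨ρ, R, hR, hρ, hsum, -, hexp⟩ := h.exists_gaussian_error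
  obtain ⟨K, hK, hq⟩ := hexp B hB
  refine ⟨Real.exp (K * (R + R)), Real.exp_pos _, fun s x y w₁ w₂ h₁ h₂ => ?_⟩
  rw [integral_exp_pair_eq_prod h, norm_prod]
  have hk : ∀ k ∈ s, ‖∫ ω, Complex.exp (w₁ * X k x ω + w₂ * X k y ω) ∂P‖
      ≤ Real.exp (K * (ρ k x + ρ k y)) * Real.exp ((quad P X k w₁ w₂ x y).re / 2) := by
    intro k _
    set E := ∫ ω, Complex.exp (w₁ * X k x ω + w₂ * X k y ω) ∂P
    set q := Complex.exp (-(quad P X k w₁ w₂ x y / 2)) * E with hqd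
    have h1 : ‖q‖ ≤ Real.exp (K * (ρ k x + ρ k y)) := by
      have h2 := hq k x y w₁ w₂ h₁ h₂
      have h3 : ‖q‖ ≤ ‖q - 1‖ + 1 := by simpa using norm_add_le (q - 1) 1
      linarith [Real.add_one_le_exp (K * (ρ k x + ρ k y))]
    have h2 : E = q * Complex.exp (quad P X k w₁ w₂ x y / 2) := by
      rw [hqd, mul_right_comm, ← Complex.exp_add]; simp
    rw [h2, norm_mul, Complex.norm_exp]
    have h3 : (quad P X k w₁ w₂ x y / 2).re = (quad P X k w₁ w₂ x y).re / 2 := by simp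
    rw [h3]
    gcongr
  refine (Finset.prod_le_prod (fun _ _ => norm_nonneg _) hk).trans ?_
  rw [Finset.prod_mul_distrib, ← Real.exp_sum, ← Real.exp_sum, ← Finset.sum_div, Complex.re_sum,
    ← Finset.mul_sum, Finset.sum_add_distrib]
  gcongr
  exacts [hsum s x, hsum s y]

/-- The lower counterpart of `1 + t ≤ e^t`. For `t ≤ 1/2` it follows from `1 - t ≥ e^(-2t)`; for
larger `t` the floor takes over, as `c ≥ c^(2t)`. -/
lemma exp_neg_le_of_one_sub_le {t q c : ℝ} (ht : 0 ≤ t) (hc : 0 < c) (hc1 : c ≤ 1)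
    (h1 : 1 - t ≤ q) (h2 : c ≤ q) : Real.exp (-((2 - 2 * Real.log c) * t)) ≤ q := by
  have hlog : Real.log c ≤ 0 := Real.log_nonpos hc.le hc1
  rcases le_total t (1 / 2) with h | h
  · refine le_trans ?_ h1
    have h3 : Real.exp (-((2 - 2 * Real.log c) * t)) ≤ Real.exp (-(2 * t)) := by
      apply Real.exp_le_exp.2; nlinarith
    refine h3.trans ?_
    rw [Real.exp_neg, inv_le_comm₀ (Real.exp_pos _) (by linarith), inv_le_iff_one_le_mul₀ (by linarith)]
    nlinarith [Real.add_one_le_exp (2 * t)]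
  · refine le_trans ?_ h2
    rw [← Real.le_log_iff_exp_le hc]
    nlinarith

lemma IsLogCorrelatedSequence.one_le_integral_exp [IsProbabilityMeasure P]
    (h : IsLogCorrelatedSequence P X) (b : ℝ) (k : ℕ) (x : unitCube d) :
    1 ≤ ∫ ω, Real.exp (b * X k x ω) ∂P := by
  have hi : Integrable (X k x) P := (h.log.memLp_two k x).integrable (by norm_num)
  have : ∫ ω, (1 + b * X k x ω) ∂P = 1 := by
    rw [integral_add (integrable_const _) (hi.const_mul _), integral_const_mul, h.centered]
    simp
  rw [← this]
  refine integral_mono ((integrable_const _).add (hi.const_mul _)) (h.integrable_exp_mul b k x) ?_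
  intro ω
  simp only
  linarith [Real.add_one_le_exp (b * X k x ω)]

/-- At a real parameter the transform of a centered variable is at least `1`, and an imaginary part
of size `τ` moves it by at most `τ * K`, where `K` bounds the moment of `e^((B+1)|X|)`. The width
`τ` thus works for all fields and points at once. -/
lemma IsLogCorrelatedSequence.exists_half_le [IsProbabilityMeasure P]
    (h : IsLogCorrelatedSequence P X) {B : ℝ} (hB : 0 ≤ B) :
    ∃ τ : ℝ, 0 < τ ∧ τ ≤ 1 ∧ ∀ k x (β : ℂ), |β.re| ≤ B → |β.im| ≤ τ →
      1 / 2 ≤ ‖∫ ω, Complex.exp (β * X k x ω) ∂P‖ := by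
  obtain ⟨K, hK, hKb⟩ := UniformExpMoments.exists_bound h.fields h.expMoment (B + 1)
  refine ⟨1 / (2 * (K + 1)), by positivity, ?_, fun k x β hre him => ?_⟩
  · rw [div_le_one (by positivity)]; linarith
  have hm := h.fields.measurable k x
  have hi := h.integrable_exp_abs (B + 1) k x
  have hiK : ∫ ω, Real.exp ((B + 1) * |X k x ω|) ∂P ≤ K := by
    rw [integral_eq_lintegral_of_nonneg_ae (ae_of_all _ fun _ => by positivity) hi.1]
    exact ENNReal.toReal_le_of_le_ofReal hK (hKb k x)
  have hn : ∀ ω, ‖Complex.exp (β * X k x ω)‖ = Real.exp (β.re * X k x ω) := fun ω => by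
    rw [Complex.norm_exp]; simp
  have hie : Integrable (fun ω => Complex.exp (β * X k x ω)) P :=
    (h.integrable_exp_mul β.re k x).mono' (by fun_prop) (ae_of_all _ fun ω => (hn ω).le)
  have hir : Integrable (fun ω => Complex.exp (β.re * X k x ω)) P := by
    have := (h.integrable_exp_mul β.re k x).ofReal (𝕜 := ℂ)
    refine this.congr (ae_of_all _ fun ω => ?_)
    simp
  have hre1 : 1 ≤ ‖∫ ω, Complex.exp (β.re * X k x ω) ∂P‖ := by
    have e : ∫ ω, Complex.exp (β.re * X k x ω) ∂P
        = ((∫ ω, Real.exp (β.re * X k x ω) ∂P : ℝ) : ℂ) := by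
      rw [← integral_complex_ofReal]; simp
    rw [e, Complex.norm_real]
    exact (h.one_le_integral_exp β.re k x).trans (le_abs_self _)
  have hdiff : ‖∫ ω, Complex.exp (β * X k x ω) ∂P - ∫ ω, Complex.exp (β.re * X k x ω) ∂P‖
      ≤ 1 / 2 := by
    rw [← integral_sub hie hir]
    refine (norm_integral_le_of_norm_le (hi.const_mul |β.im|) (ae_of_all _ fun ω => ?_)).trans ?_
    · set v := X k x ω
      have e1 : Complex.exp (β * v) = Complex.exp (β.re * v) * Complex.exp (Complex.I * (β.im * v : ℝ)) := by
        rw [← Complex.exp_add]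
        congr 1
        conv_lhs => rw [← Complex.re_add_im β]
        push_cast; ring
      have e2 : ‖Complex.exp (β.re * v)‖ ≤ Real.exp (B * |v|) := by
        rw [Complex.norm_exp]
        simp only [Complex.mul_re, Complex.ofReal_re, Complex.ofReal_im, mul_zero, sub_zero]
        refine Real.exp_le_exp.2 ((le_abs_self _).trans ?_)
        rw [abs_mul]; gcongr
      have e3 : ‖Complex.exp (Complex.I * (β.im * v : ℝ)) - 1‖ ≤ |β.im| * |v| := by
        refine Real.norm_exp_I_mul_ofReal_sub_one_le.trans ?_
        rw [Real.norm_eq_abs, abs_mul]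
      have e4 : |v| ≤ Real.exp |v| := by linarith [Real.add_one_le_exp |v|]
      calc _ = ‖Complex.exp (β.re * v)‖ * ‖Complex.exp (Complex.I * (β.im * v : ℝ)) - 1‖ := by
            rw [← norm_mul, mul_sub, mul_one, ← e1]
        _ ≤ Real.exp (B * |v|) * (|β.im| * Real.exp |v|) := by
            refine mul_le_mul e2 (e3.trans ?_) (norm_nonneg _) (Real.exp_pos _).le
            gcongr
        _ = |β.im| * Real.exp ((B + 1) * |v|) := by rw [add_mul, Real.exp_add, one_mul]; ring
    · rw [integral_const_mul]
      have hp : 0 ≤ ∫ ω, Real.exp ((B + 1) * |X k x ω|) ∂P := integral_nonneg fun _ => by positivity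
      calc _ ≤ 1 / (2 * (K + 1)) * K := by gcongr
        _ ≤ 1 / 2 := by
          rw [div_mul_eq_mul_div, one_mul, div_le_div_iff₀ (by positivity) (by norm_num)]; linarith
  have := norm_sub_norm_le (∫ ω, Complex.exp (β.re * X k x ω) ∂P)
    (∫ ω, Complex.exp (β * X k x ω) ∂P)
  rw [norm_sub_rev] at this
  linarith

/-- The relative errors are summable, but individual ones may exceed `1` and then do not exclude a
zero. For those factors the floor from `exists_half_le` is used, and `exp_neg_le_of_one_sub_le`
treats both cases together. -/
lemma IsLogCorrelatedSequence.exists_laplace_lower [IsProbabilityMeasure P]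
    (h : IsLogCorrelatedSequence P X) {B : ℝ} (hB : 0 ≤ B) :
    ∃ τ : ℝ, 0 < τ ∧ τ ≤ 1 ∧ ∃ c : ℝ, 0 < c ∧ ∀ (s : Finset ℕ) x (β : ℂ), |β.re| ≤ B → |β.im| ≤ τ →
      c * Real.exp ((β ^ 2).re * (∑ k ∈ s, cov P X k x x) / 2) ≤ ‖laplace P X s β x‖ := by
  obtain ⟨ρ, R, hR, hρ, hsum, hcov, hexp⟩ := h.exists_gaussian_error
  obtain ⟨τ, hτ, hτ1, hhalf⟩ := h.exists_half_le hB
  obtain ⟨K, hK, hq⟩ := hexp (B + 1) (by linarith)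
  set c₀ := 1 / 2 * Real.exp (-((B + 1) ^ 2 * R / 2)) with hc₀
  have hc0 : 0 < c₀ := by positivity
  have hc1 : c₀ ≤ 1 := by
    have : Real.exp (-((B + 1) ^ 2 * R / 2)) ≤ 1 := Real.exp_le_one_iff.2 (by
      have : 0 ≤ (B + 1) ^ 2 * R / 2 := by positivity
      linarith)
    rw [hc₀]; linarith
  set L := 2 - 2 * Real.log c₀
  have hL : 0 ≤ L := by have := Real.log_nonpos hc0.le hc1; simp only [L]; linarith
  refine ⟨τ, hτ, hτ1, Real.exp (-(L * (K * (R + R)))), Real.exp_pos _, fun s x β hre him => ?_⟩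
  have hβ : ‖β‖ ≤ B + 1 := (Complex.norm_le_abs_re_add_abs_im β).trans (by linarith)
  rw [laplace_eq_prod h.fields h.indep, norm_prod]
  have hk : ∀ k ∈ s, Real.exp (-(L * (K * (ρ k x + ρ k x))))
      * Real.exp ((β ^ 2).re * cov P X k x x / 2) ≤ ‖∫ ω, Complex.exp (β * X k x ω) ∂P‖ := by
    intro k _
    have h1 := hq k x x β 0 hβ (by simpa using by linarith)
    have hh := hhalf k x β hre him
    simp only [quad, zero_mul, add_zero, mul_zero, ne_eq, OfNat.ofNat_ne_zero, not_false_eq_true,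
      zero_pow] at h1
    set E := ∫ ω, Complex.exp (β * X k x ω) ∂P
    set q := Complex.exp (-(β ^ 2 * (cov P X k x x : ℂ) / 2)) * E with hqd
    have hre2 : (β ^ 2 * (cov P X k x x : ℂ) / 2).re = (β ^ 2).re * cov P X k x x / 2 := by
      simp
    have hqn : ‖q‖ = Real.exp (-((β ^ 2).re * cov P X k x x / 2)) * ‖E‖ := by
      rw [hqd, norm_mul, Complex.norm_exp, Complex.neg_re, hre2]
    have h2 : 1 - K * (ρ k x + ρ k x) ≤ ‖q‖ := by
      have : ‖(1 : ℂ)‖ - ‖q‖ ≤ ‖1 - q‖ := norm_sub_norm_le _ _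
      rw [norm_one, norm_sub_rev] at this
      linarith
    have h3 : c₀ ≤ ‖q‖ := by
      rw [hqn, hc₀, mul_comm]
      have h4 : (β ^ 2).re ≤ (B + 1) ^ 2 := (Complex.re_le_norm _).trans (by
        rw [norm_pow]; gcongr)
      have h5 : (β ^ 2).re * cov P X k x x ≤ (B + 1) ^ 2 * R := by
        have := cov_self_nonneg (P := P) (X := X) k x
        calc _ ≤ (B + 1) ^ 2 * cov P X k x x := by gcongr
          _ ≤ _ := by gcongr; exact hcov k x
      gcongr
    have h4 := exp_neg_le_of_one_sub_le (t := K * (ρ k x + ρ k x))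
      (mul_nonneg hK (add_nonneg (hρ k x) (hρ k x))) hc0 hc1 h2 h3
    calc _ ≤ ‖q‖ * Real.exp ((β ^ 2).re * cov P X k x x / 2) := by gcongr
      _ = ‖E‖ := by rw [hqn, mul_right_comm, ← Real.exp_add]; simp
  refine le_trans ?_ (Finset.prod_le_prod (fun _ _ => by positivity) hk)
  rw [Finset.prod_mul_distrib, ← Real.exp_sum, ← Real.exp_sum, ← Finset.sum_div,
    ← Finset.mul_sum, Finset.sum_neg_distrib, ← Finset.mul_sum, ← Finset.mul_sum,
    Finset.sum_add_distrib]
  gcongr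
  exacts [hsum s x, hsum s x]

end LaplaceBounds

end Chaos

namespace Chaos

/-! ### Decorrelation, constants for blocks, and levels of unit variance. -/

section Levels

variable {d : ℕ} {Ω : Type*} [mΩ : MeasurableSpace Ω] {P : Measure Ω}
  {X : ℕ → unitCube d → Ω → ℝ}

lemma varSum_eq (n : ℕ) :
    varSum P X n = ∑ k ∈ Finset.range n, cov P X k (origin d) (origin d) := by
  simp only [varSum, cov, pow_two]

lemma varSum_zero : varSum P X 0 = 0 := by simp [varSum]

lemma varSum_mono : Monotone (varSum P X) := by
  refine monotone_nat_of_le_succ fun n => ?_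
  rw [varSum_eq, varSum_eq, Finset.sum_range_succ]
  linarith [cov_self_nonneg (P := P) (X := X) n (origin d)]

lemma varSum_nonneg (n : ℕ) : 0 ≤ varSum P X n :=
  varSum_zero.symm.le.trans (varSum_mono (Nat.zero_le n))

/-- Subtract the covariance estimate at `m` from the one at `n`. On the diagonal the minimum is the
variance at the origin; off the diagonal, once the logarithm is below the variance at `m`, both
minima equal the logarithm and cancel. -/
lemma IsLogCorrelatedSequence.exists_cov_sum (h : IsLogCorrelatedSequence P X) :
    ∃ δ C : ℝ, 0 < δ ∧ δ ≤ 1 ∧ 0 < C ∧ ∀ m n, m ≤ n →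
      (∀ x, |∑ k ∈ Finset.Ico m n, cov P X k x x - (varSum P X n - varSum P X m)| ≤ C) ∧
      (∀ x y, x ≠ y → dist x y ≤ δ → Real.log (1 / dist x y) ≤ varSum P X m →
        |∑ k ∈ Finset.Ico m n, cov P X k x y| ≤ C) := by
  obtain ⟨δ, hδ, C, hC, hcov⟩ := h.log.covariance
  -- Capping `δ` at `1` makes the logarithm nonnegative, which settles the empty sum: the hypothesis
  -- only covers `n ≥ 1`.
  refine ⟨min δ 1, 2 * C, by positivity, min_le_right _ _, by positivity, fun m n hmn => ?_⟩
  have h0 : ∀ n, ∀ x y : unitCube d, dist x y ≤ min δ 1 →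
      |(∑ k ∈ Finset.range n, cov P X k x y) - truncLog x y (varSum P X n)| ≤ C := by
    intro n x y hxy
    rcases Nat.eq_zero_or_pos n with rfl | hn
    · rw [varSum_zero, truncLog]
      split_ifs with hxy'
      · simpa using hC.le
      · have : 0 ≤ Real.log (1 / dist x y) := by
          have hd : 0 < dist x y := dist_pos.2 hxy'
          refine Real.log_nonneg ?_
          rw [le_div_iff₀ hd, one_mul]
          exact hxy.trans (min_le_right _ _)
        rw [min_eq_right this]
        simpa using hC.le
    · exact hcov n hn x y (hxy.trans (min_le_left _ _))
  refine ⟨fun x => ?_, fun x y hxy hd hl => ?_⟩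
  · have hxx : dist x x ≤ min δ 1 := by rw [dist_self]; positivity
    have h1 := abs_le.1 (h0 n x x hxx)
    have h2 := abs_le.1 (h0 m x x hxx)
    simp only [truncLog, if_true] at h1 h2
    rw [Finset.sum_Ico_eq_sub _ hmn, abs_le]
    constructor <;> linarith [h1.1, h1.2, h2.1, h2.2]
  · have h1 := abs_le.1 (h0 n x y hd)
    have h2 := abs_le.1 (h0 m x y hd)
    simp only [truncLog, if_neg hxy] at h1 h2
    rw [min_eq_left (hl.trans (varSum_mono hmn))] at h1
    rw [min_eq_left hl] at h2
    rw [Finset.sum_Ico_eq_sub _ hmn, abs_le]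
    constructor <;> linarith [h1.1, h1.2, h2.1, h2.2]

/-- Two points are decorrelated from the index `m` on. -/
def Decorrelated (P : Measure Ω) (X : ℕ → unitCube d → Ω → ℝ) (δ : ℝ) (m : ℕ)
    (x y : unitCube d) : Prop :=
  x ≠ y ∧ dist x y ≤ δ ∧ Real.log (1 / dist x y) ≤ varSum P X m

lemma Decorrelated.mono {δ : ℝ} {m n : ℕ} {x y : unitCube d} (h : Decorrelated P X δ m x y)
    (hmn : m ≤ n) : Decorrelated P X δ n x y :=
  ⟨h.1, h.2.1, h.2.2.trans (varSum_mono hmn)⟩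

/-- Constants in Gaussian-type bounds of the Laplace transforms of blocks of fields. -/
structure BlockBounds (P : Measure Ω) (X : ℕ → unitCube d → Ω → ℝ) (δ B τ C : ℝ) : Prop where
  one_le : 1 ≤ C
  lower : ∀ m n, m ≤ n → ∀ x (β : ℂ), |β.re| ≤ B → |β.im| ≤ τ →
    Real.exp ((β.re ^ 2 - β.im ^ 2) * (varSum P X n - varSum P X m) / 2)
      ≤ C * ‖laplace P X (Finset.Ico m n) β x‖
  upper : ∀ m n, m ≤ n → ∀ x (a : ℝ), |a| ≤ B →
    ∫ ω, Real.exp (a * fieldSum X (Finset.Ico m n) x ω) ∂P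
      ≤ C * Real.exp (a ^ 2 * (varSum P X n - varSum P X m) / 2)
  pair : ∀ m n, m ≤ n → ∀ x y, Decorrelated P X δ m x y → ∀ w₁ w₂ : ℂ, ‖w₁‖ ≤ B → ‖w₂‖ ≤ B →
    ‖∫ ω, Complex.exp (w₁ * (fieldSum X (Finset.Ico m n) x ω : ℂ)
        + w₂ * (fieldSum X (Finset.Ico m n) y ω : ℂ)) ∂P‖
      ≤ C * Real.exp (((w₁ ^ 2).re + (w₂ ^ 2).re) * (varSum P X n - varSum P X m) / 2)

lemma BlockBounds.pair_real {δ B τ C : ℝ} (h : BlockBounds P X δ B τ C) {m n : ℕ} (hmn : m ≤ n)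
    {x y : unitCube d} (hxy : Decorrelated P X δ m x y) {a b : ℝ} (ha : |a| ≤ B) (hb : |b| ≤ B) :
    ∫ ω, Real.exp (a * fieldSum X (Finset.Ico m n) x ω + b * fieldSum X (Finset.Ico m n) y ω) ∂P
      ≤ C * Real.exp ((a ^ 2 + b ^ 2) * (varSum P X n - varSum P X m) / 2) := by
  have := h.pair m n hmn x y hxy a b (by simpa using ha) (by simpa using hb)
  have e : ∫ ω, Complex.exp ((a : ℂ) * (fieldSum X (Finset.Ico m n) x ω : ℂ)
        + (b : ℂ) * (fieldSum X (Finset.Ico m n) y ω : ℂ)) ∂P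
      = ((∫ ω, Real.exp (a * fieldSum X (Finset.Ico m n) x ω
        + b * fieldSum X (Finset.Ico m n) y ω) ∂P : ℝ) : ℂ) := by
    rw [← integral_complex_ofReal]; simp
  rw [e, Complex.norm_real] at this
  refine (le_abs_self _).trans (this.trans_eq ?_)
  norm_cast

/-- The coefficients of the covariances in the Gaussian exponents are at most `(B + 1) ^ 2`, so
replacing covariance sums by increments of the variance at the origin costs only a constant. The
distance `δ` does not depend on `B`. -/
lemma IsLogCorrelatedSequence.exists_blockBounds [IsProbabilityMeasure P]
    (h : IsLogCorrelatedSequence P X) :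
    ∃ δ : ℝ, 0 < δ ∧ δ ≤ 1 ∧ ∀ B : ℝ, 0 ≤ B →
      ∃ τ C : ℝ, 0 < τ ∧ τ ≤ 1 ∧ BlockBounds P X δ B τ C := by
  obtain ⟨δ, C₀, hδ, hδ1, hC₀, hcov⟩ := h.exists_cov_sum
  refine ⟨δ, hδ, hδ1, fun B hB => ?_⟩
  obtain ⟨τ, hτ, hτ1, c, hc, hlow⟩ := h.exists_laplace_lower hB
  obtain ⟨C₁, hC₁, hup⟩ := h.exists_laplace_upper hB
  set C₂ := Real.exp ((B + 1) ^ 2 * C₀ * 2) with hC₂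
  have h12 : (B + 1) ^ 2 * C₀ / 2 ≤ (B + 1) ^ 2 * C₀ * 2 := by
    have : 0 ≤ (B + 1) ^ 2 * C₀ := by positivity
    linarith
  have hmul : ∀ r M u v : ℝ, |r| ≤ M → |v - u| ≤ C₀ → r * v ≤ r * u + M * C₀ := by
    intro r M u v hr hv
    have hM : 0 ≤ M := (abs_nonneg r).trans hr
    have : r * (v - u) ≤ M * C₀ := (le_abs_self _).trans (by rw [abs_mul]; gcongr)
    linarith
  refine ⟨τ, 1 + C₂ / c + C₁ * C₂, hτ, hτ1, ⟨?_, ?_, ?_, ?_⟩⟩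
  · have : 0 ≤ C₂ / c := by positivity
    have : 0 ≤ C₁ * C₂ := by positivity
    linarith
  · intro m n hmn x β hre him
    have h1 := hlow (Finset.Ico m n) x β hre him
    have h2 := (hcov m n hmn).1 x
    set s := ∑ k ∈ Finset.Ico m n, cov P X k x x
    set u := varSum P X n - varSum P X m
    have hr2 : (β ^ 2).re = β.re ^ 2 - β.im ^ 2 := by simp [pow_two]
    rw [hr2] at h1
    have h3 : (β.re ^ 2 - β.im ^ 2) * u ≤ (β.re ^ 2 - β.im ^ 2) * s + (B + 1) ^ 2 * C₀ := by
      refine hmul _ _ _ _ ?_ (by rwa [abs_sub_comm])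
      rw [abs_le]
      have : β.re ^ 2 ≤ B ^ 2 := sq_le_sq' (abs_le.1 hre).1 (abs_le.1 hre).2
      have : β.im ^ 2 ≤ 1 ^ 2 := sq_le_sq' (by linarith [(abs_le.1 him).1]) (by linarith [(abs_le.1 him).2])
      constructor <;> nlinarith [sq_nonneg β.re, sq_nonneg β.im]
    have h4 : Real.exp ((β.re ^ 2 - β.im ^ 2) * u / 2) ≤
        C₂ * Real.exp ((β.re ^ 2 - β.im ^ 2) * s / 2) := by
      rw [hC₂, ← Real.exp_add, Real.exp_le_exp]; linarith
    calc _ ≤ C₂ * Real.exp ((β.re ^ 2 - β.im ^ 2) * s / 2) := h4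
      _ = C₂ / c * (c * Real.exp ((β.re ^ 2 - β.im ^ 2) * s / 2)) := by field_simp
      _ ≤ C₂ / c * ‖laplace P X (Finset.Ico m n) β x‖ := by gcongr
      _ ≤ _ := by
        refine mul_le_mul_of_nonneg_right ?_ (norm_nonneg _)
        have : 0 ≤ C₁ * C₂ := by positivity
        linarith
  · intro m n hmn x a ha
    have h1 := hup (Finset.Ico m n) x x a 0 (by simpa using ha) (by simpa using hB)
    have h2 := (hcov m n hmn).1 x
    simp only [quad, zero_mul, add_zero, mul_zero, ne_eq, OfNat.ofNat_ne_zero, not_false_eq_true,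
      zero_pow, ← Finset.mul_sum] at h1
    set s := ∑ k ∈ Finset.Ico m n, cov P X k x x with hs
    set u := varSum P X n - varSum P X m
    have e : ∫ ω, Complex.exp ((a : ℂ) * (fieldSum X (Finset.Ico m n) x ω : ℂ)) ∂P
        = ((∫ ω, Real.exp (a * fieldSum X (Finset.Ico m n) x ω) ∂P : ℝ) : ℂ) := by
      rw [← integral_complex_ofReal]; simp
    have e2 : ((a : ℂ) ^ 2 * ∑ k ∈ Finset.Ico m n, (cov P X k x x : ℂ)).re = a ^ 2 * s := by
      rw [hs]; norm_cast
    rw [e, Complex.norm_real, e2] at h1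
    refine (le_abs_self _).trans (h1.trans ?_)
    have h3 : a ^ 2 * s ≤ a ^ 2 * u + (B + 1) ^ 2 * C₀ := by
      refine hmul _ _ _ _ ?_ h2
      rw [abs_pow]; gcongr; linarith
    have h4 : Real.exp (a ^ 2 * s / 2) ≤ C₂ * Real.exp (a ^ 2 * u / 2) := by
      rw [hC₂, ← Real.exp_add, Real.exp_le_exp]; linarith
    calc _ ≤ C₁ * (C₂ * Real.exp (a ^ 2 * u / 2)) := by gcongr
      _ = C₁ * C₂ * Real.exp (a ^ 2 * u / 2) := by ring
      _ ≤ _ := by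
        gcongr
        have : 0 ≤ C₂ / c := by positivity
        linarith
  · intro m n hmn x y hxy w₁ w₂ hw₁ hw₂
    have h1 := hup (Finset.Ico m n) x y w₁ w₂ hw₁ hw₂
    have h2 := (hcov m n hmn).1 x
    have h3 := (hcov m n hmn).1 y
    have h4 := (hcov m n hmn).2 x y hxy.1 hxy.2.1 hxy.2.2
    set sx := ∑ k ∈ Finset.Ico m n, cov P X k x x with hsx
    set sy := ∑ k ∈ Finset.Ico m n, cov P X k y y with hsy
    set sxy := ∑ k ∈ Finset.Ico m n, cov P X k x y with hsxy
    set u := varSum P X n - varSum P X m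
    have e : (∑ k ∈ Finset.Ico m n, quad P X k w₁ w₂ x y).re
        = (w₁ ^ 2).re * sx + (2 * w₁ * w₂).re * sxy + (w₂ ^ 2).re * sy := by
      simp only [quad, Finset.sum_add_distrib, ← Finset.mul_sum, ← Complex.ofReal_sum]
      simp only [Complex.add_re, Complex.re_mul_ofReal]
      rfl
    rw [e] at h1
    refine h1.trans ?_
    have hw : ∀ w w' : ℂ, ‖w‖ ≤ B → ‖w'‖ ≤ B → |(w * w').re| ≤ (B + 1) ^ 2 := fun w w' hw hw' => by
      refine (Complex.abs_re_le_norm _).trans ?_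
      rw [norm_mul, pow_two]
      gcongr <;> linarith
    have a1 := hmul (w₁ ^ 2).re ((B + 1) ^ 2) u sx (by rw [pow_two w₁]; exact hw _ _ hw₁ hw₁) h2
    have a2 := hmul (w₂ ^ 2).re ((B + 1) ^ 2) u sy (by rw [pow_two w₂]; exact hw _ _ hw₂ hw₂) h3
    have a3 := hmul (w₁ * w₂).re ((B + 1) ^ 2) 0 sxy (hw _ _ hw₁ hw₂) (by simpa using h4)
    have e2 : (2 * w₁ * w₂).re = 2 * (w₁ * w₂).re := by rw [mul_assoc]; simp
    have h5 : Real.exp (((w₁ ^ 2).re * sx + (2 * w₁ * w₂).re * sxy + (w₂ ^ 2).re * sy) / 2)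
        ≤ C₂ * Real.exp (((w₁ ^ 2).re + (w₂ ^ 2).re) * u / 2) := by
      rw [hC₂, ← Real.exp_add, Real.exp_le_exp, e2]; linarith
    calc _ ≤ C₁ * (C₂ * Real.exp (((w₁ ^ 2).re + (w₂ ^ 2).re) * u / 2)) := by gcongr
      _ = C₁ * C₂ * Real.exp (((w₁ ^ 2).re + (w₂ ^ 2).re) * u / 2) := by ring
      _ ≤ _ := by
        gcongr
        have : 0 ≤ C₂ / c := by positivity
        linarith

/-- Levels at which the variance at the origin passes the natural numbers. -/
structure IsLevels (P : Measure Ω) (X : ℕ → unitCube d → Ω → ℝ) (N : ℕ → ℕ) (A : ℝ) : Prop where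
  zero : N 0 = 0
  mono : Monotone N
  lower : ∀ j : ℕ, (j : ℝ) ≤ varSum P X (N j)
  upper : ∀ j : ℕ, varSum P X (N j) ≤ j + A
  nonneg : 0 ≤ A
  unbounded : ∀ n, ∃ j, n ≤ N j

/-- `N j` is the first index at which the variance reaches `j`; the overshoot is at most the
variance of one field. -/
lemma IsLogCorrelatedSequence.exists_levels [IsProbabilityMeasure P]
    (h : IsLogCorrelatedSequence P X) : ∃ (N : ℕ → ℕ) (A : ℝ), IsLevels P X N A := by
  obtain ⟨ρ, R, hR, -, -, hcov, -⟩ := h.exists_control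
  have hex : ∀ j : ℕ, ∃ n, (j : ℝ) ≤ varSum P X n := fun j =>
    ((tendsto_atTop.1 h.log.variance_diverges j).exists)
  classical
  refine ⟨fun j => Nat.find (hex j), R, ?_, ?_, fun j => Nat.find_spec (hex j), ?_, hR, ?_⟩
  · exact (Nat.find_eq_zero _).2 (by simp [varSum_zero])
  · intro i j hij
    exact Nat.find_min' _ (le_trans (by exact_mod_cast hij) (Nat.find_spec (hex j)))
  · intro j
    have hmin := fun {m} => Nat.find_min (hex j) (m := m)
    rcases Nat.eq_zero_or_eq_succ_pred (Nat.find (hex j)) with h0 | h0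
    · simp only [h0, varSum_zero]; positivity
    · rw [h0]
      have h1 := hmin (m := (Nat.find (hex j)).pred) (by omega)
      have h2 := hcov (Nat.find (hex j)).pred (origin d)
      rw [varSum_eq, Finset.sum_range_succ, ← varSum_eq]
      linarith
  · intro n
    obtain ⟨j, hj⟩ := exists_nat_gt (varSum P X n)
    refine ⟨j, ?_⟩
    by_contra hlt
    push Not at hlt
    have := varSum_mono (P := P) (X := X) hlt.le
    have := Nat.find_spec (hex j)
    linarith

end Levels

end Chaos

namespace Chaos

/-! ### Two-point functions of normalized exponentials under a barrier. -/

section TwoPoint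

variable {d : ℕ} {Ω : Type*} [mΩ : MeasurableSpace Ω] {P : Measure Ω}
  {X : ℕ → unitCube d → Ω → ℝ}

/-- The normalized exponential of the block of fields with index in `[m, n)`. -/
noncomputable def blockExp (P : Measure Ω) (X : ℕ → unitCube d → Ω → ℝ) (m n : ℕ) (β : ℂ)
    (x : unitCube d) (ω : Ω) : ℂ :=
  Complex.exp (β * (fieldSum X (Finset.Ico m n) x ω : ℂ)) / laplace P X (Finset.Ico m n) β x

/-- The event that the partial sums started at level `l` stay below a line of slope `α` up to
level `j`. -/
def barrier (P : Measure Ω) (X : ℕ → unitCube d → Ω → ℝ) (N : ℕ → ℕ) (α : ℝ) (l j : ℕ)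
    (x : unitCube d) : Set Ω :=
  ⋂ i ∈ Finset.Ioc l j, {ω | fieldSum X (Finset.Ico (N l) (N i)) x ω
    ≤ α * (varSum P X (N i) - varSum P X (N l))}

lemma fieldSum_Ico_add {m k n : ℕ} (h₁ : m ≤ k) (h₂ : k ≤ n) (x : unitCube d) (ω : Ω) :
    fieldSum X (Finset.Ico m k) x ω + fieldSum X (Finset.Ico k n) x ω
      = fieldSum X (Finset.Ico m n) x ω :=
  Finset.sum_Ico_consecutive _ h₁ h₂

lemma fieldSum_empty (m : ℕ) (x : unitCube d) (ω : Ω) : fieldSum X (Finset.Ico m m) x ω = 0 := by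
  simp [fieldSum]

lemma measurable_blockExp {m n : ℕ} {s : Set ℕ} (h : Set.Ico m n ⊆ s) (β : ℂ) (x : unitCube d) :
    Measurable[fieldSigma X s] (blockExp P X m n β x) :=
  (measurable_cexp_mul β (measurable_fieldSum (by simpa using h) x)).div_const _

lemma measurableSet_barrier {N : ℕ → ℕ} (hN : Monotone N) {α : ℝ} {l j : ℕ} {s : Set ℕ}
    (h : Set.Ico (N l) (N j) ⊆ s) (x : unitCube d) :
    MeasurableSet[fieldSigma X s] (barrier P X N α l j x) := by
  refine Finset.measurableSet_biInter _ fun i hi => ?_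
  rw [Finset.mem_Ioc] at hi
  have hm : Measurable[fieldSigma X s] (fieldSum X (Finset.Ico (N l) (N i)) x) :=
    measurable_fieldSum (by
      rw [Finset.coe_Ico]
      exact (Set.Ico_subset_Ico_right (hN hi.2)).trans h) x
  exact hm measurableSet_Iic

lemma barrier_anti {N : ℕ → ℕ} {α : ℝ} {l i j : ℕ} (hij : i ≤ j) (x : unitCube d) :
    barrier P X N α l j x ⊆ barrier P X N α l i x :=
  Set.biInter_mono (fun _ hk => Finset.mem_Ioc.2
    ⟨(Finset.mem_Ioc.1 hk).1, (Finset.mem_Ioc.1 hk).2.trans hij⟩) fun _ _ => le_rfl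

lemma le_of_mem_barrier {N : ℕ → ℕ} {α : ℝ} {l j : ℕ} (hlj : l ≤ j) {x : unitCube d} {ω : Ω}
    (h : ω ∈ barrier P X N α l j x) :
    fieldSum X (Finset.Ico (N l) (N j)) x ω ≤ α * (varSum P X (N j) - varSum P X (N l)) := by
  rcases hlj.eq_or_lt with rfl | hlt
  · rw [fieldSum_empty]; simp
  · exact Set.mem_iInter₂.1 h j (Finset.mem_Ioc.2 ⟨hlt, le_rfl⟩)

lemma mem_barrier_succ {N : ℕ → ℕ} {α : ℝ} {l j : ℕ} {x : unitCube d} {ω : Ω}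
    (h : ω ∈ barrier P X N α l j x)
    (h' : fieldSum X (Finset.Ico (N l) (N (j + 1))) x ω
      ≤ α * (varSum P X (N (j + 1)) - varSum P X (N l))) :
    ω ∈ barrier P X N α l (j + 1) x := by
  refine Set.mem_iInter₂.2 fun i hi => ?_
  rw [Finset.mem_Ioc] at hi
  rcases hi.2.eq_or_lt with rfl | hlt
  · exact h'
  · exact Set.mem_iInter₂.1 h i (Finset.mem_Ioc.2 ⟨hi.1, Nat.lt_succ_iff.1 hlt⟩)

lemma laplace_mul [IsProbabilityMeasure P] (h : IsLogCorrelatedSequence P X) {m k n : ℕ}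
    (h₁ : m ≤ k) (h₂ : k ≤ n) (β : ℂ) (x : unitCube d) :
    laplace P X (Finset.Ico m k) β x * laplace P X (Finset.Ico k n) β x
      = laplace P X (Finset.Ico m n) β x := by
  simp only [laplace_eq_prod h.fields h.indep]
  exact Finset.prod_Ico_consecutive _ h₁ h₂

lemma blockExp_mul [IsProbabilityMeasure P] (h : IsLogCorrelatedSequence P X) {m k n : ℕ}
    (h₁ : m ≤ k) (h₂ : k ≤ n) (β : ℂ) (x : unitCube d) (ω : Ω) :
    blockExp P X m k β x ω * blockExp P X k n β x ω = blockExp P X m n β x ω := by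
  rw [blockExp, blockExp, blockExp, div_mul_div_comm, ← Complex.exp_add, laplace_mul h h₁ h₂,
    ← mul_add, ← Complex.ofReal_add, fieldSum_Ico_add h₁ h₂]

lemma norm_blockExp (m n : ℕ) (β : ℂ) (x : unitCube d) (ω : Ω) :
    ‖blockExp P X m n β x ω‖ = Real.exp (β.re * fieldSum X (Finset.Ico m n) x ω)
      / ‖laplace P X (Finset.Ico m n) β x‖ := by
  rw [blockExp, norm_div, Complex.norm_exp]
  simp

lemma BlockBounds.laplace_pos {δ B τ C : ℝ} (hb : BlockBounds P X δ B τ C) {m n : ℕ} (hmn : m ≤ n)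
    {β : ℂ} (hre : |β.re| ≤ B) (him : |β.im| ≤ τ) (x : unitCube d) :
    0 < ‖laplace P X (Finset.Ico m n) β x‖ := by
  have h1 := hb.lower m n hmn x β hre him
  have h2 := Real.exp_pos ((β.re ^ 2 - β.im ^ 2) * (varSum P X n - varSum P X m) / 2)
  by_contra h3
  have h4 : ‖laplace P X (Finset.Ico m n) β x‖ = 0 := le_antisymm (not_lt.1 h3) (norm_nonneg _)
  rw [h4] at h1
  linarith

lemma BlockBounds.inv_laplace_le {δ B τ C : ℝ} (hb : BlockBounds P X δ B τ C) {m n : ℕ}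
    (hmn : m ≤ n) {β : ℂ} (hre : |β.re| ≤ B) (him : |β.im| ≤ τ) (x : unitCube d) :
    ‖laplace P X (Finset.Ico m n) β x‖⁻¹
      ≤ C * Real.exp (-((β.re ^ 2 - β.im ^ 2) * (varSum P X n - varSum P X m) / 2)) := by
  have h1 := hb.lower m n hmn x β hre him
  rw [inv_le_iff_one_le_mul₀ (hb.laplace_pos hmn hre him x), Real.exp_neg, mul_right_comm,
    ← div_eq_mul_inv, le_div_iff₀ (Real.exp_pos _), one_mul]
  exact h1

lemma BlockBounds.norm_blockExp_le {δ B τ C : ℝ} (hb : BlockBounds P X δ B τ C) {m n : ℕ}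
    (hmn : m ≤ n) {β : ℂ} (hre : |β.re| ≤ B) (him : |β.im| ≤ τ) (x : unitCube d) (ω : Ω) :
    ‖blockExp P X m n β x ω‖
      ≤ C * Real.exp (β.re * fieldSum X (Finset.Ico m n) x ω
        - (β.re ^ 2 - β.im ^ 2) * (varSum P X n - varSum P X m) / 2) := by
  rw [norm_blockExp, div_eq_mul_inv, sub_eq_add_neg, Real.exp_add, mul_left_comm]
  gcongr
  exact hb.inv_laplace_le hmn hre him x


lemma integrable_blockExp_mul [IsProbabilityMeasure P]
    (h : IsLogCorrelatedSequence P X) (m n : ℕ) (β : ℂ)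
    (x y : unitCube d) :
    Integrable (fun ω => blockExp P X m n β x ω * (starRingEnd ℂ) (blockExp P X m n β y ω)) P := by
  have h1 := measurable_fieldSum' h.fields (Finset.Ico m n) x
  have h2 := measurable_fieldSum' h.fields (Finset.Ico m n) y
  refine ((h.integrable_exp_pair β.re β.re (Finset.Ico m n) (Finset.Ico m n) x y).mul_const
    (‖laplace P X (Finset.Ico m n) β x‖⁻¹ * ‖laplace P X (Finset.Ico m n) β y‖⁻¹)).mono' ?_
    (ae_of_all _ fun ω => le_of_eq ?_)
  · simp only [blockExp]
    exact Measurable.aestronglyMeasurable (by fun_prop)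
  · rw [norm_mul, RCLike.norm_conj, norm_blockExp, norm_blockExp, Real.exp_add]
    simp only [div_eq_mul_inv]
    ring

/-- After decorrelation, two-point functions are bounded. -/
lemma BlockBounds.norm_integral_blockExp_mul_le {δ B τ C : ℝ} (hb : BlockBounds P X δ B τ C)
    {m n : ℕ} (hmn : m ≤ n) {β : ℂ} (hre : |β.re| ≤ B) (him : |β.im| ≤ τ) (hB : ‖β‖ ≤ B)
    {x y : unitCube d} (hxy : Decorrelated P X δ m x y) :
    ‖∫ ω, blockExp P X m n β x ω * (starRingEnd ℂ) (blockExp P X m n β y ω) ∂P‖ ≤ C ^ 3 := by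
  set u := varSum P X n - varSum P X m
  have hC := hb.one_le
  have e : ∀ ω, blockExp P X m n β x ω * (starRingEnd ℂ) (blockExp P X m n β y ω)
      = Complex.exp (β * (fieldSum X (Finset.Ico m n) x ω : ℂ)
        + (starRingEnd ℂ) β * (fieldSum X (Finset.Ico m n) y ω : ℂ))
        * ((laplace P X (Finset.Ico m n) β x)⁻¹
          * ((starRingEnd ℂ) (laplace P X (Finset.Ico m n) β y))⁻¹) := by
    intro ω
    simp only [blockExp, Complex.exp_add, map_inv₀, ← Complex.exp_conj, map_mul,
      Complex.conj_ofReal, div_eq_mul_inv]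
    ring
  simp only [e]
  rw [integral_mul_const, norm_mul, norm_mul, norm_inv, norm_inv, RCLike.norm_conj]
  have h1 := hb.pair m n hmn x y hxy β ((starRingEnd ℂ) β) hB (by rwa [RCLike.norm_conj])
  -- The parameters at the two points are `β` and its conjugate, so the Gaussian exponent exactly
  -- cancels the two normalizers. Absolute values inside the integral would leave a growth `exp
  -- (β.im ^ 2 * u)`.
  have h2 : ((β ^ 2).re + ((starRingEnd ℂ) β ^ 2).re) * u / 2 = (β.re ^ 2 - β.im ^ 2) * u := by
    simp [pow_two]; ring
  rw [h2] at h1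
  have h3 := hb.inv_laplace_le hmn hre him x
  have h4 := hb.inv_laplace_le hmn hre him y
  calc _ ≤ (C * Real.exp ((β.re ^ 2 - β.im ^ 2) * u)) *
        ((C * Real.exp (-((β.re ^ 2 - β.im ^ 2) * u / 2))) *
          (C * Real.exp (-((β.re ^ 2 - β.im ^ 2) * u / 2)))) := by gcongr
    _ = C ^ 3 * (Real.exp ((β.re ^ 2 - β.im ^ 2) * u) *
        (Real.exp (-((β.re ^ 2 - β.im ^ 2) * u / 2)) *
          Real.exp (-((β.re ^ 2 - β.im ^ 2) * u / 2)))) := by ring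
    _ = C ^ 3 := by
      rw [← Real.exp_add, ← Real.exp_add]
      ring_nf
      simp

/-- Factorization of a two-point function at an intermediate index. -/
lemma setIntegral_blockExp_mul [IsProbabilityMeasure P]
    (h : IsLogCorrelatedSequence P X) {m k n : ℕ} (h₁ : m ≤ k)
    (h₂ : k ≤ n) (β : ℂ) (x y : unitCube d) {S : Set Ω}
    (hS : MeasurableSet[fieldSigma X (Set.Ico m k)] S) :
    ∫ ω in S, blockExp P X m n β x ω * (starRingEnd ℂ) (blockExp P X m n β y ω) ∂P
      = (∫ ω in S, blockExp P X m k β x ω * (starRingEnd ℂ) (blockExp P X m k β y ω) ∂P)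
        * ∫ ω, blockExp P X k n β x ω * (starRingEnd ℂ) (blockExp P X k n β y ω) ∂P := by
  have hS' : MeasurableSet S := fieldSigma_le h.fields _ hS
  rw [← integral_indicator hS', ← integral_indicator hS', ← integral_mul_of_disjoint h.fields
    h.indep (s := Set.Ico m k) (t := Set.Ico k n) (by
      rw [Set.disjoint_left]; intro a ha hb; exact absurd hb.1 (not_le.2 ha.2))]
  · refine integral_congr_ae (ae_of_all _ fun ω => ?_)
    by_cases hω : ω ∈ S
    · simp only [Set.indicator_of_mem hω, ← blockExp_mul h h₁ h₂, map_mul]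
      ring
    · simp only [Set.indicator_of_notMem hω, zero_mul]
  · exact ((measurable_blockExp le_rfl β x).mul (Complex.continuous_conj.measurable.comp
      (measurable_blockExp le_rfl β y))).indicator hS
  · exact (measurable_blockExp le_rfl β x).mul (Complex.continuous_conj.measurable.comp
      (measurable_blockExp le_rfl β y))

lemma norm_setIntegral_le_integral {F : Ω → ℂ} {g : Ω → ℝ} {S : Set Ω} (hS : MeasurableSet S)
    (hg : Integrable g P) (hg0 : ∀ ω, 0 ≤ g ω) (hFg : ∀ ω ∈ S, ‖F ω‖ ≤ g ω) :
    ‖∫ ω in S, F ω ∂P‖ ≤ ∫ ω, g ω ∂P := by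
  refine (norm_integral_le_of_norm_le hg.integrableOn ?_).trans
    (setIntegral_le_integral hg (ae_of_all _ hg0))
  exact (ae_restrict_iff' hS).2 (ae_of_all _ hFg)

/-- Exponents entering the truncated second moment estimate. -/
structure Exponents (B τ α η κ c : ℝ) (β : ℂ) : Prop where
  re_nonneg : 0 ≤ β.re
  norm_le : ‖β‖ ≤ B
  im_le : |β.im| ≤ τ
  eta_nonneg : 0 ≤ η
  re_add_le : β.re + η ≤ B
  decay_pos : 0 < c
  -- Growth rate per unit of variance while the two points move together: one exponential is capped
  -- by the barrier, the other is integrated.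
  energy : β.re * α - β.re ^ 2 / 2 + β.im ^ 2 ≤ κ
  kappa_nonneg : 0 ≤ κ
  -- Rate after decorrelation when one point crosses the line: exponential moments at `β.re` and at
  -- the tilted `β.re + η`, minus the gain `η * α` of the tilt and the normalizers.
  escape : β.re ^ 2 / 2 + (β.re + η) ^ 2 / 2 - η * α - (β.re ^ 2 - β.im ^ 2) ≤ -c

lemma Exponents.re_le {B τ α η κ c : ℝ} {β : ℂ} (he : Exponents B τ α η κ c β) : |β.re| ≤ B :=
  (Complex.abs_re_le_norm β).trans he.norm_le

/-- No decorrelation is used, so absolute values are taken. The barrier caps the exponential at `x`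
pointwise by `exp (β.re * α * u)`, and a one-point exponential moment remains at `y`. -/
lemma BlockBounds.norm_setIntegral_barrier_le [IsProbabilityMeasure P]
    (h : IsLogCorrelatedSequence P X)
    {δ B τ C α η κ c : ℝ} {β : ℂ} (hb : BlockBounds P X δ B τ C) (he : Exponents B τ α η κ c β)
    {N : ℕ → ℕ} (hN : Monotone N) {l j : ℕ} (hlj : l ≤ j) (x y : unitCube d) :
    ‖∫ ω in barrier P X N α l j x ∩ barrier P X N α l j y,
      blockExp P X (N l) (N j) β x ω * (starRingEnd ℂ) (blockExp P X (N l) (N j) β y ω) ∂P‖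
      ≤ C ^ 3 * Real.exp (κ * (varSum P X (N j) - varSum P X (N l))) := by
  have hC := hb.one_le
  have hmn := hN hlj
  set u := varSum P X (N j) - varSum P X (N l) with hu
  have hu0 : 0 ≤ u := sub_nonneg.2 (varSum_mono hmn)
  set D := C ^ 2 * Real.exp (β.re * (α * u) - (β.re ^ 2 - β.im ^ 2) * u) with hD
  have hg := (h.integrable_exp_fieldSum β.re (Finset.Ico (N l) (N j)) y).const_mul D
  refine (norm_setIntegral_le_integral (g := fun ω => D * Real.exp (β.re *
    fieldSum X (Finset.Ico (N l) (N j)) y ω)) ?_ hg (fun ω => by positivity) ?_).trans ?_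
  · exact fieldSigma_le h.fields _ ((measurableSet_barrier hN le_rfl x).inter
      (measurableSet_barrier hN le_rfl y))
  · rintro ω ⟨hx, -⟩
    have h1 := hb.norm_blockExp_le hmn he.re_le he.im_le x ω
    have h2 := hb.norm_blockExp_le hmn he.re_le he.im_le y ω
    have h3 := mul_le_mul_of_nonneg_left (le_of_mem_barrier hlj hx) he.re_nonneg
    rw [norm_mul, RCLike.norm_conj]
    refine (mul_le_mul h1 h2 (norm_nonneg _) (by positivity)).trans ?_
    rw [hD, mul_mul_mul_comm, ← Real.exp_add, ← pow_two, mul_assoc, ← Real.exp_add]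
    refine mul_le_mul_of_nonneg_left (Real.exp_le_exp.2 ?_) (by positivity)
    linarith
  · rw [integral_const_mul]
    have h1 := hb.upper _ _ hmn y β.re he.re_le
    calc _ ≤ D * (C * Real.exp (β.re ^ 2 * u / 2)) := by gcongr
      _ = C ^ 3 * Real.exp ((β.re * α - β.re ^ 2 / 2 + β.im ^ 2) * u) := by
        rw [hD, mul_mul_mul_comm, ← Real.exp_add]
        ring_nf
      _ ≤ _ := by
        gcongr
        exact he.energy

/-- Only `y` occurs before index `k`: there the exponential at `x` is already capped by the barrier.
After `k` the two points behave as if independent. -/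
lemma BlockBounds.integral_escape_le (h : IsLogCorrelatedSequence P X)
    {δ B τ C α η κ c : ℝ} {β : ℂ} (hb : BlockBounds P X δ B τ C) (he : Exponents B τ α η κ c β)
    {m k n : ℕ} (h₁ : m ≤ k) (h₂ : k ≤ n) {x y : unitCube d} (hxy : Decorrelated P X δ k x y) :
    ∫ ω, Real.exp (β.re * fieldSum X (Finset.Ico m k) y ω) *
      Real.exp (β.re * fieldSum X (Finset.Ico k n) x ω
        + (β.re + η) * fieldSum X (Finset.Ico k n) y ω) ∂P
      ≤ C ^ 2 * Real.exp (β.re ^ 2 * (varSum P X k - varSum P X m) / 2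
        + (β.re ^ 2 + (β.re + η) ^ 2) * (varSum P X n - varSum P X k) / 2) := by
  have hC := hb.one_le
  rw [integral_mul_of_disjoint h.fields h.indep (s := Set.Ico m k) (t := Set.Ico k n) (by
      rw [Set.disjoint_left]; intro a ha hb; exact absurd hb.1 (not_le.2 ha.2))]
  · have e1 := hb.upper m k h₁ y β.re he.re_le
    have e2 := hb.pair_real h₂ hxy he.re_le (b := β.re + η) (by
      rw [abs_of_nonneg (add_nonneg he.re_nonneg he.eta_nonneg)]; exact he.re_add_le)
    refine (mul_le_mul e1 e2 (integral_nonneg fun _ => (Real.exp_pos _).le) (by positivity)).trans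
      (le_of_eq ?_)
    rw [mul_mul_mul_comm, ← Real.exp_add, ← pow_two]
  · exact Real.measurable_exp.comp ((measurable_fieldSum (by simp) y).const_mul _)
  · exact Real.measurable_exp.comp (((measurable_fieldSum (by simp) x).const_mul _).add
      ((measurable_fieldSum (by simp) y).const_mul _))

lemma Decorrelated.symm {δ : ℝ} {m : ℕ} {x y : unitCube d} (h : Decorrelated P X δ m x y) :
    Decorrelated P X δ m y x :=
  ⟨h.1.symm, by rw [dist_comm]; exact h.2.1, by rw [dist_comm]; exact h.2.2⟩

/-- If `y` crosses the line at level `j + 1` but was below it at level `q`, its increment between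
them exceeds `α * v`, so the Chernoff factor `exp (η * (increment - α * v)) ≥ 1` may be inserted.
The tilt turns the growth after `q` into decay at rate `c`. The factor `2` accounts for which of the
points crosses. -/
lemma BlockBounds.norm_setIntegral_escape_le [IsProbabilityMeasure P]
    (h : IsLogCorrelatedSequence P X)
    {δ B τ C α η κ c : ℝ} {β : ℂ} (hb : BlockBounds P X δ B τ C) (he : Exponents B τ α η κ c β)
    {N : ℕ → ℕ} (hN : Monotone N) {l q j : ℕ} (hlq : l ≤ q) (hqj : q ≤ j)
    {x y : unitCube d} (hxy : Decorrelated P X δ (N q) x y) :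
    ‖∫ ω in (barrier P X N α l j x ∩ barrier P X N α l j y) \
        (barrier P X N α l (j + 1) x ∩ barrier P X N α l (j + 1) y),
      blockExp P X (N l) (N (j + 1)) β x ω
        * (starRingEnd ℂ) (blockExp P X (N l) (N (j + 1)) β y ω) ∂P‖
      ≤ 2 * C ^ 4 * Real.exp (κ * (varSum P X (N q) - varSum P X (N l))
        - c * (varSum P X (N (j + 1)) - varSum P X (N q))) := by
  have hC := hb.one_le
  have h₁ : N l ≤ N q := hN hlq
  have h₂ : N q ≤ N (j + 1) := hN (hqj.trans (Nat.le_succ j))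
  have h₃ : N l ≤ N (j + 1) := h₁.trans h₂
  set u := varSum P X (N q) - varSum P X (N l) with hu
  set v := varSum P X (N (j + 1)) - varSum P X (N q) with hv
  have huv : varSum P X (N (j + 1)) - varSum P X (N l) = u + v := by rw [hu, hv]; ring
  have hu0 : 0 ≤ u := sub_nonneg.2 (varSum_mono h₁)
  have hv0 : 0 ≤ v := sub_nonneg.2 (varSum_mono h₂)
  set D := C ^ 2 * Real.exp (β.re * (α * u) - η * (α * v) - (β.re ^ 2 - β.im ^ 2) * (u + v)) with hD
  set g : unitCube d → unitCube d → Ω → ℝ := fun x y ω =>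
    Real.exp (β.re * fieldSum X (Finset.Ico (N l) (N q)) y ω) *
      Real.exp (β.re * fieldSum X (Finset.Ico (N q) (N (j + 1))) x ω
        + (β.re + η) * fieldSum X (Finset.Ico (N q) (N (j + 1))) y ω) with hg
  have hgi : ∀ x y, Integrable (g x y) P := by
    intro x y
    have a1 := measurable_fieldSum' h.fields (Finset.Ico (N l) (N q)) y
    have a2 := measurable_fieldSum' h.fields (Finset.Ico (N q) (N (j + 1))) y
    have a3 := measurable_fieldSum' h.fields (Finset.Ico (N q) (N (j + 1))) x
    refine ((h.integrable_exp_fieldSum (2 * β.re) (Finset.Ico (N l) (N q)) y).add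
      (h.integrable_exp_pair (2 * β.re) (2 * (β.re + η)) (Finset.Ico (N q) (N (j + 1)))
        (Finset.Ico (N q) (N (j + 1))) x y)).mono' (by fun_prop) (ae_of_all _ fun ω => ?_)
    have e : ∀ r : ℝ, Real.exp (2 * r) = Real.exp r ^ 2 := fun r => by
      rw [two_mul, Real.exp_add, pow_two]
    rw [Real.norm_of_nonneg (by positivity)]
    simp only [Pi.add_apply, hg, mul_assoc, ← mul_add, e]
    nlinarith [sq_nonneg (Real.exp (β.re * fieldSum X (Finset.Ico (N l) (N q)) y ω)
      - Real.exp (β.re * fieldSum X (Finset.Ico (N q) (N (j + 1))) x ω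
        + (β.re + η) * fieldSum X (Finset.Ico (N q) (N (j + 1))) y ω)),
      sq_nonneg (Real.exp (β.re * fieldSum X (Finset.Ico (N l) (N q)) y ω)),
      sq_nonneg (Real.exp (β.re * fieldSum X (Finset.Ico (N q) (N (j + 1))) x ω
        + (β.re + η) * fieldSum X (Finset.Ico (N q) (N (j + 1))) y ω))]
  have hpt : ∀ x y ω, ω ∈ barrier P X N α l j x → ω ∈ barrier P X N α l j y →
      ω ∉ barrier P X N α l (j + 1) y →
      ‖blockExp P X (N l) (N (j + 1)) β x ω‖ * ‖blockExp P X (N l) (N (j + 1)) β y ω‖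
        ≤ D * g x y ω := by
    intro x y ω hx hy hy'
    have a1 := hb.norm_blockExp_le h₃ he.re_le he.im_le x ω
    have a2 := hb.norm_blockExp_le h₃ he.re_le he.im_le y ω
    have a3 := le_of_mem_barrier hlq (barrier_anti hqj x hx)
    have a4 := le_of_mem_barrier hlq (barrier_anti hqj y hy)
    have a5 : α * (varSum P X (N (j + 1)) - varSum P X (N l))
        < fieldSum X (Finset.Ico (N l) (N (j + 1))) y ω := by
      by_contra hcon
      exact hy' (mem_barrier_succ hy (not_lt.1 hcon))
    rw [huv] at a1 a2 a5
    rw [← fieldSum_Ico_add h₁ h₂] at a1 a2 a5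
    rw [← hu] at a3 a4
    set z₁ := fieldSum X (Finset.Ico (N l) (N q)) x ω
    set z₂ := fieldSum X (Finset.Ico (N q) (N (j + 1))) x ω with hz₂
    set z₃ := fieldSum X (Finset.Ico (N l) (N q)) y ω with hz₃
    set z₄ := fieldSum X (Finset.Ico (N q) (N (j + 1))) y ω with hz₄
    refine (mul_le_mul a1 a2 (norm_nonneg _) (by positivity)).trans ?_
    rw [hD]
    simp only [hg]
    rw [← hz₂, ← hz₃, ← hz₄, mul_mul_mul_comm, ← Real.exp_add, ← pow_two, mul_assoc,
      ← Real.exp_add, ← Real.exp_add]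
    refine mul_le_mul_of_nonneg_left (Real.exp_le_exp.2 ?_) (by positivity)
    have b1 := mul_le_mul_of_nonneg_left a3 he.re_nonneg
    have b2 : 0 ≤ η * (z₄ - α * v) := mul_nonneg he.eta_nonneg (by linarith)
    linarith
  have hint : ∀ x y, Decorrelated P X δ (N q) x y →
      ∫ ω, D * g x y ω ∂P ≤ C ^ 4 * Real.exp (κ * u - c * v) := by
    intro x y hxy
    rw [integral_const_mul]
    have a1 := hb.integral_escape_le h he h₁ h₂ hxy
    calc _ ≤ D * (C ^ 2 * Real.exp (β.re ^ 2 * u / 2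
        + (β.re ^ 2 + (β.re + η) ^ 2) * v / 2)) := by gcongr
      _ = C ^ 4 * Real.exp ((β.re * α - β.re ^ 2 / 2 + β.im ^ 2) * u
          + (β.re ^ 2 / 2 + (β.re + η) ^ 2 / 2 - η * α - (β.re ^ 2 - β.im ^ 2)) * v) := by
        rw [hD, mul_mul_mul_comm, ← Real.exp_add]
        ring_nf
      _ ≤ _ := by
        gcongr
        have b1 := mul_le_mul_of_nonneg_right he.energy hu0
        have b2 := mul_le_mul_of_nonneg_right he.escape hv0
        linarith
  refine (norm_setIntegral_le_integral (g := fun ω => D * g x y ω + D * g y x ω) ?_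
    (((hgi x y).const_mul D).add ((hgi y x).const_mul D)) (fun ω => by positivity) ?_).trans ?_
  · refine fieldSigma_le h.fields (s := Set.univ) _ (MeasurableSet.diff
      ((measurableSet_barrier hN (Set.subset_univ _) x).inter
      (measurableSet_barrier hN (Set.subset_univ _) y))
      ((measurableSet_barrier hN (Set.subset_univ _) x).inter
      (measurableSet_barrier hN (Set.subset_univ _) y)))
  · rintro ω ⟨⟨hx, hy⟩, hne⟩
    rw [norm_mul, RCLike.norm_conj]
    have p1 : 0 ≤ D * g x y ω := by positivity
    have p2 : 0 ≤ D * g y x ω := by positivity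
    by_cases hy' : ω ∈ barrier P X N α l (j + 1) y
    · have hx' : ω ∉ barrier P X N α l (j + 1) x := fun hx' => hne ⟨hx', hy'⟩
      have := hpt y x ω hy hx hx'
      rw [mul_comm] at this
      linarith
    · have := hpt x y ω hx hy hy'
      linarith
  · rw [integral_add ((hgi x y).const_mul D) ((hgi y x).const_mul D)]
    linarith [hint x y hxy, hint y x hxy.symm]

end TwoPoint

end Chaos

namespace Chaos

/-! ### Power law bound for the truncated two-point function. -/

section TruncatedTwoPoint

variable {d : ℕ} {Ω : Type*} [mΩ : MeasurableSpace Ω] {P : Measure Ω}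
  {X : ℕ → unitCube d → Ω → ℝ}

/-- The normalized exponential of a block of levels, restricted to the barrier event. -/
noncomputable def truncExp (P : Measure Ω) (X : ℕ → unitCube d → Ω → ℝ) (N : ℕ → ℕ) (α : ℝ)
    (l j : ℕ) (β : ℂ) (x : unitCube d) : Ω → ℂ :=
  (barrier P X N α l j x).indicator (blockExp P X (N l) (N j) β x)

lemma integral_truncExp_mul (h : IsLogCorrelatedSequence P X) {N : ℕ → ℕ} (hN : Monotone N)
    (α : ℝ) (l j : ℕ) (β : ℂ) (x y : unitCube d) :
    ∫ ω, truncExp P X N α l j β x ω * (starRingEnd ℂ) (truncExp P X N α l j β y ω) ∂P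
      = ∫ ω in barrier P X N α l j x ∩ barrier P X N α l j y,
        blockExp P X (N l) (N j) β x ω * (starRingEnd ℂ) (blockExp P X (N l) (N j) β y ω) ∂P := by
  have hm : MeasurableSet (barrier P X N α l j x ∩ barrier P X N α l j y) :=
    fieldSigma_le h.fields _ ((measurableSet_barrier hN le_rfl x).inter
      (measurableSet_barrier hN le_rfl y))
  rw [← integral_indicator hm]
  refine integral_congr_ae (ae_of_all _ fun ω => ?_)
  by_cases hx : ω ∈ barrier P X N α l j x <;> by_cases hy : ω ∈ barrier P X N α l j y <;>
    simp [truncExp, hx, hy]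

lemma sum_exp_escape_le {c : ℝ} (hc : 0 < c) (q J : ℕ) :
    ∑ j ∈ Finset.Ico q J, Real.exp (-c * ((j : ℝ) - q)) ≤ (1 - Real.exp (-c))⁻¹ := by
  have hr : Real.exp (-c) < 1 := Real.exp_lt_one_iff.2 (by linarith)
  rw [Finset.sum_Ico_eq_sum_range, ← tsum_geometric_of_lt_one (Real.exp_pos _).le hr]
  refine (Finset.sum_le_sum fun i _ => le_of_eq ?_).trans
    ((summable_geometric_of_lt_one (Real.exp_pos _).le hr).sum_le_tsum (Finset.range (J - q))
      fun i _ => by positivity)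
  rw [← Real.exp_nat_mul]
  congr 1
  push_cast
  ring

/-- The truncated two-point function is controlled by a power of the distance. -/
theorem exists_truncExp_bound [IsProbabilityMeasure P] (C κ c A : ℝ) :
    ∃ C' : ℝ, 0 ≤ C' ∧ ∀ {X : ℕ → unitCube d → Ω → ℝ}, IsLogCorrelatedSequence P X →
      ∀ {δ B τ α η : ℝ} {β : ℂ} {N : ℕ → ℕ}, BlockBounds P X δ B τ C → IsLevels P X N A →
      Exponents B τ α η κ c β → ∀ {l J : ℕ}, l ≤ J → ∀ {x y : unitCube d}, x ≠ y → dist x y ≤ δ →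
      (l : ℝ) ≤ Real.log (1 / dist x y) →
      ‖∫ ω, truncExp P X N α l J β x ω * (starRingEnd ℂ) (truncExp P X N α l J β y ω) ∂P‖
        ≤ C' * Real.exp (κ * (Real.log (1 / dist x y) - l)) := by
  set G := (1 - Real.exp (-c))⁻¹
  -- The constant is fixed before the fields and the exponents, when no signs are known; the
  -- absolute values disappear below. The factor `exp (c * A)` absorbs the overshoot of the variance
  -- at level `q`.
  refine ⟨|C| ^ 3 * (|C| ^ 3 + 2 * |C| ^ 4 * Real.exp (c * A) * |G|) * Real.exp (|κ| * (1 + A)),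
    by positivity, ?_⟩
  intro X h δ B τ α η β N hb hN he l J hlJ x y hxy hd hl
  have hC := hb.one_le
  have hκ := he.kappa_nonneg
  have hc := he.decay_pos
  have hG : 0 ≤ G := inv_nonneg.2 (by
    have : Real.exp (-c) ≤ 1 := Real.exp_le_one_iff.2 (by linarith)
    linarith)
  rw [abs_of_nonneg (by linarith : (0 : ℝ) ≤ C), abs_of_nonneg hκ, abs_of_nonneg hG]
  set L := Real.log (1 / dist x y) with hL
  rw [integral_truncExp_mul h hN.mono]
  have hfac : Real.exp (κ * (1 + A)) * Real.exp (κ * (L - l)) = Real.exp (κ * (L + 1 + A - l)) := by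
    rw [← Real.exp_add]; ring_nf
  rw [mul_assoc, hfac]
  -- From level `q` on the two points are decorrelated.
  set q := ⌈L⌉₊ with hq
  have hL0 : 0 ≤ L := (Nat.cast_nonneg l).trans hl
  have hq1 : L ≤ q := Nat.le_ceil L
  have hq2 : (q : ℝ) < L + 1 := Nat.ceil_lt_add_one hL0
  have hlq : l ≤ q := by exact_mod_cast hl.trans hq1
  have hC3 : 1 ≤ C ^ 3 := one_le_pow₀ hC
  have hA := hN.nonneg
  have hrest : 0 ≤ 2 * C ^ 4 * Real.exp (c * A) * G := by positivity
  have hmain : ∀ j, j ≤ q → Real.exp (κ * (varSum P X (N j) - varSum P X (N l)))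
      ≤ Real.exp (κ * (L + 1 + A - l)) := by
    intro j hj
    have h1 := hN.upper j
    have h2 := hN.lower l
    have h3 : (j : ℝ) ≤ q := by exact_mod_cast hj
    gcongr
    linarith
  rcases le_total J q with hJq | hqJ
  · refine (hb.norm_setIntegral_barrier_le h he hN.mono hlJ x y).trans ?_
    calc _ ≤ C ^ 3 * Real.exp (κ * (L + 1 + A - l)) := mul_le_mul_of_nonneg_left (hmain J hJq) (by positivity)
      _ ≤ _ := by
        gcongr
        nlinarith
  · have hdec : Decorrelated P X δ (N q) x y := ⟨hxy, hd, hq1.trans (hN.lower q)⟩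
    set S : ℕ → Set Ω := fun j => barrier P X N α l j x ∩ barrier P X N α l j y with hS
    have hSm : ∀ j, MeasurableSet[fieldSigma X (Set.Ico (N l) (N j))] (S j) := fun j =>
      (measurableSet_barrier hN.mono le_rfl x).inter (measurableSet_barrier hN.mono le_rfl y)
    have hSm' : ∀ j, MeasurableSet (S j) := fun j => fieldSigma_le h.fields _ (hSm j)
    have hSa : ∀ j, S (j + 1) ⊆ S j := fun j =>
      Set.inter_subset_inter (barrier_anti (Nat.le_succ j) x) (barrier_anti (Nat.le_succ j) y)
    set F : Ω → ℂ := fun ω =>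
      blockExp P X (N l) (N J) β x ω * (starRingEnd ℂ) (blockExp P X (N l) (N J) β y ω) with hF
    have hFi : Integrable F P := integrable_blockExp_mul h _ _ β x y
    -- The event `S J` constrains all fields up to level `J`, so no block factors off directly. Each
    -- telescoped event depends only on the fields before `N (j + 1)`: the remaining block factors
    -- off free of truncation, where its oscillation keeps it bounded, and the escape bound is
    -- summable in `j`.
    have htel : ∫ ω in S J, F ω ∂P = ∫ ω in S q, F ω ∂P
        - ∑ j ∈ Finset.Ico q J, ∫ ω in S j \ S (j + 1), F ω ∂P := by
      have h1 : ∀ j, ∫ ω in S j \ S (j + 1), F ω ∂P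
          = -(∫ ω in S (j + 1), F ω ∂P - ∫ ω in S j, F ω ∂P) := fun j => by
        rw [setIntegral_sdiff (hSm' (j + 1)) hFi.integrableOn (hSa j)]; ring
      simp only [h1, Finset.sum_neg_distrib]
      rw [Finset.sum_Ico_sub (fun j => ∫ ω in S j, F ω ∂P) hqJ]
      ring
    have hbase : ‖∫ ω in S q, F ω ∂P‖ ≤ C ^ 3 * (C ^ 3 * Real.exp (κ * (L + 1 + A - l))) := by
      rw [hF, setIntegral_blockExp_mul h (hN.mono hlq) (hN.mono hqJ) β x y (hSm q), norm_mul,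
        mul_comm]
      refine mul_le_mul ?_ ?_ (norm_nonneg _) (by positivity)
      · exact hb.norm_integral_blockExp_mul_le (hN.mono hqJ) he.re_le he.im_le he.norm_le hdec
      · refine (hb.norm_setIntegral_barrier_le h he hN.mono hlq x y).trans ?_
        exact mul_le_mul_of_nonneg_left (hmain q le_rfl) (by positivity)
    have hstep : ∀ j ∈ Finset.Ico q J, ‖∫ ω in S j \ S (j + 1), F ω ∂P‖
        ≤ C ^ 3 * (2 * C ^ 4 * (Real.exp (κ * (L + 1 + A - l)) * Real.exp (c * A)
          * Real.exp (-c * ((j : ℝ) - q)))) := by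
      intro j hj
      rw [Finset.mem_Ico] at hj
      have hj1 : l ≤ j + 1 := hlq.trans (hj.1.trans (Nat.le_succ j))
      have hset : MeasurableSet[fieldSigma X (Set.Ico (N l) (N (j + 1)))] (S j \ S (j + 1)) :=
        MeasurableSet.diff (fieldSigma_mono (Set.Ico_subset_Ico_right (hN.mono (Nat.le_succ j)))
          _ (hSm j)) (hSm (j + 1))
      rw [hF, setIntegral_blockExp_mul h (hN.mono hj1) (hN.mono hj.2) β x y hset, norm_mul,
        mul_comm]
      refine mul_le_mul ?_ ?_ (norm_nonneg _) (by positivity)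
      · exact hb.norm_integral_blockExp_mul_le (hN.mono hj.2) he.re_le he.im_le he.norm_le
          (hdec.mono (hN.mono (hj.1.trans (Nat.le_succ j))))
      · refine (hb.norm_setIntegral_escape_le h he hN.mono hlq hj.1 hdec).trans ?_
        refine mul_le_mul_of_nonneg_left ?_ (by positivity)
        rw [sub_eq_add_neg, Real.exp_add, mul_assoc]
        refine mul_le_mul (hmain q le_rfl) ?_ (Real.exp_pos _).le (Real.exp_pos _).le
        rw [← Real.exp_add, Real.exp_le_exp]
        have h1 := hN.lower (j + 1)
        have h2 := hN.upper q
        push_cast at h1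
        nlinarith
    rw [htel]
    refine (norm_sub_le _ _).trans ((add_le_add hbase ((norm_sum_le _ _).trans
      (Finset.sum_le_sum hstep))).trans ?_)
    rw [← Finset.mul_sum, ← Finset.mul_sum, ← Finset.mul_sum]
    have := sum_exp_escape_le hc q J
    calc _ ≤ C ^ 3 * (C ^ 3 * Real.exp (κ * (L + 1 + A - l))) + C ^ 3 * (2 * C ^ 4 *
          (Real.exp (κ * (L + 1 + A - l)) * Real.exp (c * A) * G)) := by gcongr
      _ = _ := by ring

end TruncatedTwoPoint

end Chaos

namespace Chaos

/-! ### Second moments as integrals of two-point functions. -/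

section SecondMoment

variable {α Ω : Type*} [MeasurableSpace α] [MeasurableSpace Ω]

/-- The second moment of an integral is an integral of the two-point function. -/
lemma lintegral_sq_integral_le {ν : Measure α} [IsFiniteMeasure ν] {P : Measure Ω}
    [IsFiniteMeasure P] {F : α → Ω → ℂ} (hF : Measurable (Function.uncurry F))
    (hF2 : ∫⁻ z, ‖F z.1 z.2‖ₑ ^ 2 ∂(ν.prod P) < ∞) :
    ∫⁻ ω, ‖∫ x, F x ω ∂ν‖ₑ ^ 2 ∂P
      ≤ ∫⁻ z, ‖∫ ω, F z.1 ω * (starRingEnd ℂ) (F z.2 ω) ∂P‖ₑ ∂(ν.prod ν) := by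
  set H : (α × α) → Ω → ℂ := fun z ω => F z.1 ω * (starRingEnd ℂ) (F z.2 ω) with hH
  have hm1 : Measurable fun q : (α × α) × Ω => F q.1.1 q.2 :=
    hF.comp (f := fun q : (α × α) × Ω => (q.1.1, q.2)) (by fun_prop)
  have hm2 : Measurable fun q : (α × α) × Ω => F q.1.2 q.2 :=
    hF.comp (f := fun q : (α × α) × Ω => (q.1.2, q.2)) (by fun_prop)
  have hHm : Measurable (Function.uncurry H) :=
    hm1.mul (Complex.continuous_conj.measurable.comp hm2)
  have hFe : Measurable fun q : α × Ω => ‖F q.1 q.2‖ₑ ^ 2 := (hF.enorm).pow_const 2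
  have hHi : Integrable (Function.uncurry H) ((ν.prod ν).prod P) := by
    refine ⟨hHm.aestronglyMeasurable, ?_⟩
    have hle : ∀ q : (α × α) × Ω, ‖Function.uncurry H q‖ₑ
        ≤ ‖F q.1.1 q.2‖ₑ ^ 2 + ‖F q.1.2 q.2‖ₑ ^ 2 := by
      intro q
      simp only [Function.uncurry, hH, enorm_mul, RCLike.enorm_conj]
      rcases le_total ‖F q.1.1 q.2‖ₑ ‖F q.1.2 q.2‖ₑ with hle | hle
      · calc _ ≤ ‖F q.1.2 q.2‖ₑ * ‖F q.1.2 q.2‖ₑ := by gcongr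
          _ ≤ _ := by rw [← pow_two]; exact le_add_self
      · calc _ ≤ ‖F q.1.1 q.2‖ₑ * ‖F q.1.1 q.2‖ₑ := by gcongr
          _ ≤ _ := by rw [← pow_two]; exact le_self_add
    have e1 : ∫⁻ q : (α × α) × Ω, ‖F q.1.1 q.2‖ₑ ^ 2 ∂((ν.prod ν).prod P)
        = (∫⁻ z, ‖F z.1 z.2‖ₑ ^ 2 ∂(ν.prod P)) * ν Set.univ := by
      rw [lintegral_prod _ ((hm1.enorm).pow_const 2).aemeasurable,
        lintegral_prod _ hFe.aemeasurable,
        lintegral_prod _ (Measurable.lintegral_prod_right' (f := fun q : (α × α) × Ω =>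
          ‖F q.1.1 q.2‖ₑ ^ 2) ((hm1.enorm).pow_const 2)).aemeasurable]
      simp only [lintegral_const]
      rw [lintegral_mul_const _ (Measurable.lintegral_prod_right' (f := fun q : α × Ω =>
          ‖F q.1 q.2‖ₑ ^ 2) hFe)]
    have e2 : ∫⁻ q : (α × α) × Ω, ‖F q.1.2 q.2‖ₑ ^ 2 ∂((ν.prod ν).prod P)
        = (∫⁻ z, ‖F z.1 z.2‖ₑ ^ 2 ∂(ν.prod P)) * ν Set.univ := by
      rw [lintegral_prod _ ((hm2.enorm).pow_const 2).aemeasurable,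
        lintegral_prod _ hFe.aemeasurable,
        lintegral_prod _ (Measurable.lintegral_prod_right' (f := fun q : (α × α) × Ω =>
          ‖F q.1.2 q.2‖ₑ ^ 2) ((hm2.enorm).pow_const 2)).aemeasurable]
      simp only [lintegral_const]
    refine (lintegral_mono hle).trans_lt ?_
    rw [lintegral_add_left ((hm1.enorm).pow_const 2), e1, e2]
    exact ENNReal.add_lt_top.2 ⟨ENNReal.mul_lt_top hF2 (measure_lt_top _ _),
      ENNReal.mul_lt_top hF2 (measure_lt_top _ _)⟩
  have hK : ∀ ω, ∫ z, H z ω ∂(ν.prod ν) = ((‖∫ x, F x ω ∂ν‖ ^ 2 : ℝ) : ℂ) := by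
    intro ω
    simp only [hH]
    rw [integral_prod_mul (fun x => F x ω) (fun y => (starRingEnd ℂ) (F y ω)), integral_conj,
      Complex.mul_conj, Complex.normSq_eq_norm_sq]
  have hKi : Integrable (fun ω => ∫ z, H z ω ∂(ν.prod ν)) P := hHi.integral_prod_right
  have hKi' : Integrable (fun ω => ‖∫ x, F x ω ∂ν‖ ^ 2) P := by
    simpa [hK] using hKi.norm
  calc ∫⁻ ω, ‖∫ x, F x ω ∂ν‖ₑ ^ 2 ∂P
      = ∫⁻ ω, ENNReal.ofReal (‖∫ x, F x ω ∂ν‖ ^ 2) ∂P := by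
        refine lintegral_congr fun ω => ?_
        rw [ENNReal.ofReal_pow (norm_nonneg _), ofReal_norm]
    _ = ENNReal.ofReal (∫ ω, ‖∫ x, F x ω ∂ν‖ ^ 2 ∂P) :=
        (ofReal_integral_eq_lintegral_ofReal hKi' (ae_of_all _ fun _ => by positivity)).symm
    _ = ‖∫ ω, ∫ z, H z ω ∂(ν.prod ν) ∂P‖ₑ := by
        simp only [hK]
        rw [integral_complex_ofReal, ← ofReal_norm, Complex.norm_real, Real.norm_of_nonneg]
        exact integral_nonneg fun _ => by positivity
    _ = ‖∫ z, ∫ ω, H z ω ∂P ∂(ν.prod ν)‖ₑ := by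
        rw [integral_integral_swap (f := H) hHi]
    _ ≤ _ := enorm_integral_le_lintegral_enorm _

end SecondMoment

/-! ### Cells of the cube and the integral of a power of the distance. -/

section Geometry

variable {d : ℕ}

lemma measurableSet_unitCube (d : ℕ) : MeasurableSet (unitCube d) := by
  have : unitCube d = ⋂ i, {x : EuclideanSpace ℝ (Fin d) | x i ∈ Set.Icc (0 : ℝ) 1} := by
    ext; simp [unitCube]
  rw [this]
  refine MeasurableSet.iInter fun i => ?_
  have : Measurable fun x : EuclideanSpace ℝ (Fin d) => x i := by fun_prop
  exact this measurableSet_Icc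

lemma volume_euclidean_box (a b : Fin d → ℝ) :
    volume {x : EuclideanSpace ℝ (Fin d) | ∀ i, x i ∈ Set.Icc (a i) (b i)}
      = ∏ i, ENNReal.ofReal (b i - a i) := by
  rw [← Real.volume_Icc_pi, ← (EuclideanSpace.volume_preserving_symm_measurableEquiv_toLp
    (Fin d)).measure_preimage_equiv]
  congr 1
  ext x
  simp [Set.mem_Icc, Pi.le_def, forall_and]

lemma cubeVolume_apply (s : Set (unitCube d)) :
    cubeVolume d s = volume (Subtype.val '' s) :=
  comap_subtype_coe_apply (measurableSet_unitCube d) _ _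

lemma cubeVolume_le_of_subset_box {s : Set (unitCube d)} {a b : Fin d → ℝ}
    (h : ∀ x ∈ s, ∀ i, (x : EuclideanSpace ℝ (Fin d)) i ∈ Set.Icc (a i) (b i)) :
    cubeVolume d s ≤ ∏ i, ENNReal.ofReal (b i - a i) := by
  rw [cubeVolume_apply, ← volume_euclidean_box]
  refine measure_mono ?_
  rintro _ ⟨x, hx, rfl⟩
  exact h x hx

lemma cubeVolume_univ_le : cubeVolume d Set.univ ≤ 1 := by
  refine (cubeVolume_le_of_subset_box (a := fun _ => 0) (b := fun _ => 1)
    fun x _ i => x.2 i).trans ?_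
  simp

instance : IsFiniteMeasure (cubeVolume d) :=
  ⟨cubeVolume_univ_le.trans_lt ENNReal.one_lt_top⟩

/-- The cell with index `q` of the subdivision of the cube with mesh `1 / n`. -/
def cell (n : ℕ) (q : Fin d → ℕ) : Set (unitCube d) :=
  {x | ∀ i, ⌊n * (x : EuclideanSpace ℝ (Fin d)) i⌋₊ = q i}

lemma measurableSet_cell (n : ℕ) (q : Fin d → ℕ) : MeasurableSet (cell n q) := by
  have : cell n q = ⋂ i, {x : unitCube d | ⌊n * (x : EuclideanSpace ℝ (Fin d)) i⌋₊ = q i} := by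
    ext; simp [cell]
  rw [this]
  refine MeasurableSet.iInter fun i => ?_
  have : Measurable fun x : unitCube d => ⌊n * (x : EuclideanSpace ℝ (Fin d)) i⌋₊ :=
    Nat.measurable_floor.comp (by fun_prop)
  exact this (measurableSet_singleton (q i))

lemma mem_Icc_of_mem_cell {n : ℕ} (hn : 0 < n) {q : Fin d → ℕ} {x : unitCube d} (hx : x ∈ cell n q)
    (i : Fin d) : (x : EuclideanSpace ℝ (Fin d)) i ∈ Set.Icc (q i / n : ℝ) (q i / n + 1 / n) := by
  have hn' : (0 : ℝ) < n := by exact_mod_cast hn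
  have h := hx i
  have h0 : 0 ≤ n * (x : EuclideanSpace ℝ (Fin d)) i := mul_nonneg hn'.le (x.2 i).1
  rw [Nat.floor_eq_iff h0] at h
  rw [← add_div]
  constructor
  · rw [div_le_iff₀ hn', mul_comm]; exact h.1
  · rw [le_div_iff₀ hn', mul_comm]; exact h.2.le

lemma cubeVolume_cell_le {n : ℕ} (hn : 0 < n) (q : Fin d → ℕ) :
    cubeVolume d (cell n q) ≤ ENNReal.ofReal ((1 / n : ℝ) ^ d) := by
  refine (cubeVolume_le_of_subset_box fun x hx i => mem_Icc_of_mem_cell hn hx i).trans ?_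
  simp only [add_sub_cancel_left, Finset.prod_const, Finset.card_univ, Fintype.card_fin]
  rw [ENNReal.ofReal_pow (by positivity)]

lemma dist_le_of_mem_cell {n : ℕ} (hn : 0 < n) {q : Fin d → ℕ} {x y : unitCube d}
    (hx : x ∈ cell n q) (hy : y ∈ cell n q) : dist x y ≤ Real.sqrt d / n := by
  rw [Subtype.dist_eq, EuclideanSpace.dist_eq]
  have hn' : (0 : ℝ) < n := by exact_mod_cast hn
  have : ∀ i, dist ((x : EuclideanSpace ℝ (Fin d)) i) ((y : EuclideanSpace ℝ (Fin d)) i) ^ 2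
      ≤ (1 / n : ℝ) ^ 2 := by
    intro i
    have h1 := mem_Icc_of_mem_cell hn hx i
    have h2 := mem_Icc_of_mem_cell hn hy i
    refine pow_le_pow_left₀ dist_nonneg ?_ 2
    rw [Real.dist_eq, abs_le]
    constructor <;> linarith [h1.1, h1.2, h2.1, h2.2]
  calc _ ≤ Real.sqrt (∑ _i : Fin d, (1 / n : ℝ) ^ 2) :=
        Real.sqrt_le_sqrt (Finset.sum_le_sum fun i _ => this i)
    _ = _ := by
      rw [Finset.sum_const, Finset.card_univ, Fintype.card_fin, nsmul_eq_mul,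
        Real.sqrt_mul (Nat.cast_nonneg _), Real.sqrt_sq (by positivity)]
      ring

/-- The indices of the cells of mesh `1 / n`. -/
def cellIndex (d n : ℕ) : Finset (Fin d → ℕ) := Fintype.piFinset fun _ => Finset.range (n + 1)

lemma card_cellIndex (d n : ℕ) : (cellIndex d n).card = (n + 1) ^ d := by
  simp [cellIndex]

lemma exists_mem_cell {n : ℕ} (x : unitCube d) :
    ∃ q ∈ cellIndex d n, x ∈ cell n q := by
  refine ⟨fun i => ⌊n * (x : EuclideanSpace ℝ (Fin d)) i⌋₊, ?_, fun i => rfl⟩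
  -- A coordinate equal to `1` has index `n`, whence `n + 1` indices per axis.
  refine Fintype.mem_piFinset.2 fun i => Finset.mem_range.2 (Nat.lt_succ_iff.2 ?_)
  refine Nat.floor_le_of_le ?_
  have := x.2 i
  have h2 := this.2
  exact mul_le_of_le_one_right (Nat.cast_nonneg _) h2

lemma integral_eq_sum_cell {F : unitCube d → ℂ} (hF : Integrable F (cubeVolume d)) (n : ℕ) :
    ∫ x, F x ∂(cubeVolume d) = ∑ q ∈ cellIndex d n, ∫ x in cell n q, F x ∂(cubeVolume d) := by
  rw [← integral_biUnion_finset (cellIndex d n) (fun q _ => measurableSet_cell n q) ?_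
    fun q _ => hF.integrableOn]
  · have : (⋃ q ∈ cellIndex d n, cell n q) = Set.univ := by
      refine Set.eq_univ_of_forall fun x => ?_
      obtain ⟨q, hq, hx⟩ := exists_mem_cell (n := n) x
      exact Set.mem_biUnion hq hx
    rw [this, setIntegral_univ]
  · intro q _ q' _ hne
    rw [Function.onFun, Set.disjoint_left]
    intro x hx hx'
    exact hne (funext fun i => (hx i).symm.trans (hx' i))

/-- In polar coordinates the radial density is `r^(d-1-κ)`, integrable at `0` since `κ < d`. -/
lemma lintegral_ball_rpow (hd : 1 ≤ d) {κ : ℝ} (hκ : κ < d) :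
    ∃ K : ℝ, 0 ≤ K ∧ ∀ R : ℝ, 0 < R →
      ∫⁻ w in Metric.ball (0 : EuclideanSpace ℝ (Fin d)) R, ENNReal.ofReal (‖w‖ ^ (-κ))
        ≤ ENNReal.ofReal (K * R ^ (d - κ)) := by
  have : Nonempty (Fin d) := ⟨⟨0, hd⟩⟩
  set V := volume.real (Metric.ball (0 : EuclideanSpace ℝ (Fin d)) 1)
  have hdκ : 0 < d - κ := by linarith
  refine ⟨d * (V * (1 / (d - κ))), by positivity, fun R hR => ?_⟩
  have hfin : Module.finrank ℝ (EuclideanSpace ℝ (Fin d)) = d := by simp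
  have hpow : ∀ y : ℝ, 0 < y → y ^ (d - 1) * y ^ (-κ) = y ^ ((d : ℝ) - 1 - κ) := by
    intro y hy
    rw [← Real.rpow_natCast, ← Real.rpow_add hy]
    push_cast [Nat.cast_sub hd]
    ring_nf
  have hint : IntegrableOn (fun w : EuclideanSpace ℝ (Fin d) => ‖w‖ ^ (-κ))
      (Metric.ball 0 R) := by
    rw [integrableOn_fun_norm_addHaar volume (f := fun r : ℝ => r ^ (-κ)), hfin]
    refine IntegrableOn.congr_fun (f := fun y : ℝ => y ^ ((d : ℝ) - 1 - κ)) ?_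
      (fun y hy => (hpow y hy.1).symm) measurableSet_Ioo
    exact (intervalIntegral.integrableOn_Ioo_rpow_iff hR).2 (by linarith)
  have hval : ∫ w in Metric.ball (0 : EuclideanSpace ℝ (Fin d)) R, ‖w‖ ^ (-κ)
      = d * (V * (1 / (d - κ))) * R ^ (d - κ) := by
    have h1 : ∫ w in Metric.ball (0 : EuclideanSpace ℝ (Fin d)) R, ‖w‖ ^ (-κ)
        = ∫ w : EuclideanSpace ℝ (Fin d), (Set.Iio R).indicator (fun r : ℝ => r ^ (-κ)) ‖w‖ := by
      rw [← integral_indicator measurableSet_ball]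
      refine integral_congr_ae (ae_of_all _ fun w => ?_)
      simp [Set.indicator]
    rw [h1, integral_fun_norm_addHaar volume, hfin]
    have h2 : ∫ y in Set.Ioi (0 : ℝ), y ^ (d - 1) • (Set.Iio R).indicator (fun r : ℝ => r ^ (-κ)) y
        = R ^ (d - κ) / (d - κ) := by
      have h3 : ∫ y in Set.Ioi (0 : ℝ), y ^ (d - 1) • (Set.Iio R).indicator (fun r : ℝ => r ^ (-κ)) y
          = ∫ y in Set.Ioo (0 : ℝ) R, y ^ ((d : ℝ) - 1 - κ) := by
        rw [← Set.Ioi_inter_Iio, ← setIntegral_indicator measurableSet_Iio]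
        refine setIntegral_congr_fun measurableSet_Ioi fun y hy => ?_
        by_cases hyR : y < R
        · simp [Set.indicator, hyR, hpow y hy]
        · simp [Set.indicator, hyR]
      rw [h3, ← integral_Ioc_eq_integral_Ioo, ← intervalIntegral.integral_of_le hR.le,
        integral_rpow (Or.inl (by linarith))]
      rw [show (d : ℝ) - 1 - κ + 1 = d - κ by ring, Real.zero_rpow hdκ.ne', sub_zero]
    rw [h2]
    simp only [nsmul_eq_mul, smul_eq_mul]
    field_simp
    rfl
  rw [← ofReal_integral_eq_lintegral_ofReal hint (ae_of_all _ fun _ => by positivity), hval]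

lemma lintegral_dist_rpow (hd : 1 ≤ d) {κ : ℝ} (hκ : κ < d) :
    ∃ K : ℝ, 0 ≤ K ∧ ∀ R : ℝ, 0 < R → ∀ (x : unitCube d) (s : Set (unitCube d)),
      MeasurableSet s → (∀ y ∈ s, dist x y < R) →
      ∫⁻ y in s, ENNReal.ofReal (dist x y ^ (-κ)) ∂(cubeVolume d)
        ≤ ENNReal.ofReal (K * R ^ (d - κ)) := by
  obtain ⟨K, hK, hb⟩ := lintegral_ball_rpow hd hκ
  refine ⟨K, hK, fun R hR x s hs hxs => le_trans ?_ (hb R hR)⟩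
  set g : EuclideanSpace ℝ (Fin d) → ℝ≥0∞ := fun w =>
    (Metric.ball (0 : EuclideanSpace ℝ (Fin d)) R).indicator
      (fun w => ENNReal.ofReal (‖w‖ ^ (-κ))) w with hg
  calc ∫⁻ y in s, ENNReal.ofReal (dist x y ^ (-κ)) ∂(cubeVolume d)
      = ∫⁻ y in s, g ((x : EuclideanSpace ℝ (Fin d)) - y) ∂(cubeVolume d) := by
        refine setLIntegral_congr_fun hs fun y hy => ?_
        have : dist x y = ‖(x : EuclideanSpace ℝ (Fin d)) - y‖ := by
          rw [Subtype.dist_eq, dist_eq_norm]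
        simp only [hg]
        rw [Set.indicator_of_mem, this]
        rw [mem_ball_zero_iff, ← this]
        exact hxs y hy
    _ ≤ ∫⁻ y, g ((x : EuclideanSpace ℝ (Fin d)) - y) ∂(cubeVolume d) :=
        setLIntegral_le_lintegral _ _
    _ = ∫⁻ w in unitCube d, g ((x : EuclideanSpace ℝ (Fin d)) - w) :=
        lintegral_subtype_comap (measurableSet_unitCube d)
          fun w => g ((x : EuclideanSpace ℝ (Fin d)) - w)
    _ ≤ ∫⁻ w, g ((x : EuclideanSpace ℝ (Fin d)) - w) := setLIntegral_le_lintegral _ _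
    _ = ∫⁻ w, g w := lintegral_sub_left_eq_self _ _
    _ = _ := lintegral_indicator measurableSet_ball _

lemma cubeVolume_singleton (hd : 1 ≤ d) (x : unitCube d) : cubeVolume d {x} = 0 := by
  have : Nonempty (Fin d) := ⟨⟨0, hd⟩⟩
  rw [cubeVolume_apply, Set.image_singleton]
  exact measure_singleton _

end Geometry

end Chaos

namespace Chaos

/-! ### Splitting at the first maximum of the tilted sums. -/

section Decomposition

variable {d : ℕ} {Ω : Type*} [mΩ : MeasurableSpace Ω] {P : Measure Ω}
  {X : ℕ → unitCube d → Ω → ℝ}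

/-- The event that the sums tilted by a line of slope `α` have a strict running maximum at
level `l`. -/
def firstMax (P : Measure Ω) (X : ℕ → unitCube d → Ω → ℝ) (N : ℕ → ℕ) (α : ℝ) (l : ℕ)
    (x : unitCube d) : Set Ω :=
  ⋂ i ∈ Finset.range l, {ω | fieldSum X (Finset.Ico 0 (N i)) x ω - α * varSum P X (N i)
    < fieldSum X (Finset.Ico 0 (N l)) x ω - α * varSum P X (N l)}

/-- Compare with level `0`, where the tilted sum vanishes. This high value is what makes a late
first maximum costly. -/
lemma le_of_mem_firstMax {N : ℕ → ℕ} (hN0 : N 0 = 0) {α : ℝ} {l : ℕ} {x : unitCube d} {ω : Ω}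
    (h : ω ∈ firstMax P X N α l x) :
    α * varSum P X (N l) ≤ fieldSum X (Finset.Ico 0 (N l)) x ω := by
  rcases Nat.eq_zero_or_pos l with rfl | hl
  · simp [hN0, varSum_zero, fieldSum]
  · have := Set.mem_iInter₂.1 h 0 (Finset.mem_range.2 hl)
    simp only [hN0, Set.mem_ofPred_eq, varSum_zero, fieldSum, Finset.Ico_self,
      Finset.sum_empty] at this
    simp only [fieldSum]
    linarith

/-- The barrier is defined by increments after level `l`, which makes it independent of the past; on
the other hand it says that level `l` dominates all later ones. -/
lemma mem_barrier_iff {N : ℕ → ℕ} (hN : Monotone N) {α : ℝ} {l J : ℕ} {x : unitCube d} {ω : Ω} :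
    ω ∈ barrier P X N α l J x ↔ ∀ i, l < i → i ≤ J →
      fieldSum X (Finset.Ico 0 (N i)) x ω - α * varSum P X (N i)
        ≤ fieldSum X (Finset.Ico 0 (N l)) x ω - α * varSum P X (N l) := by
  have h : ∀ i, l < i → (fieldSum X (Finset.Ico (N l) (N i)) x ω
      ≤ α * (varSum P X (N i) - varSum P X (N l)) ↔
      fieldSum X (Finset.Ico 0 (N i)) x ω - α * varSum P X (N i)
        ≤ fieldSum X (Finset.Ico 0 (N l)) x ω - α * varSum P X (N l)) := by
    intro i hi
    rw [← fieldSum_Ico_add (Nat.zero_le (N l)) (hN hi.le)]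
    constructor <;> intro h <;> linarith
  simp only [barrier, Set.mem_iInter, Finset.mem_Ioc, Set.mem_ofPred_eq]
  constructor
  · intro hb i hi hiJ
    exact (h i hi).1 (hb i ⟨hi, hiJ⟩)
  · intro hb i hi
    exact (h i hi.1).2 (hb i hi.1 hi.2)

lemma mem_firstMax_iff {N : ℕ → ℕ} {α : ℝ} {l : ℕ} {x : unitCube d} {ω : Ω} :
    ω ∈ firstMax P X N α l x ↔ ∀ i, i < l →
      fieldSum X (Finset.Ico 0 (N i)) x ω - α * varSum P X (N i)
        < fieldSum X (Finset.Ico 0 (N l)) x ω - α * varSum P X (N l) := by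
  simp [firstMax]

lemma exists_first_argmax (W : ℕ → ℝ) (J : ℕ) :
    ∃ l ≤ J, (∀ i, i < l → W i < W l) ∧ ∀ i, i ≤ J → W i ≤ W l := by
  classical
  have hex : ∃ l, l ≤ J ∧ ∀ i, i ≤ J → W i ≤ W l := by
    obtain ⟨l, hl, hmax⟩ := Finset.exists_max_image (Finset.range (J + 1)) W ⟨0, by simp⟩
    exact ⟨l, by simpa [Nat.lt_succ_iff] using hl, fun i hi => hmax i (by simpa [Nat.lt_succ_iff])⟩
  obtain ⟨h1, h2⟩ := Nat.find_spec hex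
  refine ⟨Nat.find hex, h1, fun i hi => ?_, h2⟩
  have h3 := Nat.find_min hex hi
  push Not at h3
  obtain ⟨k, hk, hik⟩ := h3 (hi.le.trans h1)
  exact hik.trans_le (h2 k hk)

/-- The normalized exponential at level `l` on the event of a running maximum. -/
noncomputable def startExp (P : Measure Ω) (X : ℕ → unitCube d → Ω → ℝ) (N : ℕ → ℕ) (α : ℝ)
    (l : ℕ) (β : ℂ) (x : unitCube d) : Ω → ℂ :=
  (firstMax P X N α l x).indicator (blockExp P X 0 (N l) β x)

/-- Decomposition with respect to the first maximum of the tilted sums. -/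
lemma blockExp_eq_sum [IsProbabilityMeasure P] (h : IsLogCorrelatedSequence P X) {N : ℕ → ℕ}
    (hN : Monotone N) (α : ℝ) (J : ℕ) (β : ℂ) (x : unitCube d) (ω : Ω) :
    blockExp P X 0 (N J) β x ω = ∑ l ∈ Finset.range (J + 1),
      startExp P X N α l β x ω * truncExp P X N α l J β x ω := by
  obtain ⟨l, hlJ, h1, h2⟩ := exists_first_argmax
    (fun i => fieldSum X (Finset.Ico 0 (N i)) x ω - α * varSum P X (N i)) J
  rw [Finset.sum_eq_single l]
  · have m1 : ω ∈ firstMax P X N α l x := mem_firstMax_iff.2 h1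
    have m2 : ω ∈ barrier P X N α l J x := (mem_barrier_iff hN).2 fun i _ hi => h2 i hi
    rw [startExp, truncExp, Set.indicator_of_mem m1, Set.indicator_of_mem m2,
      blockExp_mul h (Nat.zero_le _) (hN hlJ)]
  -- Strict inequality before the level and weak inequality after it make the events of distinct
  -- levels disjoint, so a single summand survives.
  · intro k hk hkl
    by_contra hne
    have m1 : ω ∈ firstMax P X N α k x := by
      by_contra hcon
      exact hne (by rw [startExp, Set.indicator_of_notMem hcon, zero_mul])
    have m2 : ω ∈ barrier P X N α k J x := by
      by_contra hcon
      exact hne (by rw [truncExp, Set.indicator_of_notMem hcon, mul_zero])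
    rw [mem_firstMax_iff] at m1
    rw [mem_barrier_iff hN] at m2
    have hkJ : k ≤ J := Nat.lt_succ_iff.1 (Finset.mem_range.1 hk)
    rcases lt_or_gt_of_ne hkl with hlt | hgt
    · exact absurd (m2 l hlt hlJ) (not_le.2 (h1 k hlt))
    · exact absurd (m1 l hgt) (not_lt.2 (h2 k hkJ))
  · intro hl
    exact absurd (Finset.mem_range.2 (Nat.lt_succ_iff.2 hlJ)) hl

lemma measurableSet_firstMax {N : ℕ → ℕ} (hN : Monotone N) {α : ℝ} {l : ℕ} {s : Set ℕ}
    (h : Set.Ico 0 (N l) ⊆ s) (x : unitCube d) :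
    MeasurableSet[fieldSigma X s] (firstMax P X N α l x) := by
  refine Finset.measurableSet_biInter _ fun i hi => ?_
  have hi' := (Finset.mem_range.1 hi).le
  have hm : ∀ j, j ≤ l → Measurable[fieldSigma X s] (fun ω =>
      fieldSum X (Finset.Ico 0 (N j)) x ω - α * varSum P X (N j)) := fun j hj =>
    (measurable_fieldSum (by
      rw [Finset.coe_Ico]
      exact (Set.Ico_subset_Ico_right (hN hj)).trans h) x).sub_const _
  exact measurableSet_lt (hm i hi') (hm l le_rfl)

lemma measurable_uncurry_blockExp [SFinite P] (hX : IsContinuousFields X) (m n : ℕ) (β : ℂ) :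
    Measurable (Function.uncurry (blockExp P X m n β)) := by
  have h1 := measurable_uncurry_fieldSum' hX (Finset.Ico m n)
  have h2 := measurable_laplace (P := P) hX (Finset.Ico m n) β
  simp only [Function.uncurry_def, blockExp]
  fun_prop

lemma measurableSet_uncurry_firstMax (hX : IsContinuousFields X) (N : ℕ → ℕ) (α : ℝ) (l : ℕ) :
    MeasurableSet {z : unitCube d × Ω | z.2 ∈ firstMax P X N α l z.1} := by
  have : {z : unitCube d × Ω | z.2 ∈ firstMax P X N α l z.1} = ⋂ i ∈ Finset.range l,
      {z : unitCube d × Ω | fieldSum X (Finset.Ico 0 (N i)) z.1 z.2 - α * varSum P X (N i)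
    < fieldSum X (Finset.Ico 0 (N l)) z.1 z.2 - α * varSum P X (N l)} := by
    ext z; simp [firstMax]
  rw [this]
  refine Finset.measurableSet_biInter _ fun i _ => ?_
  have h1 := measurable_uncurry_fieldSum' hX (Finset.Ico 0 (N i))
  have h2 := measurable_uncurry_fieldSum' hX (Finset.Ico 0 (N l))
  exact measurableSet_lt (by fun_prop) (by fun_prop)

lemma measurableSet_uncurry_barrier (hX : IsContinuousFields X) (N : ℕ → ℕ) (α : ℝ) (l J : ℕ) :
    MeasurableSet {z : unitCube d × Ω | z.2 ∈ barrier P X N α l J z.1} := by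
  have : {z : unitCube d × Ω | z.2 ∈ barrier P X N α l J z.1} = ⋂ i ∈ Finset.Ioc l J,
      {z : unitCube d × Ω | fieldSum X (Finset.Ico (N l) (N i)) z.1 z.2
        ≤ α * (varSum P X (N i) - varSum P X (N l))} := by
    ext z; simp [barrier]
  rw [this]
  refine Finset.measurableSet_biInter _ fun i _ => ?_
  have h1 := measurable_uncurry_fieldSum' hX (Finset.Ico (N l) (N i))
  exact measurableSet_le h1 measurable_const

lemma measurable_uncurry_indicator {E : unitCube d → Set Ω} {F : unitCube d → Ω → ℂ}
    (hE : MeasurableSet {z : unitCube d × Ω | z.2 ∈ E z.1}) (hF : Measurable (Function.uncurry F)) :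
    Measurable (Function.uncurry fun x => (E x).indicator (F x)) := by
  have : (Function.uncurry fun x => (E x).indicator (F x))
      = {z : unitCube d × Ω | z.2 ∈ E z.1}.indicator (Function.uncurry F) := by
    ext z; simp [Set.indicator, Function.uncurry]
  rw [this]
  exact hF.indicator hE

lemma measurable_truncExp {N : ℕ → ℕ} (hN : Monotone N) (α : ℝ) (l J : ℕ) (β : ℂ)
    (x : unitCube d) :
    Measurable[fieldSigma X (Set.Ico (N l) (N J))] (truncExp P X N α l J β x) :=
  (measurable_blockExp le_rfl β x).indicator (measurableSet_barrier hN le_rfl x)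

lemma measurable_uncurry_truncExp [SFinite P] (hX : IsContinuousFields X) (N : ℕ → ℕ) (α : ℝ)
    (l J : ℕ) (β : ℂ) : Measurable (Function.uncurry (truncExp P X N α l J β)) :=
  measurable_uncurry_indicator (measurableSet_uncurry_barrier hX N α l J)
    (measurable_uncurry_blockExp hX _ _ β)

end Decomposition

/-! ### Moments of integrals with an independent random weight. -/

section WeightedSecondMoment

variable {d : ℕ} {Ω : Type*} [mΩ : MeasurableSpace Ω] {P : Measure Ω}
  {X : ℕ → unitCube d → Ω → ℝ}

lemma enorm_mul_le_add_sq_div_two (a b : ℝ≥0∞) : a * b ≤ (a ^ 2 + b ^ 2) / 2 := by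
  rw [ENNReal.le_div_iff_mul_le (by simp) (by simp)]
  rcases eq_or_ne a ∞ with rfl | ha
  · simp
  rcases eq_or_ne b ∞ with rfl | hb
  · simp
  lift a to ℝ≥0 using ha
  lift b to ℝ≥0 using hb
  norm_cast
  have := sq_nonneg ((a : ℝ) - b)
  have h : (a : ℝ) * b * 2 ≤ a ^ 2 + b ^ 2 := by nlinarith
  exact_mod_cast h

lemma lintegral_mul_le_of_sq_le {f g : Ω → ℝ≥0∞} (hf : Measurable f) {Γ : ℝ≥0∞}
    (hfΓ : ∫⁻ ω, f ω ^ 2 ∂P ≤ Γ) (hgΓ : ∫⁻ ω, g ω ^ 2 ∂P ≤ Γ) : ∫⁻ ω, f ω * g ω ∂P ≤ Γ := by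
  calc ∫⁻ ω, f ω * g ω ∂P ≤ ∫⁻ ω, (f ω ^ 2 + g ω ^ 2) / 2 ∂P :=
        lintegral_mono fun ω => enorm_mul_le_add_sq_div_two _ _
    _ = (∫⁻ ω, f ω ^ 2 ∂P + ∫⁻ ω, g ω ^ 2 ∂P) / 2 := by
        simp only [div_eq_mul_inv]
        rw [lintegral_mul_const' _ _ (by simp), lintegral_add_left (hf.pow_const 2)]
    _ ≤ (Γ + Γ) / 2 := by gcongr
    _ = Γ := by rw [← two_mul, mul_comm, ENNReal.mul_div_cancel_right (by simp) (by simp)]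

/-- Second moment bound for an integral over `Q` with a random weight independent of the field. -/
lemma lintegral_sq_weighted_le [IsProbabilityMeasure P]
    (h : IsLogCorrelatedSequence P X) {s t : Set ℕ} (hst : Disjoint s t)
    {Q : Set (unitCube d)} (hQ : MeasurableSet Q) {f : unitCube d → ℂ} (hf : Measurable f)
    {Φ Γ Z : ℝ≥0∞} (hΦ : Φ ≠ ∞) (hΓ : Γ ≠ ∞) (hZ : Z ≠ ∞) (hfΦ : ∀ x, ‖f x‖ₑ ≤ Φ)
    {G ζ : unitCube d → Ω → ℂ} (hG : ∀ x, Measurable[fieldSigma X s] (G x))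
    (hG' : Measurable (Function.uncurry G)) (hζ : ∀ x, Measurable[fieldSigma X t] (ζ x))
    (hζ' : Measurable (Function.uncurry ζ)) (hGΓ : ∀ x ∈ Q, ∫⁻ ω, ‖G x ω‖ₑ ^ 2 ∂P ≤ Γ)
    (hζZ : ∀ x ∈ Q, ∫⁻ ω, ‖ζ x ω‖ₑ ^ 2 ∂P ≤ Z) :
    ∫⁻ ω, ‖∫ x in Q, f x * (G x ω * ζ x ω) ∂(cubeVolume d)‖ₑ ^ 2 ∂P
      ≤ Φ ^ 2 * Γ * ∫⁻ z, ‖∫ ω, ζ z.1 ω * (starRingEnd ℂ) (ζ z.2 ω) ∂P‖ₑ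
        ∂(((cubeVolume d).restrict Q).prod ((cubeVolume d).restrict Q)) := by
  set ν := (cubeVolume d).restrict Q
  set F : unitCube d → Ω → ℂ := fun x ω => f x * (G x ω * ζ x ω) with hF
  have hFm : Measurable (Function.uncurry F) :=
    (hf.comp measurable_fst).mul (hG'.mul hζ')
  have hm : ∀ {M : MeasurableSpace Ω} {u : Ω → ℂ}, Measurable u →
      Measurable fun ω => ‖u ω‖ₑ ^ 2 := fun hu => (Measurable.enorm hu).pow_const 2
  have hfin : ∫⁻ z, ‖F z.1 z.2‖ₑ ^ 2 ∂(ν.prod P) < ∞ := by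
    rw [lintegral_prod (fun z : unitCube d × Ω => ‖F z.1 z.2‖ₑ ^ 2)
      (Measurable.aemeasurable ((hFm.enorm).pow_const 2))]
    have hx : ∀ x ∈ Q, ∫⁻ ω, ‖F x ω‖ₑ ^ 2 ∂P ≤ Φ ^ 2 * (Γ * Z) := by
      intro x hx
      have e : ∀ ω, ‖F x ω‖ₑ ^ 2 = ‖f x‖ₑ ^ 2 * (‖G x ω‖ₑ ^ 2 * ‖ζ x ω‖ₑ ^ 2) := fun ω => by
        simp only [hF, enorm_mul, mul_pow]
      simp only [e]
      rw [lintegral_const_mul' _ _ (by simp), lintegral_mul_of_disjoint h.fields h.indep hst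
        (hm (hG x)) (hm (hζ x))]
      gcongr
      exacts [hfΦ x, hGΓ x hx, hζZ x hx]
    calc ∫⁻ x, ∫⁻ ω, ‖F x ω‖ₑ ^ 2 ∂P ∂ν ≤ ∫⁻ _x in Q, Φ ^ 2 * (Γ * Z) ∂(cubeVolume d) :=
          setLIntegral_mono' hQ hx
      _ < ∞ := by
          rw [setLIntegral_const]
          exact ENNReal.mul_lt_top (ENNReal.mul_lt_top (ENNReal.pow_lt_top hΦ.lt_top)
            (ENNReal.mul_lt_top hΓ.lt_top hZ.lt_top)) (measure_lt_top _ _)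
  refine (lintegral_sq_integral_le hFm hfin).trans ?_
  have hQQ : ν.prod ν = ((cubeVolume d).prod (cubeVolume d)).restrict (Q ×ˢ Q) :=
    Measure.prod_restrict Q Q
  rw [hQQ, ← lintegral_const_mul' _ _ (ENNReal.mul_ne_top (ENNReal.pow_ne_top hΦ) hΓ)]
  refine setLIntegral_mono' (hQ.prod hQ) fun z hz => ?_
  -- By independence the two-point function of the weight, bounded by `Γ` through its second
  -- moments, splits off, and that of `ζ` stays inside the norm.
  have e : ∀ ω, F z.1 ω * (starRingEnd ℂ) (F z.2 ω) = f z.1 * (starRingEnd ℂ) (f z.2) *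
      ((G z.1 ω * (starRingEnd ℂ) (G z.2 ω)) * (ζ z.1 ω * (starRingEnd ℂ) (ζ z.2 ω))) := fun ω => by
    simp only [hF, map_mul]; ring
  simp only [e]
  rw [integral_const_mul, integral_mul_of_disjoint h.fields h.indep hst
    (F := fun ω => G z.1 ω * (starRingEnd ℂ) (G z.2 ω))
    (G := fun ω => ζ z.1 ω * (starRingEnd ℂ) (ζ z.2 ω))
    ((hG z.1).mul (Complex.continuous_conj.measurable.comp (hG z.2)))
    ((hζ z.1).mul (Complex.continuous_conj.measurable.comp (hζ z.2)))]
  rw [enorm_mul, enorm_mul, enorm_mul, RCLike.enorm_conj, ← mul_assoc, pow_two]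
  gcongr
  · exact hfΦ z.1
  · exact hfΦ z.2
  · refine (enorm_integral_le_lintegral_enorm _).trans ?_
    simp only [enorm_mul, RCLike.enorm_conj]
    exact lintegral_mul_le_of_sq_le ((hG z.1).mono (fieldSigma_le h.fields) le_rfl).enorm
      (hGΓ _ hz.1) (hGΓ _ hz.2)

/-- `L^p` bound for an integral whose random weight is comparable to a single random variable. -/
lemma lintegral_rpow_weighted_le [IsProbabilityMeasure P]
    (h : IsLogCorrelatedSequence P X) {s t : Set ℕ}
    (hst : Disjoint s t) {Q : Set (unitCube d)} (hQ : MeasurableSet Q) {f : unitCube d → ℂ}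
    (hf : Measurable f) {Φ Z : ℝ≥0∞} (hΦ : Φ ≠ ∞) (hZ : Z ≠ ∞) (hfΦ : ∀ x, ‖f x‖ₑ ≤ Φ)
    {G ζ : unitCube d → Ω → ℂ} (hG : ∀ x, Measurable[fieldSigma X s] (G x))
    (hG' : Measurable (Function.uncurry G)) (hζ : ∀ x, Measurable[fieldSigma X t] (ζ x))
    (hζ' : Measurable (Function.uncurry ζ)) (hζZ : ∀ x ∈ Q, ∫⁻ ω, ‖ζ x ω‖ₑ ^ 2 ∂P ≤ Z)
    {p : ℝ} (hp1 : 1 ≤ p) (hp2 : p ≤ 2) {m : Ω → ℝ} (hm : Measurable[fieldSigma X s] m)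
    (hm0 : ∀ ω, 0 < m ω) {D : Set Ω} (hD : MeasurableSet D) {c : ℝ≥0∞} (hc : c ≠ ∞)
    (hGD : ∀ x, ∀ ω, ω ∉ D → G x ω = 0) (hGm : ∀ x ω, ‖G x ω‖ₑ ≤ c * ENNReal.ofReal (m ω))
    (hmp : ∫⁻ ω in D, ENNReal.ofReal (m ω ^ p) ∂P ≠ ∞) :
    ∫⁻ ω, ‖∫ x in Q, f x * (G x ω * ζ x ω) ∂(cubeVolume d)‖ₑ ^ p ∂P
      ≤ (∫⁻ ω in D, ENNReal.ofReal (m ω ^ p) ∂P) * (Φ ^ 2 * c ^ 2 *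
        ∫⁻ z, ‖∫ ω, ζ z.1 ω * (starRingEnd ℂ) (ζ z.2 ω) ∂P‖ₑ
        ∂(((cubeVolume d).restrict Q).prod ((cubeVolume d).restrict Q))) ^ (p / 2) := by
  set μp := ∫⁻ ω in D, ENNReal.ofReal (m ω ^ p) ∂P
  set aQ := ∫⁻ z, ‖∫ ω, ζ z.1 ω * (starRingEnd ℂ) (ζ z.2 ω) ∂P‖ₑ
        ∂(((cubeVolume d).restrict Q).prod ((cubeVolume d).restrict Q))
  have hmm : Measurable m := hm.mono (fieldSigma_le h.fields) le_rfl
  -- Rescaling by `m^(p/2 - 1)` gives the weight a second moment controlled by the `p`-th moment of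
  -- `m` on `D`. Hölder with weights `1 - p/2` and `p/2` then restores the factor `m^(1 - p/2)`, so
  -- no second moment of `m` is needed.
  set G₁ : unitCube d → Ω → ℂ := fun x ω => ((m ω ^ (p / 2 - 1) : ℝ) : ℂ) * G x ω with hG₁
  have hmr : ∀ {M : MeasurableSpace Ω} {u : Ω → ℝ} (r : ℝ), Measurable u →
      Measurable fun ω => ((u ω ^ r : ℝ) : ℂ) := fun r hu =>
    Complex.measurable_ofReal.comp (hu.pow_const r)
  have h1 : ∀ x, Measurable[fieldSigma X s] (G₁ x) := fun x =>
    (hmr (p / 2 - 1) hm).mul (hG x)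
  have h2 : Measurable (Function.uncurry G₁) :=
    ((hmr (p / 2 - 1) hmm).comp measurable_snd).mul hG'
  set I₁ : Ω → ℂ := fun ω => ∫ x in Q, f x * (G₁ x ω * ζ x ω) ∂(cubeVolume d) with hI₁
  have hsq : ∀ x, ∫⁻ ω, ‖G₁ x ω‖ₑ ^ 2 ∂P ≤ c ^ 2 * μp := by
    intro x
    rw [← lintegral_const_mul' _ _ (ENNReal.pow_ne_top hc), ← lintegral_indicator hD]
    refine lintegral_mono fun ω => ?_
    by_cases hω : ω ∈ D
    · rw [Set.indicator_of_mem hω]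
      simp only [hG₁, enorm_mul, mul_pow]
      have e1 : ‖((m ω ^ (p / 2 - 1) : ℝ) : ℂ)‖ₑ = ENNReal.ofReal (m ω ^ (p / 2 - 1)) := by
        rw [← ofReal_norm, Complex.norm_real, Real.norm_of_nonneg]
        exact (Real.rpow_pos_of_pos (hm0 ω) _).le
      rw [e1]
      calc _ ≤ ENNReal.ofReal (m ω ^ (p / 2 - 1)) ^ 2 * (c * ENNReal.ofReal (m ω)) ^ 2 := by
            gcongr; exact hGm x ω
        _ = c ^ 2 * (ENNReal.ofReal (m ω ^ (p / 2 - 1)) * ENNReal.ofReal (m ω)) ^ 2 := by ring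
        _ = c ^ 2 * ENNReal.ofReal (m ω ^ p) := by
            rw [← ENNReal.ofReal_mul (Real.rpow_pos_of_pos (hm0 ω) _).le,
              ← Real.rpow_add_one (hm0 ω).ne', ← ENNReal.ofReal_pow
              (Real.rpow_pos_of_pos (hm0 ω) _).le, ← Real.rpow_natCast,
              ← Real.rpow_mul (hm0 ω).le]
            congr 3; push_cast; ring
    · rw [Set.indicator_of_notMem hω]
      simp [hG₁, hGD x ω hω]
  have hI₁m : AEMeasurable (fun ω => ‖I₁ ω‖ₑ ^ 2) P := by
    have : StronglyMeasurable (Function.uncurry fun ω x => f x * (G₁ x ω * ζ x ω)) := by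
      refine Measurable.stronglyMeasurable ?_
      exact (hf.comp measurable_snd).mul ((h2.comp measurable_swap).mul (hζ'.comp measurable_swap))
    exact ((this.integral_prod_right (ν := (cubeVolume d).restrict Q)).measurable.enorm.pow_const
      2).aemeasurable
  have hW : ∫⁻ ω, ‖I₁ ω‖ₑ ^ 2 ∂P ≤ Φ ^ 2 * (c ^ 2 * μp) * aQ :=
    lintegral_sq_weighted_le h hst hQ hf hΦ (ENNReal.mul_ne_top (ENNReal.pow_ne_top hc) hmp) hZ hfΦ
      h1 h2 hζ hζ' (fun x _ => hsq x) hζZ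
  have hpt : ∀ ω, ‖∫ x in Q, f x * (G x ω * ζ x ω) ∂(cubeVolume d)‖ₑ ^ p
      ≤ (D.indicator (fun ω => ENNReal.ofReal (m ω ^ p)) ω) ^ (1 - p / 2)
        * (‖I₁ ω‖ₑ ^ 2) ^ (p / 2) := by
    intro ω
    by_cases hω : ω ∈ D
    · rw [Set.indicator_of_mem hω]
      have e1 : ∫ x in Q, f x * (G x ω * ζ x ω) ∂(cubeVolume d)
          = ((m ω ^ (1 - p / 2) : ℝ) : ℂ) * I₁ ω := by
        rw [hI₁, ← integral_const_mul]
        refine integral_congr_ae (ae_of_all _ fun x => ?_)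
        simp only [hG₁]
        have : ((m ω ^ (1 - p / 2) : ℝ) : ℂ) * ((m ω ^ (p / 2 - 1) : ℝ) : ℂ) = 1 := by
          rw [← Complex.ofReal_mul, ← Real.rpow_add (hm0 ω)]
          simp
        linear_combination -(f x * (G x ω * ζ x ω)) * this
      have e2 : ‖((m ω ^ (1 - p / 2) : ℝ) : ℂ)‖ₑ = ENNReal.ofReal (m ω ^ (1 - p / 2)) := by
        rw [← ofReal_norm, Complex.norm_real, Real.norm_of_nonneg]
        exact (Real.rpow_pos_of_pos (hm0 ω) _).le
      rw [e1, enorm_mul, e2, ENNReal.mul_rpow_of_nonneg _ _ (by linarith)]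
      refine le_of_eq (congrArg₂ _ ?_ ?_)
      · rw [ENNReal.ofReal_rpow_of_pos (Real.rpow_pos_of_pos (hm0 ω) _),
          ENNReal.ofReal_rpow_of_pos (Real.rpow_pos_of_pos (hm0 ω) _),
          ← Real.rpow_mul (hm0 ω).le, ← Real.rpow_mul (hm0 ω).le, mul_comm]
      · rw [← ENNReal.rpow_natCast, ← ENNReal.rpow_mul]
        congr 1; push_cast; ring
    · have : ∫ x in Q, f x * (G x ω * ζ x ω) ∂(cubeVolume d) = 0 := by
        simp [hGD _ ω hω]
      rw [this, enorm_zero, ENNReal.zero_rpow_of_pos (by linarith)]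
      exact bot_le
  have hDm : Measurable (D.indicator fun ω => ENNReal.ofReal (m ω ^ p)) :=
    ((hmm.pow_const p).ennreal_ofReal).indicator hD
  refine (lintegral_mono hpt).trans ((ENNReal.lintegral_mul_norm_pow_le hDm.aemeasurable
    hI₁m (by linarith) (by linarith) (by ring)).trans ?_)
  rw [lintegral_indicator hD]
  have hp0 : 0 ≤ p / 2 := by linarith
  calc μp ^ (1 - p / 2) * (∫⁻ ω, ‖I₁ ω‖ₑ ^ 2 ∂P) ^ (p / 2)
      ≤ μp ^ (1 - p / 2) * (μp * (Φ ^ 2 * c ^ 2 * aQ)) ^ (p / 2) := by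
        gcongr
        refine hW.trans_eq ?_
        ring
    _ = μp * (Φ ^ 2 * c ^ 2 * aQ) ^ (p / 2) := by
        rw [ENNReal.mul_rpow_of_nonneg _ _ hp0, ← mul_assoc,
          ← ENNReal.rpow_add_of_nonneg _ _ (by linarith) hp0]
        simp

end WeightedSecondMoment

end Chaos

namespace Chaos

/-! ### Integrability over the cube and moment bounds for one cell. -/

section Compactness

variable {d : ℕ} {Ω : Type*} [mΩ : MeasurableSpace Ω] {P : Measure Ω}
  {X : ℕ → unitCube d → Ω → ℝ}

instance : CompactSpace (unitCube d) := by
  refine isCompact_iff_compactSpace.1 ?_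
  have : unitCube d = (WithLp.toLp 2) '' (Set.univ.pi fun _ : Fin d => Set.Icc (0 : ℝ) 1) := by
    ext x
    simp only [unitCube, Set.mem_ofPred_eq, Set.mem_image, Set.mem_pi, Set.mem_univ, true_imp_iff]
    exact ⟨fun h => ⟨WithLp.ofLp x, h, rfl⟩, by rintro ⟨y, hy, rfl⟩; exact hy⟩
  rw [this]
  exact (isCompact_univ_pi fun _ => isCompact_Icc).image (PiLp.continuous_toLp 2 _)

lemma exists_norm_blockExp_le (hX : IsContinuousFields X) {δ B τ C : ℝ}
    (hb : BlockBounds P X δ B τ C) {m n : ℕ} (hmn : m ≤ n) {β : ℂ} (hre : |β.re| ≤ B)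
    (him : |β.im| ≤ τ) (ω : Ω) : ∃ K : ℝ, ∀ x, ‖blockExp P X m n β x ω‖ ≤ K := by
  have hc : Continuous fun x => C * Real.exp (β.re * fieldSum X (Finset.Ico m n) x ω
        - (β.re ^ 2 - β.im ^ 2) * (varSum P X n - varSum P X m) / 2) := by
    have := continuous_fieldSum hX (Finset.Ico m n) ω
    fun_prop
  obtain ⟨K, hK⟩ := isCompact_univ.exists_bound_of_continuousOn hc.continuousOn
  exact ⟨K, fun x => (hb.norm_blockExp_le hmn hre him x ω).trans
    ((le_abs_self _).trans (hK x (Set.mem_univ x)))⟩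

lemma integrable_of_norm_le_blockExp (hX : IsContinuousFields X) {δ B τ C : ℝ}
    (hb : BlockBounds P X δ B τ C) {m n : ℕ} (hmn : m ≤ n) {β : ℂ} (hre : |β.re| ≤ B)
    (him : |β.im| ≤ τ) (ω : Ω) {f : unitCube d → ℂ} (Φ : ℝ) (hfΦ : ∀ x, ‖f x‖ ≤ Φ)
    {F : unitCube d → ℂ} (hF : Measurable F)
    (hle : ∀ x, ‖F x‖ ≤ ‖f x‖ * ‖blockExp P X m n β x ω‖) : Integrable F (cubeVolume d) := by
  obtain ⟨K, hK⟩ := exists_norm_blockExp_le hX hb hmn hre him ω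
  refine (integrable_const (Φ * K)).mono' hF.aestronglyMeasurable (ae_of_all _ fun x => ?_)
  exact (hle x).trans (mul_le_mul (hfΦ x) (hK x) (norm_nonneg _) ((norm_nonneg _).trans (hfΦ x)))

end Compactness

section MomentBounds

variable {d : ℕ} {Ω : Type*} [mΩ : MeasurableSpace Ω] {P : Measure Ω}
  {X : ℕ → unitCube d → Ω → ℝ}

lemma BlockBounds.lintegral_exp_le [IsProbabilityMeasure P]
    (h : IsLogCorrelatedSequence P X) {δ B τ C : ℝ}
    (hb : BlockBounds P X δ B τ C) {m n : ℕ} (hmn : m ≤ n) (x : unitCube d) {a : ℝ}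
    (ha : |a| ≤ B) (r : ℝ) :
    ∫⁻ ω, ENNReal.ofReal (Real.exp (a * fieldSum X (Finset.Ico m n) x ω + r)) ∂P
      ≤ ENNReal.ofReal (C * Real.exp (a ^ 2 * (varSum P X n - varSum P X m) / 2 + r)) := by
  have hi := (h.integrable_exp_fieldSum a (Finset.Ico m n) x).mul_const (Real.exp r)
  simp only [Real.exp_add]
  rw [← ofReal_integral_eq_lintegral_ofReal hi (ae_of_all _ fun _ => by positivity),
    integral_mul_const, ← mul_assoc]
  gcongr
  exact hb.upper m n hmn x a ha

lemma BlockBounds.lintegral_blockExp_pow_le [IsProbabilityMeasure P]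
    (h : IsLogCorrelatedSequence P X) {δ B τ C : ℝ}
    (hb : BlockBounds P X δ B τ C) {m n : ℕ} (hmn : m ≤ n) {β : ℂ} (hre : |β.re| ≤ B)
    (him : |β.im| ≤ τ) (x : unitCube d) (k : ℕ) (hk : |k * β.re| ≤ B) :
    ∫⁻ ω, ‖blockExp P X m n β x ω‖ₑ ^ k ∂P ≤ ENNReal.ofReal (C ^ (k + 1) *
      Real.exp ((k * β.re) ^ 2 * (varSum P X n - varSum P X m) / 2
        - k * ((β.re ^ 2 - β.im ^ 2) * (varSum P X n - varSum P X m) / 2))) := by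
  have hC := hb.one_le
  have h1 := hb.lintegral_exp_le h hmn x hk
    (-(k * ((β.re ^ 2 - β.im ^ 2) * (varSum P X n - varSum P X m) / 2)))
  calc _ ≤ ∫⁻ ω, ENNReal.ofReal (C ^ k) * ENNReal.ofReal (Real.exp (k * β.re *
        fieldSum X (Finset.Ico m n) x ω
        + -(k * ((β.re ^ 2 - β.im ^ 2) * (varSum P X n - varSum P X m) / 2)))) ∂P := by
        refine lintegral_mono fun ω => ?_
        rw [← ofReal_norm, ← ENNReal.ofReal_pow (norm_nonneg _),
          ← ENNReal.ofReal_mul (by positivity)]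
        refine ENNReal.ofReal_le_ofReal ((pow_le_pow_left₀ (norm_nonneg _)
          (hb.norm_blockExp_le hmn hre him x ω) k).trans (le_of_eq ?_))
        rw [mul_pow, ← Real.exp_nat_mul]
        congr 2
        ring
    _ ≤ _ := by
        rw [lintegral_const_mul' _ _ ENNReal.ofReal_ne_top]
        refine (mul_le_mul_right h1 _).trans (le_of_eq ?_)
        rw [← ENNReal.ofReal_mul (by positivity), ← mul_assoc, ← pow_succ]
        simp only [sub_eq_add_neg]

/-- The two-point function of the truncated exponential integrated over a cell. -/
lemma exists_lintegral_truncExp_le [IsProbabilityMeasure P]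
    (hd : 1 ≤ d) {κ : ℝ} (hκ : κ < d) (C c A : ℝ) :
    ∃ K : ℝ, 0 ≤ K ∧ ∀ {X : ℕ → unitCube d → Ω → ℝ}, IsLogCorrelatedSequence P X →
      ∀ {δ B τ α η : ℝ} {β : ℂ} {N : ℕ → ℕ}, BlockBounds P X δ B τ C → IsLevels P X N A →
      Exponents B τ α η κ c β → ∀ {l J : ℕ}, l ≤ J → ∀ {n : ℕ}, 0 < n → Real.sqrt d / n ≤ δ →
      Real.sqrt d / n ≤ Real.exp (-l) → ∀ q : Fin d → ℕ,
      ∫⁻ z, ‖∫ ω, truncExp P X N α l J β z.1 ω * (starRingEnd ℂ) (truncExp P X N α l J β z.2 ω) ∂P‖ₑ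
        ∂(((cubeVolume d).restrict (cell n q)).prod ((cubeVolume d).restrict (cell n q)))
        ≤ ENNReal.ofReal (K * (1 / n : ℝ) ^ (2 * d) * (n * Real.exp (-l)) ^ κ) := by
  obtain ⟨C', hC', hbound⟩ := exists_truncExp_bound (P := P) (d := d) C κ c A
  obtain ⟨K, hK, hker⟩ := lintegral_dist_rpow hd hκ
  have hs : 0 < Real.sqrt d + 1 := by positivity
  refine ⟨C' * K * (Real.sqrt d + 1) ^ (d - κ), by positivity, ?_⟩
  intro X h δ B τ α η β N hb hN he l J hlJ n hn hnδ hnl q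
  have hn' : (0 : ℝ) < n := by exact_mod_cast hn
  set Q := cell (d := d) n q
  have hQ : MeasurableSet Q := measurableSet_cell n q
  set R := (Real.sqrt d + 1) / n with hR
  have hR0 : 0 < R := by positivity
  have hdist : ∀ x ∈ Q, ∀ y ∈ Q, dist x y < R := fun x hx y hy =>
    (dist_le_of_mem_cell hn hx hy).trans_lt (by rw [hR]; gcongr; linarith)
  have hζ := measurable_uncurry_truncExp (P := P) h.fields N α l J β
  have hm : Measurable fun z : unitCube d × unitCube d =>
      ‖∫ ω, truncExp P X N α l J β z.1 ω * (starRingEnd ℂ) (truncExp P X N α l J β z.2 ω) ∂P‖ₑ := by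
    have hs : StronglyMeasurable (Function.uncurry fun (z : unitCube d × unitCube d) (ω : Ω) =>
        truncExp P X N α l J β z.1 ω * (starRingEnd ℂ) (truncExp P X N α l J β z.2 ω)) := by
      refine Measurable.stronglyMeasurable ?_
      exact (hζ.comp (f := fun q : (unitCube d × unitCube d) × Ω => (q.1.1, q.2)) (by fun_prop)).mul
        (Complex.continuous_conj.measurable.comp
        (hζ.comp (f := fun q : (unitCube d × unitCube d) × Ω => (q.1.2, q.2)) (by fun_prop)))
    exact hs.integral_prod_right.measurable.enorm
  rw [lintegral_prod _ hm.aemeasurable]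
  have hinner : ∀ x ∈ Q, ∫⁻ y in Q, ‖∫ ω, truncExp P X N α l J β x ω
      * (starRingEnd ℂ) (truncExp P X N α l J β y ω) ∂P‖ₑ ∂(cubeVolume d)
      ≤ ENNReal.ofReal (C' * Real.exp (-(κ * l)) * (K * R ^ (d - κ))) := by
    intro x hx
    -- The two-point estimate excludes the diagonal, a null set as `d ≥ 1`.
    have hne : ∀ᵐ y ∂(cubeVolume d), y ≠ x := by
      have := cubeVolume_singleton hd x
      rw [← compl_mem_ae_iff] at this
      exact this
    have hpt : ∀ᵐ y ∂((cubeVolume d).restrict Q), ‖∫ ω, truncExp P X N α l J β x ω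
        * (starRingEnd ℂ) (truncExp P X N α l J β y ω) ∂P‖ₑ
        ≤ ENNReal.ofReal (C' * Real.exp (-(κ * l))) * ENNReal.ofReal (dist x y ^ (-κ)) := by
      filter_upwards [ae_restrict_mem hQ, ae_restrict_of_ae hne] with y hy hyx
      have hD : 0 < dist x y := dist_pos.2 (Ne.symm hyx)
      have hle := dist_le_of_mem_cell hn hx hy
      have hlog : (l : ℝ) ≤ Real.log (1 / dist x y) := by
        rw [one_div, Real.log_inv, le_neg, Real.log_le_iff_le_exp hD]
        exact hle.trans hnl
      have h1 := hbound h hb hN he hlJ (Ne.symm hyx) (hle.trans hnδ) hlog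
      rw [← ofReal_norm, ← ENNReal.ofReal_mul (by positivity)]
      refine ENNReal.ofReal_le_ofReal (h1.trans (le_of_eq ?_))
      rw [Real.rpow_def_of_pos hD, mul_assoc, ← Real.exp_add, one_div, Real.log_inv]
      ring_nf
    refine (lintegral_mono_ae hpt).trans ?_
    rw [lintegral_const_mul' _ _ ENNReal.ofReal_ne_top,
      ENNReal.ofReal_mul (by positivity : 0 ≤ C' * Real.exp (-(κ * l)))]
    exact mul_le_mul_right (hker R hR0 x Q hQ (hdist x hx)) _
  refine (setLIntegral_mono' hQ hinner).trans ?_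
  rw [setLIntegral_const]
  refine (mul_le_mul_right (cubeVolume_cell_le hn q) _).trans ?_
  rw [← ENNReal.ofReal_mul (by positivity)]
  refine ENNReal.ofReal_le_ofReal (le_of_eq ?_)
  have e1 : R ^ (d - κ) = (Real.sqrt d + 1) ^ (d - κ) * ((1 / n : ℝ) ^ d * (n : ℝ) ^ κ) := by
    rw [hR, Real.div_rpow hs.le hn'.le, Real.rpow_sub hn', Real.rpow_natCast, div_div_eq_mul_div,
      one_div, inv_pow]
    field_simp
  have e2 : ((n : ℝ) * Real.exp (-l)) ^ κ = (n : ℝ) ^ κ * Real.exp (-(κ * l)) := by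
    rw [Real.mul_rpow hn'.le (Real.exp_pos _).le, ← Real.exp_mul]
    ring_nf
  rw [e1, e2, two_mul, pow_add]
  ring

/-- Exponential moments on the event of a high value. -/
lemma BlockBounds.lintegral_high_le [IsProbabilityMeasure P]
    (h : IsLogCorrelatedSequence P X) {δ B τ C α η κ c c₁ p : ℝ}
    {β : ℂ} (hb : BlockBounds P X δ B τ C) (he : Exponents B τ α η κ c β) (hp0 : 0 ≤ p)
    (hp : p * β.re + η ≤ B)
    (hdec : (p * β.re + η) ^ 2 / 2 - η * α - p * (β.re ^ 2 - β.im ^ 2) / 2 ≤ -c₁) (n : ℕ)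
    (x : unitCube d) :
    ∫⁻ ω in {ω | α * varSum P X n - 1 ≤ fieldSum X (Finset.Ico 0 n) x ω},
      ENNReal.ofReal (Real.exp (β.re * fieldSum X (Finset.Ico 0 n) x ω
        - (β.re ^ 2 - β.im ^ 2) * varSum P X n / 2) ^ p) ∂P
      ≤ ENNReal.ofReal (C * Real.exp B * Real.exp (-c₁ * varSum P X n)) := by
  have hC := hb.one_le
  set v := varSum P X n with hv
  have hv0 : 0 ≤ v := varSum_nonneg n
  have hS := measurable_fieldSum' h.fields (Finset.Ico 0 n) x
  have hre := he.re_nonneg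
  have hη := he.eta_nonneg
  have h1 := hb.lintegral_exp_le h (Nat.zero_le n) x (a := p * β.re + η) (by
    rw [abs_of_nonneg (by positivity)]; exact hp)
    (η * (1 - α * v) - p * ((β.re ^ 2 - β.im ^ 2) * v / 2))
  rw [varSum_zero, sub_zero] at h1
  refine le_trans ?_ (h1.trans ?_)
  · refine le_trans ?_ (setLIntegral_le_lintegral {ω | α * v - 1 ≤ fieldSum X (Finset.Ico 0 n) x ω} _)
    refine setLIntegral_mono' (measurableSet_le measurable_const hS) fun ω hω => ?_
    rw [← Real.exp_mul]
    refine ENNReal.ofReal_le_ofReal (Real.exp_le_exp.2 ?_)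
    -- Chernoff: on the event the tilt is at least `1`. The shift by `1` in the threshold costs `e^η
    -- ≤ e^B`.
    have : 0 ≤ η * (fieldSum X (Finset.Ico 0 n) x ω - (α * v - 1)) :=
      mul_nonneg hη (sub_nonneg.2 hω)
    linarith
  · refine ENNReal.ofReal_le_ofReal ?_
    rw [mul_assoc, ← Real.exp_add]
    refine mul_le_mul_of_nonneg_left (Real.exp_le_exp.2 ?_) (by linarith)
    have h2 := mul_le_mul_of_nonneg_right hdec hv0
    have h3 : η ≤ B := by nlinarith [mul_nonneg hp0 hre]
    linarith

/-- The increments exceed `1` with small probability. -/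
lemma measure_increment_le (h : IsLogCorrelatedSequence P X) {r C : ℝ} (hr : 0 < r)
    (hC : ∀ n ≥ 1, ∀ x y : unitCube d,
      ∫⁻ ω, ‖∑ k ∈ Finset.range n, (X k x ω - X k y ω)‖ₑ ^ r ∂P
        ≤ ENNReal.ofReal (C * Real.exp (r * varSum P X n) * dist x y ^ r)) (n : ℕ)
    (x y : unitCube d) :
    P {ω | 1 < |fieldSum X (Finset.Ico 0 n) x ω - fieldSum X (Finset.Ico 0 n) y ω|}
      ≤ ENNReal.ofReal (C * Real.exp (r * varSum P X n) * dist x y ^ r) := by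
  rcases Nat.eq_zero_or_pos n with rfl | hn
  · simp [fieldSum, not_lt.2 zero_le_one]
  refine le_trans ?_ (hC n hn x y)
  have e : ∀ ω, ∑ k ∈ Finset.range n, (X k x ω - X k y ω)
      = fieldSum X (Finset.Ico 0 n) x ω - fieldSum X (Finset.Ico 0 n) y ω := fun ω => by
    rw [fieldSum, fieldSum, Finset.range_eq_Ico, Finset.sum_sub_distrib]
  simp only [e]
  have h1 := measurable_fieldSum' h.fields (Finset.Ico 0 n) x
  have h2 := measurable_fieldSum' h.fields (Finset.Ico 0 n) y
  have hset : MeasurableSet {ω | 1 < |fieldSum X (Finset.Ico 0 n) x ω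
      - fieldSum X (Finset.Ico 0 n) y ω|} := measurableSet_lt measurable_const (by fun_prop)
  rw [← lintegral_indicator_one hset]
  refine lintegral_mono fun ω => ?_
  by_cases hω : 1 < |fieldSum X (Finset.Ico 0 n) x ω - fieldSum X (Finset.Ico 0 n) y ω|
  swap
  · rw [Set.indicator_of_notMem (by exact hω)]
    exact bot_le
  rw [Set.indicator_of_mem (by exact hω), Pi.one_apply]
  refine ENNReal.one_le_rpow ?_ hr
  rw [Real.enorm_eq_ofReal_abs, ENNReal.one_le_ofReal]
  exact hω.le

end MomentBounds

end Chaos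

namespace Chaos

/-! ### Bounds in `L^p` over one cell: small and large oscillation. -/

section CloseEvent

variable {d : ℕ} {Ω : Type*} {X : ℕ → unitCube d → Ω → ℝ}

/-- The event that the sum of the first `n` fields at `x` is close to its value at `y`. -/
def closeEvent (X : ℕ → unitCube d → Ω → ℝ) (n : ℕ) (y x : unitCube d) : Set Ω :=
  {ω | |fieldSum X (Finset.Ico 0 n) x ω - fieldSum X (Finset.Ico 0 n) y ω| ≤ 1}

lemma measurableSet_closeEvent {n : ℕ} {s : Set ℕ} (h : Set.Ico 0 n ⊆ s) (y x : unitCube d) :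
    MeasurableSet[fieldSigma X s] (closeEvent X n y x) := by
  have h' : ((Finset.Ico 0 n : Finset ℕ) : Set ℕ) ⊆ s := by rwa [Finset.coe_Ico]
  have h1 := measurable_fieldSum (X := X) h' x
  have h2 := measurable_fieldSum (X := X) h' y
  exact (continuous_abs.measurable.comp (h1.sub h2)) measurableSet_Iic

end CloseEvent

section LevelBound

variable {d : ℕ} {Ω : Type*} [mΩ : MeasurableSpace Ω] {P : Measure Ω}
  {X : ℕ → unitCube d → Ω → ℝ}

/-- Exponents entering the `L^p` estimate of the chaos. -/
structure MomentExponents (B τ α η κ c c₁ p : ℝ) (β : ℂ) : Prop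
    extends Exponents B τ α η κ c β where
  one_le : 1 ≤ p
  le_two : p ≤ 2
  -- Keeps the fourth moment, used on the event of large oscillation, within reach of the block
  -- bounds.
  four_le : 4 * β.re ≤ B
  im_le_one : |β.im| ≤ 1
  high_le : p * β.re + η ≤ B
  high : (p * β.re + η) ^ 2 / 2 - η * α - p * (β.re ^ 2 - β.im ^ 2) / 2 ≤ -c₁

lemma measurableSet_uncurry_closeEvent (hX : IsContinuousFields X) (n : ℕ) (y : unitCube d) :
    MeasurableSet {z : unitCube d × Ω | z.2 ∈ closeEvent X n y z.1} := by
  have h1 := measurable_uncurry_fieldSum' hX (Finset.Ico 0 n)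
  have h2 := measurable_fieldSum' hX (Finset.Ico 0 n) y
  have h3 : Measurable fun z : unitCube d × Ω => fieldSum X (Finset.Ico 0 n) z.1 z.2 := h1
  exact measurableSet_le (h3.sub (h2.comp measurable_snd)).abs measurable_const

lemma measurable_startExp {N : ℕ → ℕ} (hN : Monotone N) {α : ℝ} {l : ℕ} {s : Set ℕ}
    (h : Set.Ico 0 (N l) ⊆ s) (β : ℂ) (x : unitCube d) :
    Measurable[fieldSigma X s] (startExp P X N α l β x) :=
  (measurable_blockExp h β x).indicator (measurableSet_firstMax hN h x)

lemma measurable_uncurry_startExp [IsProbabilityMeasure P]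
    (hX : IsContinuousFields X) (N : ℕ → ℕ) (α : ℝ) (l : ℕ)
    (β : ℂ) : Measurable (Function.uncurry (startExp P X N α l β)) :=
  measurable_uncurry_indicator (measurableSet_uncurry_firstMax hX N α l)
    (measurable_uncurry_blockExp hX 0 (N l) β)

lemma BlockBounds.exists_lintegral_truncExp_sq_le [IsProbabilityMeasure P]
    (h : IsLogCorrelatedSequence P X)
    {δ B τ C : ℝ} (hb : BlockBounds P X δ B τ C) {N : ℕ → ℕ} (hN : Monotone N) {l J : ℕ}
    (hlJ : l ≤ J) {β : ℂ} (hre : |2 * β.re| ≤ B) (him : |β.im| ≤ τ) (α : ℝ) :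
    ∃ Z : ℝ≥0∞, Z ≠ ∞ ∧ ∀ x, ∫⁻ ω, ‖truncExp P X N α l J β x ω‖ₑ ^ 2 ∂P ≤ Z := by
  have hre' : |β.re| ≤ B := by
    rw [abs_mul, abs_two] at hre
    linarith [abs_nonneg β.re]
  refine ⟨_, ENNReal.ofReal_ne_top, fun x => (lintegral_mono fun ω => ?_).trans
    (hb.lintegral_blockExp_pow_le h (hN hlJ) hre' him x 2 (by exact_mod_cast hre))⟩
  gcongr
  exact enorm_indicator_le_enorm_self _ _

section Cell

variable {δ B τ C α η κ c c₁ p A : ℝ} {β : ℂ} {N : ℕ → ℕ} {l J : ℕ}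

/-- Contribution of the event that the field varies little over a cell. -/
lemma BlockBounds.eLpNorm_near_le [IsProbabilityMeasure P] (h : IsLogCorrelatedSequence P X)
    (hb : BlockBounds P X δ B τ C) (hN : IsLevels P X N A)
    (he : MomentExponents B τ α η κ c c₁ p β) (hc₁ : 0 ≤ c₁) (hlJ : l ≤ J) {Q : Set (unitCube d)}
    (hQ : MeasurableSet Q) (y : unitCube d) {f : unitCube d → ℂ} (hf : Measurable f) {Φ : ℝ≥0∞}
    (hΦ : Φ ≠ ∞) (hfΦ : ∀ x, ‖f x‖ₑ ≤ Φ) {a : ℝ≥0∞}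
    (ha : ∫⁻ z, ‖∫ ω, truncExp P X N α l J β z.1 ω * (starRingEnd ℂ) (truncExp P X N α l J β z.2 ω) ∂P‖ₑ
        ∂(((cubeVolume d).restrict Q).prod ((cubeVolume d).restrict Q)) ≤ a) :
    eLpNorm (fun ω => ∫ x in Q, f x * ((closeEvent X (N l) y x).indicator
        (startExp P X N α l β x) ω * truncExp P X N α l J β x ω) ∂(cubeVolume d))
      (ENNReal.ofReal p) P
      ≤ Φ * ENNReal.ofReal ((C * Real.exp B) ^ 2 * Real.exp (-c₁ * l / 2)) * a ^ (1 / 2 : ℝ) := by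
  have hp0 : 0 < p := by linarith [he.one_le]
  have hC := hb.one_le
  have hre := he.re_nonneg
  have hreB : β.re ≤ B := by linarith [he.re_add_le, he.eta_nonneg]
  have hB0 : 0 ≤ B := hre.trans hreB
  obtain ⟨Z, hZ, hζZ⟩ := hb.exists_lintegral_truncExp_sq_le h hN.mono hlJ (β := β)
    (by rw [abs_of_nonneg (by positivity)]; linarith [he.four_le]) he.im_le α
  have hst : Disjoint (Set.Ico 0 (N l)) (Set.Ico (N l) (N J)) := by
    rw [Set.disjoint_left]; intro a ha hb; exact absurd hb.1 (not_le.2 ha.2)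
  have hbase : 1 ≤ C * Real.exp B := one_le_mul_of_one_le_of_one_le hC (Real.one_le_exp hB0)
  have hhigh := hb.lintegral_high_le h he.toExponents hp0.le he.high_le he.high (N l) y
  have key := lintegral_rpow_weighted_le h hst hQ hf hΦ hZ hfΦ
    (G := fun x => (closeEvent X (N l) y x).indicator (startExp P X N α l β x))
    (ζ := truncExp P X N α l J β)
    (fun x => (measurable_startExp hN.mono le_rfl β x).indicator
      (measurableSet_closeEvent le_rfl y x))
    (measurable_uncurry_indicator (measurableSet_uncurry_closeEvent h.fields (N l) y)
      (measurable_uncurry_startExp h.fields N α l β))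
    (fun x => measurable_truncExp hN.mono α l J β x)
    (measurable_uncurry_truncExp h.fields N α l J β) (fun x _ => hζZ x) he.one_le he.le_two
    (m := fun ω => Real.exp (β.re * fieldSum X (Finset.Ico 0 (N l)) y ω
        - (β.re ^ 2 - β.im ^ 2) * varSum P X (N l) / 2))
    (Real.measurable_exp.comp (((measurable_fieldSum (by rw [Finset.coe_Ico]) y).const_mul _).sub_const _))
    (fun _ => Real.exp_pos _)
    -- The sum at `x` is at least `α` times the variance on the event of a running maximum, and the
    -- sum at `y` is within `1` of it.
    (D := {ω | α * varSum P X (N l) - 1 ≤ fieldSum X (Finset.Ico 0 (N l)) y ω})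
    (measurableSet_le measurable_const (measurable_fieldSum' h.fields _ y))
    (c := ENNReal.ofReal (C * Real.exp B)) ENNReal.ofReal_ne_top ?_ ?_
    (hhigh.trans_lt ENNReal.ofReal_lt_top).ne
  rotate_left
  · intro x ω hω
    by_contra hne
    have h1 := Set.mem_of_indicator_ne_zero hne
    rw [Set.indicator_of_mem h1] at hne
    have h2 := le_of_mem_firstMax hN.zero (Set.mem_of_indicator_ne_zero hne)
    have h3 := (abs_le.1 (show |_| ≤ (1 : ℝ) from h1)).2
    refine hω (?_ : α * varSum P X (N l) - 1 ≤ fieldSum X (Finset.Ico 0 (N l)) y ω)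
    linarith
  · intro x ω
    by_cases h1 : ω ∈ closeEvent X (N l) y x
    swap
    · simp [Set.indicator_of_notMem h1]
    rw [Set.indicator_of_mem h1]
    refine (enorm_indicator_le_enorm_self _ _).trans ?_
    rw [← ENNReal.ofReal_mul (by positivity), ← ofReal_norm]
    refine ENNReal.ofReal_le_ofReal ((hb.norm_blockExp_le (Nat.zero_le _) he.re_le he.im_le x ω).trans ?_)
    rw [varSum_zero, sub_zero, mul_assoc, ← Real.exp_add]
    have h3 := (abs_le.1 (show |_| ≤ (1 : ℝ) from h1)).2
    have h4 := mul_le_mul_of_nonneg_left h3 hre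
    refine mul_le_mul_of_nonneg_left (Real.exp_le_exp.2 ?_) (by linarith)
    linarith
  rw [eLpNorm_eq_lintegral_rpow_enorm_toReal (by simpa using hp0) ENNReal.ofReal_ne_top,
    ENNReal.toReal_ofReal hp0.le]
  refine (ENNReal.rpow_le_rpow key (by positivity)).trans ?_
  rw [ENNReal.mul_rpow_of_nonneg _ _ (by positivity), ← ENNReal.rpow_mul,
    show p / 2 * (1 / p) = 1 / 2 by field_simp, ENNReal.mul_rpow_of_nonneg _ _ (by positivity),
    ENNReal.mul_rpow_of_nonneg _ _ (by positivity), ← ENNReal.rpow_natCast, ← ENNReal.rpow_natCast,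
    ← ENNReal.rpow_mul, ← ENNReal.rpow_mul,
    show ((2 : ℕ) : ℝ) * (1 / 2) = 1 by norm_num, ENNReal.rpow_one, ENNReal.rpow_one]
  have h5 : (∫⁻ ω in {ω | α * varSum P X (N l) - 1 ≤ fieldSum X (Finset.Ico 0 (N l)) y ω},
      ENNReal.ofReal (Real.exp (β.re * fieldSum X (Finset.Ico 0 (N l)) y ω
        - (β.re ^ 2 - β.im ^ 2) * varSum P X (N l) / 2) ^ p) ∂P) ^ (1 / p)
      ≤ ENNReal.ofReal (C * Real.exp B * Real.exp (-c₁ * l / 2)) := by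
    refine (ENNReal.rpow_le_rpow hhigh (by positivity)).trans ?_
    rw [ENNReal.ofReal_rpow_of_nonneg (by positivity) (by positivity)]
    refine ENNReal.ofReal_le_ofReal ?_
    rw [Real.mul_rpow (by positivity) (by positivity), ← Real.exp_mul]
    rw [one_div p]
    -- Taking the `p`-th root at most halves the rate of decay, as `p ≤ 2`.
    have h6 : 1 / 2 ≤ p⁻¹ := by
      rw [one_div]; exact inv_anti₀ hp0 he.le_two
    refine mul_le_mul ?_ (Real.exp_le_exp.2 ?_) (Real.exp_pos _).le (by linarith)
    · exact (Real.rpow_le_rpow_of_exponent_le hbase (inv_le_one_of_one_le₀ he.one_le)).trans_eq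
        (Real.rpow_one _)
    · have h7 := hN.lower l
      have h8 : (l : ℝ) * (1 / 2) ≤ varSum P X (N l) * p⁻¹ :=
        mul_le_mul h7 h6 (by norm_num) (varSum_nonneg _)
      nlinarith [mul_le_mul_of_nonneg_left h8 hc₁]
  calc _ ≤ ENNReal.ofReal (C * Real.exp B * Real.exp (-c₁ * l / 2)) *
        (Φ * ENNReal.ofReal (C * Real.exp B) * a ^ (1 / 2 : ℝ)) := by
        refine mul_le_mul' h5 (mul_le_mul' le_rfl (ENNReal.rpow_le_rpow ha (by norm_num)))
    _ = _ := by
        rw [show (C * Real.exp B) ^ 2 * Real.exp (-c₁ * l / 2)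
          = (C * Real.exp B * Real.exp (-c₁ * l / 2)) * (C * Real.exp B) by ring,
          ENNReal.ofReal_mul (by positivity) (q := C * Real.exp B)]
        ring

/-- Contribution of the event that the field varies a lot over a cell. -/
lemma BlockBounds.eLpNorm_far_le [IsProbabilityMeasure P] (h : IsLogCorrelatedSequence P X)
    (hb : BlockBounds P X δ B τ C) (hN : IsLevels P X N A)
    (he : MomentExponents B τ α η κ c c₁ p β) (hlJ : l ≤ J) {Q : Set (unitCube d)}
    (hQ : MeasurableSet Q) (y : unitCube d) {r C' θ : ℝ} (hr : 0 < r) (hC'0 : 0 < C')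
    (hC' : ∀ n ≥ 1, ∀ x y : unitCube d,
      ∫⁻ ω, ‖∑ k ∈ Finset.range n, (X k x ω - X k y ω)‖ₑ ^ r ∂P
        ≤ ENNReal.ofReal (C' * Real.exp (r * varSum P X n) * dist x y ^ r))
    (hrθ : B ^ 2 / 4 + 1 + c₁ ≤ r * θ / 2)
    (hdist : ∀ x ∈ Q, dist x y ≤ Real.exp (-(1 + θ) * l))
    {f : unitCube d → ℂ} (hf : Measurable f) {Φ : ℝ≥0∞}
    (hΦ : Φ ≠ ∞) (hfΦ : ∀ x, ‖f x‖ₑ ≤ Φ) {a : ℝ≥0∞}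
    (ha : ∫⁻ z, ‖∫ ω, truncExp P X N α l J β z.1 ω * (starRingEnd ℂ) (truncExp P X N α l J β z.2 ω) ∂P‖ₑ
        ∂(((cubeVolume d).restrict Q).prod ((cubeVolume d).restrict Q)) ≤ a) :
    eLpNorm (fun ω => ∫ x in Q, f x * ((closeEvent X (N l) y x)ᶜ.indicator
        (startExp P X N α l β x) ω * truncExp P X N α l J β x ω) ∂(cubeVolume d))
      (ENNReal.ofReal p) P
      ≤ Φ * ENNReal.ofReal ((C ^ 5 * Real.exp ((B ^ 2 / 2 + 2) * A) * C' * Real.exp (r * A)) ^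
        (1 / 4 : ℝ) * Real.exp (-c₁ * l / 2)) * a ^ (1 / 2 : ℝ) := by
  have hp0 : 0 < p := by linarith [he.one_le]
  have hC := hb.one_le
  have hre := he.re_nonneg
  have hfour := he.four_le
  set K := C ^ 5 * Real.exp ((B ^ 2 / 2 + 2) * A) * C' * Real.exp (r * A) with hK
  have hK0 : 0 < K := by positivity
  obtain ⟨Z, hZ, hζZ⟩ := hb.exists_lintegral_truncExp_sq_le h hN.mono hlJ (β := β)
    (by rw [abs_of_nonneg (by positivity)]; linarith) he.im_le α
  have hst : Disjoint (Set.Ico 0 (N l)) (Set.Ico (N l) (N J)) := by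
    rw [Set.disjoint_left]; intro a ha hb; exact absurd hb.1 (not_le.2 ha.2)
  set v := varSum P X (N l) with hv
  have hv0 : 0 ≤ v := varSum_nonneg _
  have hvA : v ≤ l + A := hN.upper l
  -- Cauchy–Schwarz: the fourth moment grows at most at rate `B ^ 2 / 2 + 2` per unit of variance,
  -- while the increment condition on a cell of size `e^(-(1+θ) l)` gives the event probability of
  -- order `e^(-r θ l)`. The choice of `r` makes the latter win by `2 * c₁`.
  have hΓ : ∀ x ∈ Q, ∫⁻ ω, ‖(closeEvent X (N l) y x)ᶜ.indicator (startExp P X N α l β x) ω‖ₑ ^ 2 ∂P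
      ≤ ENNReal.ofReal (K * Real.exp (-2 * c₁ * l)) ^ (1 / 2 : ℝ) := by
    intro x hx
    have hE : MeasurableSet (closeEvent X (N l) y x)ᶜ :=
      (fieldSigma_le h.fields _ (measurableSet_closeEvent le_rfl y x)).compl
    have hM := ((measurable_uncurry_blockExp (P := P) h.fields 0 (N l) β).comp
      (measurable_prodMk_left (x := x))).enorm
    have h4 := hb.lintegral_blockExp_pow_le h (Nat.zero_le (N l)) he.re_le he.im_le x 4
      (by rw [abs_of_nonneg (by positivity)]; exact_mod_cast hfour)
    have hP := measure_increment_le h hr hC' (N l) x y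
    have hset : {ω | 1 < |fieldSum X (Finset.Ico 0 (N l)) x ω - fieldSum X (Finset.Ico 0 (N l)) y ω|}
        = (closeEvent X (N l) y x)ᶜ := by
      ext ω; simp [closeEvent]
    rw [hset] at hP
    have hhold := ENNReal.lintegral_mul_norm_pow_le (μ := P)
      (f := fun ω => ‖blockExp P X 0 (N l) β x ω‖ₑ ^ 4)
      (g := (closeEvent X (N l) y x)ᶜ.indicator 1) (hM.pow_const 4).aemeasurable
      (measurable_one.indicator hE).aemeasurable
      (p := 1 / 2) (q := 1 / 2) (by norm_num) (by norm_num) (by norm_num)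
    rw [lintegral_indicator_one hE] at hhold
    refine (lintegral_mono fun ω => ?_).trans (hhold.trans ?_)
    · by_cases hω : ω ∈ (closeEvent X (N l) y x)ᶜ
      · rw [Set.indicator_of_mem hω, Set.indicator_of_mem hω, Pi.one_apply, ENNReal.one_rpow,
          mul_one, ← ENNReal.rpow_natCast _ 4, ← ENNReal.rpow_mul]
        norm_num
        gcongr
        exact enorm_indicator_le_enorm_self _ _
      · simp [Set.indicator_of_notMem hω]
    · rw [← ENNReal.mul_rpow_of_nonneg _ _ (by norm_num)]
      refine ENNReal.rpow_le_rpow ((mul_le_mul' h4 hP).trans ?_) (by norm_num)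
      rw [← ENNReal.ofReal_mul (by positivity)]
      refine ENNReal.ofReal_le_ofReal ?_
      have hd : dist x y ^ r ≤ Real.exp (-(1 + θ) * l * r) := by
        rw [Real.exp_mul]
        exact Real.rpow_le_rpow dist_nonneg (hdist x hx) hr.le
      rw [varSum_zero, sub_zero, ← hv]
      push_cast
      calc _ ≤ C ^ 5 * Real.exp ((B ^ 2 / 2 + 2) * (l + A)) *
            (C' * Real.exp (r * (l + A)) * Real.exp (-(1 + θ) * l * r)) := by
            have hB2 : (4 * β.re) ^ 2 ≤ B ^ 2 := pow_le_pow_left₀ (by positivity) hfour 2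
            have him : β.im ^ 2 ≤ 1 := by
              rw [← sq_abs]; exact pow_le_one₀ (abs_nonneg _) he.im_le_one
            have e1 : (4 * β.re) ^ 2 * v / 2 - 4 * ((β.re ^ 2 - β.im ^ 2) * v / 2)
                ≤ (B ^ 2 / 2 + 2) * (l + A) := by
              have h1 : (4 * β.re) ^ 2 * v / 2 - 4 * ((β.re ^ 2 - β.im ^ 2) * v / 2)
                = (6 * β.re ^ 2 + 2 * β.im ^ 2) * v := by ring
              rw [h1]
              exact mul_le_mul (by nlinarith) hvA hv0 (by positivity)
            have e2 : r * v ≤ r * (l + A) := mul_le_mul_of_nonneg_left hvA hr.le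
            gcongr
        _ = K * Real.exp ((B ^ 2 / 2 + 2 - r * θ) * l) := by
            have : Real.exp ((B ^ 2 / 2 + 2) * (l + A)) *
              (Real.exp (r * (l + A)) * Real.exp (-(1 + θ) * l * r))
              = Real.exp ((B ^ 2 / 2 + 2) * A) * (Real.exp (r * A) *
                Real.exp ((B ^ 2 / 2 + 2 - r * θ) * l)) := by
              simp only [← Real.exp_add]; congr 1; ring
            rw [hK]
            linear_combination C ^ 5 * C' * this
        _ ≤ _ := by
            refine mul_le_mul_of_nonneg_left (Real.exp_le_exp.2 ?_) hK0.le
            exact mul_le_mul_of_nonneg_right (by linarith) (Nat.cast_nonneg _)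
  have hGm := measurable_uncurry_indicator (E := fun x => (closeEvent X (N l) y x)ᶜ)
    (measurableSet_uncurry_closeEvent h.fields (N l) y).compl
    (measurable_uncurry_startExp (P := P) h.fields N α l β)
  have hζm := measurable_uncurry_truncExp (P := P) h.fields N α l J β
  have key := lintegral_sq_weighted_le h hst hQ hf hΦ
    (ENNReal.rpow_ne_top_of_nonneg (by norm_num) ENNReal.ofReal_ne_top) hZ hfΦ
    (G := fun x => (closeEvent X (N l) y x)ᶜ.indicator (startExp P X N α l β x))
    (ζ := truncExp P X N α l J β)
    (fun x => (measurable_startExp hN.mono le_rfl β x).indicator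
      (measurableSet_closeEvent le_rfl y x).compl) hGm
    (fun x => measurable_truncExp hN.mono α l J β x) hζm hΓ (fun x _ => hζZ x)
  have hmeas : AEStronglyMeasurable (fun ω => ∫ x in Q, f x * ((closeEvent X (N l) y x)ᶜ.indicator
        (startExp P X N α l β x) ω * truncExp P X N α l J β x ω) ∂(cubeVolume d)) P := by
    have hF : Measurable (Function.uncurry fun (x : unitCube d) (ω : Ω) =>
        f x * ((closeEvent X (N l) y x)ᶜ.indicator
        (startExp P X N α l β x) ω * truncExp P X N α l J β x ω)) :=
      (hf.comp measurable_fst).mul (hGm.mul hζm)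
    exact (StronglyMeasurable.integral_prod_left' (μ := (cubeVolume d).restrict Q)
      hF.stronglyMeasurable).aestronglyMeasurable
  refine (eLpNorm_le_eLpNorm_of_exponent_le (q := 2) ?_ hmeas).trans ?_
  · rw [← ENNReal.ofReal_ofNat]; exact ENNReal.ofReal_le_ofReal he.le_two
  rw [eLpNorm_eq_lintegral_rpow_enorm_toReal (by norm_num) (by norm_num), ENNReal.toReal_ofNat]
  simp only [ENNReal.rpow_ofNat]
  refine (ENNReal.rpow_le_rpow (key.trans (mul_le_mul' le_rfl ha)) (by positivity)).trans
    (le_of_eq ?_)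
  rw [ENNReal.mul_rpow_of_nonneg _ _ (by positivity),
    ENNReal.mul_rpow_of_nonneg _ _ (by positivity), ← ENNReal.rpow_natCast,
    ← ENNReal.rpow_mul, ← ENNReal.rpow_mul,
    ENNReal.ofReal_rpow_of_nonneg (by positivity) (by positivity),
    Real.mul_rpow hK0.le (Real.exp_pos _).le, ← Real.exp_mul]
  norm_num
  congr 4
  ring_nf

end Cell

end LevelBound

end Chaos

namespace Chaos

/-! ### Summation over cells and over levels. -/

section LevelSum

variable {d : ℕ} {Ω : Type*} [mΩ : MeasurableSpace Ω] {P : Measure Ω}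
  {X : ℕ → unitCube d → Ω → ℝ}

lemma aestronglyMeasurable_setIntegral {F : unitCube d → Ω → ℂ}
    (hF : Measurable (Function.uncurry F)) (Q : Set (unitCube d)) :
    AEStronglyMeasurable (fun ω => ∫ x in Q, F x ω ∂(cubeVolume d)) P :=
  (StronglyMeasurable.integral_prod_left' (μ := (cubeVolume d).restrict Q)
    hF.stronglyMeasurable).aestronglyMeasurable

lemma norm_startExp_mul_truncExp_le [IsProbabilityMeasure P]
    (h : IsLogCorrelatedSequence P X) {N : ℕ → ℕ}
    (hN : Monotone N) {l J : ℕ} (hlJ : l ≤ J) (α : ℝ) (β : ℂ) (x : unitCube d) (ω : Ω) :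
    ‖startExp P X N α l β x ω * truncExp P X N α l J β x ω‖ ≤ ‖blockExp P X 0 (N J) β x ω‖ := by
  rw [← blockExp_mul h (Nat.zero_le (N l)) (hN hlJ), norm_mul, norm_mul]
  exact mul_le_mul (norm_indicator_le_norm_self _ _) (norm_indicator_le_norm_self _ _)
    (norm_nonneg _) (norm_nonneg _)

lemma BlockBounds.integrable_startExp_mul_truncExp [IsProbabilityMeasure P]
    (h : IsLogCorrelatedSequence P X)
    {δ B τ C α η κ c : ℝ} (hb : BlockBounds P X δ B τ C) {N : ℕ → ℕ} (hN : Monotone N) {β : ℂ}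
    (he : Exponents B τ α η κ c β) {l J : ℕ} (hlJ : l ≤ J) {f : unitCube d → ℂ} (hf : Measurable f)
    {Φ : ℝ≥0} (hfΦ : ∀ x, ‖f x‖₊ ≤ Φ) (ω : Ω) :
    Integrable (fun x => f x * (startExp P X N α l β x ω * truncExp P X N α l J β x ω))
      (cubeVolume d) := by
  have hs : Measurable fun x => startExp P X N α l β x ω :=
    (measurable_uncurry_startExp (P := P) h.fields N α l β).of_uncurry_right
  have ht : Measurable fun x => truncExp P X N α l J β x ω :=
    (measurable_uncurry_truncExp (P := P) h.fields N α l J β).of_uncurry_right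
  refine integrable_of_norm_le_blockExp h.fields hb (Nat.zero_le (N J)) he.re_le he.im_le ω Φ
    (fun x => by exact_mod_cast hfΦ x) (f := f) (hf.mul (hs.mul ht)) fun x => ?_
  · rw [norm_mul]
    exact mul_le_mul_of_nonneg_left (norm_startExp_mul_truncExp_le h hN hlJ α β x ω)
      (norm_nonneg _)

/-- The early factor is split according to whether the sum at `x` is close to its value at the
reference point `y`, and the near and far estimates are added. -/
lemma BlockBounds.eLpNorm_cell_le [IsProbabilityMeasure P] (h : IsLogCorrelatedSequence P X)
    {δ B τ C α η κ c c₁ p A : ℝ} {β : ℂ} {N : ℕ → ℕ} {l J : ℕ}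
    (hb : BlockBounds P X δ B τ C) (hN : IsLevels P X N A)
    (he : MomentExponents B τ α η κ c c₁ p β) (hc₁ : 0 ≤ c₁) (hlJ : l ≤ J) {Q : Set (unitCube d)}
    (hQ : MeasurableSet Q) (y : unitCube d) {r C' θ : ℝ} (hr : 0 < r) (hC'0 : 0 < C')
    (hC' : ∀ n ≥ 1, ∀ x y : unitCube d,
      ∫⁻ ω, ‖∑ k ∈ Finset.range n, (X k x ω - X k y ω)‖ₑ ^ r ∂P
        ≤ ENNReal.ofReal (C' * Real.exp (r * varSum P X n) * dist x y ^ r))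
    (hrθ : B ^ 2 / 4 + 1 + c₁ ≤ r * θ / 2)
    (hdist : ∀ x ∈ Q, dist x y ≤ Real.exp (-(1 + θ) * l))
    {f : unitCube d → ℂ} (hf : Measurable f) {Φ : ℝ≥0} (hfΦ : ∀ x, ‖f x‖₊ ≤ Φ) {a : ℝ≥0∞}
    (ha : ∫⁻ z, ‖∫ ω, truncExp P X N α l J β z.1 ω * (starRingEnd ℂ) (truncExp P X N α l J β z.2 ω) ∂P‖ₑ
        ∂(((cubeVolume d).restrict Q).prod ((cubeVolume d).restrict Q)) ≤ a) :
    eLpNorm (fun ω => ∫ x in Q, f x * (startExp P X N α l β x ω * truncExp P X N α l J β x ω)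
      ∂(cubeVolume d)) (ENNReal.ofReal p) P
      ≤ Φ * ENNReal.ofReal (((C * Real.exp B) ^ 2 +
        (C ^ 5 * Real.exp ((B ^ 2 / 2 + 2) * A) * C' * Real.exp (r * A)) ^ (1 / 4 : ℝ)) *
        Real.exp (-c₁ * l / 2)) * a ^ (1 / 2 : ℝ) := by
  have hC := hb.one_le
  have hfm : Measurable fun z : unitCube d × Ω => f z.1 := hf.comp measurable_fst
  have hsm := measurable_uncurry_startExp (P := P) h.fields N α l β
  have htm := measurable_uncurry_truncExp (P := P) h.fields N α l J β
  have hfΦ' : ∀ x, ‖f x‖ₑ ≤ (Φ : ℝ≥0∞) := fun x => by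
    rw [enorm_eq_nnnorm]; exact_mod_cast hfΦ x
  have hp1 : 1 ≤ ENNReal.ofReal p := by
    rw [← ENNReal.ofReal_one]; exact ENNReal.ofReal_le_ofReal he.one_le
  have hE := measurableSet_uncurry_closeEvent h.fields (N l) y
  have hint : ∀ (E : unitCube d → Set Ω), MeasurableSet {z : unitCube d × Ω | z.2 ∈ E z.1} →
      ∀ ω, Integrable (fun x => f x * ((E x).indicator (startExp P X N α l β x) ω *
        truncExp P X N α l J β x ω)) (cubeVolume d) := by
    intro E hE ω
    have hs : Measurable fun x => (E x).indicator (startExp P X N α l β x) ω :=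
      (measurable_uncurry_indicator hE hsm).of_uncurry_right
    have ht : Measurable fun x => truncExp P X N α l J β x ω := htm.of_uncurry_right
    refine (hb.integrable_startExp_mul_truncExp h hN.mono he.toExponents hlJ hf hfΦ ω).mono
      (hf.mul (hs.mul ht)).aestronglyMeasurable (ae_of_all _ fun x => ?_)
    rw [norm_mul, norm_mul (f x), norm_mul, norm_mul (startExp P X N α l β x ω)]
    exact mul_le_mul_of_nonneg_left (mul_le_mul_of_nonneg_right (norm_indicator_le_norm_self _ _)
      (norm_nonneg _)) (norm_nonneg _)
  have hsplit : (fun ω => ∫ x in Q,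
      f x * (startExp P X N α l β x ω * truncExp P X N α l J β x ω) ∂(cubeVolume d))
      = (fun ω => ∫ x in Q, f x * ((closeEvent X (N l) y x).indicator
        (startExp P X N α l β x) ω * truncExp P X N α l J β x ω) ∂(cubeVolume d)) +
      fun ω => ∫ x in Q, f x * ((closeEvent X (N l) y x)ᶜ.indicator
        (startExp P X N α l β x) ω * truncExp P X N α l J β x ω) ∂(cubeVolume d) := by
    ext ω
    rw [Pi.add_apply, ← integral_add (hint _ hE ω).integrableOn (hint _ hE.compl ω).integrableOn]
    refine integral_congr_ae (ae_of_all _ fun x => ?_)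
    beta_reduce
    rw [← mul_add, ← add_mul, ← Pi.add_apply (_ : Ω → ℂ), Set.indicator_self_add_compl]
  have hm : ∀ (E : unitCube d → Set Ω), MeasurableSet {z : unitCube d × Ω | z.2 ∈ E z.1} →
      AEStronglyMeasurable (fun ω => ∫ x in Q, f x * ((E x).indicator (startExp P X N α l β x) ω *
        truncExp P X N α l J β x ω) ∂(cubeVolume d)) P := fun E hE =>
    aestronglyMeasurable_setIntegral (F := fun x ω => f x * ((E x).indicator
      (startExp P X N α l β x) ω * truncExp P X N α l J β x ω))
      (hfm.mul ((measurable_uncurry_indicator hE hsm).mul htm)) Q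
  rw [hsplit]
  refine (eLpNorm_add_le (hm _ hE) (hm (fun x => (closeEvent X (N l) y x)ᶜ) hE.compl) hp1).trans ?_
  refine (add_le_add (hb.eLpNorm_near_le h hN he hc₁ hlJ hQ y hf ENNReal.coe_ne_top hfΦ' ha)
    (hb.eLpNorm_far_le h hN he hlJ hQ y hr hC'0 hC' hrθ hdist hf ENNReal.coe_ne_top hfΦ' ha)).trans
    (le_of_eq ?_)
  rw [← add_mul, ← mul_add, ← ENNReal.ofReal_add (by positivity) (by positivity), ← add_mul]

/-- Contribution of one level to the `L^p` norm of the chaos. -/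
lemma BlockBounds.exists_eLpNorm_level_le [IsProbabilityMeasure P]
    (hd : 1 ≤ d) (h : IsLogCorrelatedSequence P X)
    {δ B τ C A κ c₁ : ℝ} (hδ : 0 < δ) (hδ1 : δ ≤ 1) (hb : BlockBounds P X δ B τ C) {N : ℕ → ℕ}
    (hN : IsLevels P X N A) (hκ0 : 0 ≤ κ) (hκ : κ < d) (c : ℝ) (hc₁ : 0 < c₁) :
    ∃ K : ℝ, 0 ≤ K ∧ ∀ {α η p : ℝ} {β : ℂ}, MomentExponents B τ α η κ c c₁ p β →
      ∀ {l J : ℕ}, l ≤ J → ∀ {f : unitCube d → ℂ}, Measurable f → ∀ {Φ : ℝ≥0}, (∀ x, ‖f x‖₊ ≤ Φ) →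
      eLpNorm (fun ω => ∫ x, f x * (startExp P X N α l β x ω * truncExp P X N α l J β x ω)
        ∂(cubeVolume d)) (ENNReal.ofReal p) P ≤ Φ * ENNReal.ofReal (K * Real.exp (-c₁ * l / 4)) := by
  obtain ⟨r₀, hr₀, hincr⟩ := h.incr
  obtain ⟨K₀, hK₀, hker⟩ := exists_lintegral_truncExp_le (P := P) hd hκ C c A
  -- Cells finer than `e^(-l)` by the factor `e^(-θ l)` cost `e^(κ θ l / 2)`, at most `e^(c₁ l /
  -- 4)`. Half of the decay `e^(-c₁ l / 2)` survives.
  set θ := c₁ / (2 * (κ + 1)) with hθ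
  have hθ0 : 0 < θ := by positivity
  have hκθ : κ * θ ≤ c₁ / 2 := by
    rw [hθ, mul_div_assoc', div_le_div_iff₀ (by positivity) (by positivity)]
    nlinarith
  -- However small `θ` is, a large moment of the increments makes the oscillation term negligible;
  -- this is why the condition is needed for all large `r`.
  set r := max r₀ (2 * (B ^ 2 / 4 + 1 + c₁) / θ) with hr
  have hr0 : 0 < r := hr₀.trans_le (le_max_left _ _)
  have hrθ : B ^ 2 / 4 + 1 + c₁ ≤ r * θ / 2 := by
    have : 2 * (B ^ 2 / 4 + 1 + c₁) / θ ≤ r := le_max_right _ _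
    rw [div_le_iff₀ hθ0] at this
    linarith
  obtain ⟨C', hC'0, hC'⟩ := hincr r (le_max_left _ _)
  -- With `n` about `M * exp ((1 + θ) * l)` the cell diameter `√d / n` is below both `δ` and `exp
  -- (-(1 + θ) * l)`.
  set M := (Real.sqrt d + 1) / δ with hM
  have hsd : Real.sqrt d ≤ δ * M := by
    rw [hM, mul_div_cancel₀ _ hδ.ne']; linarith
  have hM1 : 1 ≤ M := by
    rw [hM, one_le_div hδ]; linarith [Real.sqrt_nonneg (d : ℝ)]
  set K₁ := (C * Real.exp B) ^ 2 + (C ^ 5 * Real.exp ((B ^ 2 / 2 + 2) * A) * C' * Real.exp (r * A)) ^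
        (1 / 4 : ℝ) with hK₁
  have hC := hb.one_le
  have hK₁0 : 0 ≤ K₁ := by positivity
  refine ⟨K₁ * Real.sqrt K₀ * 2 ^ d * (2 * M) ^ (κ / 2), by positivity, ?_⟩
  intro α η p β he l J hlJ f hf Φ hfΦ
  have hfΦ' : ∀ x, ‖f x‖ₑ ≤ (Φ : ℝ≥0∞) := fun x => by
    rw [enorm_eq_nnnorm]; exact_mod_cast hfΦ x
  set n := ⌈M * Real.exp ((1 + θ) * l)⌉₊ with hn
  have hMe : 1 ≤ M * Real.exp ((1 + θ) * l) :=
    one_le_mul_of_one_le_of_one_le hM1 (Real.one_le_exp (by positivity))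
  have hnge : M * Real.exp ((1 + θ) * l) ≤ n := Nat.le_ceil _
  have hnle : (n : ℝ) ≤ 2 * M * Real.exp ((1 + θ) * l) := by
    have := (Nat.ceil_lt_add_one (by positivity : 0 ≤ M * Real.exp ((1 + θ) * l))).le
    linarith
  have hn1 : (1 : ℝ) ≤ n := hMe.trans hnge
  have hn0 : 0 < n := by exact_mod_cast hn1
  have hmesh : Real.sqrt d / n ≤ δ * Real.exp (-(1 + θ) * l) := by
    rw [div_le_iff₀ (by positivity)]
    calc Real.sqrt d ≤ δ * M * (Real.exp (-(1 + θ) * l) * Real.exp ((1 + θ) * l)) := by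
          rw [← Real.exp_add]; ring_nf; rw [Real.exp_zero, mul_one]; exact hsd
      _ = δ * Real.exp (-(1 + θ) * l) * (M * Real.exp ((1 + θ) * l)) := by ring
      _ ≤ _ := by gcongr
  have hmesh1 : Real.sqrt d / n ≤ Real.exp (-(1 + θ) * l) :=
    hmesh.trans (mul_le_of_le_one_left (Real.exp_pos _).le hδ1)
  have hmesh2 : Real.sqrt d / n ≤ Real.exp (-l) := hmesh1.trans (Real.exp_le_exp.2 (by
    have : 0 ≤ θ * l := by positivity
    linarith))
  have hmesh3 : Real.sqrt d / n ≤ δ := hmesh.trans (mul_le_of_le_one_right hδ.le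
    (Real.exp_le_one_iff.2 (by
      have : 0 ≤ (1 + θ) * l := by positivity
      linarith)))
  set T : ℝ := K₁ * Real.exp (-c₁ * l / 2) * (Real.sqrt K₀ * (1 / n : ℝ) ^ d *
    (n * Real.exp (-l)) ^ (κ / 2)) with hT
  have hT0 : 0 ≤ T := by positivity
  have hp1 : 1 ≤ ENNReal.ofReal p := by
    rw [← ENNReal.ofReal_one]; exact ENNReal.ofReal_le_ofReal he.one_le
  have hfm : Measurable fun z : unitCube d × Ω => f z.1 := hf.comp measurable_fst
  have hsm := measurable_uncurry_startExp (P := P) h.fields N α l β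
  have htm := measurable_uncurry_truncExp (P := P) h.fields N α l J β
  have hcell : ∀ q ∈ cellIndex d n, eLpNorm (fun ω => ∫ x in cell n q,
      f x * (startExp P X N α l β x ω * truncExp P X N α l J β x ω) ∂(cubeVolume d))
      (ENNReal.ofReal p) P ≤ Φ * ENNReal.ofReal T := by
    intro q _
    rcases (cell (d := d) n q).eq_empty_or_nonempty with hemp | ⟨y, hy⟩
    · simp [hemp]
    have hQ := measurableSet_cell (d := d) n q
    have ha := hker h hb hN he.toExponents hlJ hn0 hmesh3 hmesh2 q
    refine (hb.eLpNorm_cell_le h hN he hc₁.le hlJ hQ y hr0 hC'0 hC' hrθ (fun x hx =>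
      (dist_le_of_mem_cell hn0 hx hy).trans hmesh1) hf hfΦ ha).trans (le_of_eq ?_)
    rw [← hK₁, mul_assoc, ENNReal.ofReal_rpow_of_nonneg (by positivity) (by norm_num),
      ← ENNReal.ofReal_mul (by positivity), hT, Real.mul_rpow (by positivity) (by positivity),
      Real.mul_rpow (by positivity) (by positivity), ← Real.rpow_mul (by positivity),
      ← Real.sqrt_eq_rpow, mul_comm 2 d, pow_mul, ← Real.sqrt_eq_rpow,
      Real.sqrt_sq (by positivity), mul_one_div]
  have hsum : (fun ω => ∫ x, f x * (startExp P X N α l β x ω * truncExp P X N α l J β x ω)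
      ∂(cubeVolume d)) = ∑ q ∈ cellIndex d n, fun ω => ∫ x in cell n q,
      f x * (startExp P X N α l β x ω * truncExp P X N α l J β x ω) ∂(cubeVolume d) := by
    ext ω
    rw [integral_eq_sum_cell (hb.integrable_startExp_mul_truncExp h hN.mono he.toExponents hlJ hf
      hfΦ ω) n, Finset.sum_apply]
  rw [hsum]
  -- There are `(n + 1)^d` cells, each contributing order `n^(-d)`, so the triangle inequality
  -- suffices and no orthogonality between cells is used.
  refine (eLpNorm_sum_le (fun q _ => aestronglyMeasurable_setIntegral (hfm.mul (hsm.mul htm)) _)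
    hp1).trans ((Finset.sum_le_sum hcell).trans ?_)
  rw [Finset.sum_const, card_cellIndex, nsmul_eq_mul, mul_left_comm]
  gcongr
  rw [← ENNReal.ofReal_natCast, ← ENNReal.ofReal_mul (by positivity)]
  refine ENNReal.ofReal_le_ofReal ?_
  push_cast
  have e1 : ((n : ℝ) + 1) ^ d * (1 / n : ℝ) ^ d ≤ 2 ^ d := by
    rw [← mul_pow]
    refine pow_le_pow_left₀ (by positivity) ?_ d
    rw [mul_one_div, div_le_iff₀ (by positivity)]
    linarith
  have e2 : ((n : ℝ) * Real.exp (-l)) ^ (κ / 2) ≤ (2 * M) ^ (κ / 2) * Real.exp (c₁ * l / 4) := by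
    have h1 : (n : ℝ) * Real.exp (-l) ≤ 2 * M * Real.exp (θ * l) := by
      calc (n : ℝ) * Real.exp (-l) ≤ 2 * M * Real.exp ((1 + θ) * l) * Real.exp (-l) := by gcongr
        _ = _ := by rw [mul_assoc, ← Real.exp_add]; ring_nf
    refine (Real.rpow_le_rpow (by positivity) h1 (by positivity)).trans ?_
    rw [Real.mul_rpow (by positivity) (by positivity), ← Real.exp_mul]
    refine mul_le_mul_of_nonneg_left (Real.exp_le_exp.2 ?_) (by positivity)
    have := mul_le_mul_of_nonneg_right hκθ (Nat.cast_nonneg (α := ℝ) l)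
    linarith
  calc ((n : ℝ) + 1) ^ d * T = K₁ * Real.sqrt K₀ * Real.exp (-c₁ * l / 2) *
        (((n : ℝ) + 1) ^ d * (1 / n : ℝ) ^ d) * ((n * Real.exp (-l)) ^ (κ / 2)) := by
        rw [hT]; ring
    _ ≤ K₁ * Real.sqrt K₀ * Real.exp (-c₁ * l / 2) * 2 ^ d *
        ((2 * M) ^ (κ / 2) * Real.exp (c₁ * l / 4)) := by gcongr
    _ = K₁ * Real.sqrt K₀ * 2 ^ d * (2 * M) ^ (κ / 2) *
        (Real.exp (-c₁ * l / 2) * Real.exp (c₁ * l / 4)) := by ring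
    _ = _ := by rw [← Real.exp_add]; ring_nf

lemma chaos_eq (n : ℕ) (f : C(unitCube d, ℂ)) (β : ℂ) (ω : Ω) :
    chaos P X n f β ω = ∫ x, f x * blockExp P X 0 n β x ω ∂(cubeVolume d) := by
  simp only [chaos, blockExp, normalizer_eq_laplace, Finset.range_eq_Ico, fieldSum]

/-- The `L^p` norms of the chaos along the levels are bounded. -/
lemma BlockBounds.exists_eLpNorm_chaos_le [IsProbabilityMeasure P]
    (hd : 1 ≤ d) (h : IsLogCorrelatedSequence P X)
    {δ B τ C A κ c₁ : ℝ} (hδ : 0 < δ) (hδ1 : δ ≤ 1) (hb : BlockBounds P X δ B τ C) {N : ℕ → ℕ}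
    (hN : IsLevels P X N A) (hκ0 : 0 ≤ κ) (hκ : κ < d) (c : ℝ) (hc₁ : 0 < c₁) :
    ∃ K : ℝ≥0, ∀ {α η p : ℝ} {β : ℂ}, MomentExponents B τ α η κ c c₁ p β →
      ∀ (J : ℕ) (f : C(unitCube d, ℂ)),
      eLpNorm (chaos P X (N J) f β) (ENNReal.ofReal p) P ≤ K * ‖f‖₊ := by
  obtain ⟨K, hK, hlev⟩ := hb.exists_eLpNorm_level_le hd h hδ hδ1 hN hκ0 hκ c hc₁
  refine ⟨(K * (1 - Real.exp (-c₁ / 4))⁻¹).toNNReal, fun {α η p β} he J f => ?_⟩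
  have hf : Measurable f := f.continuous.measurable
  have hfΦ : ∀ x, ‖f x‖₊ ≤ ‖f‖₊ := fun x => f.norm_coe_le_norm x
  have hp1 : 1 ≤ ENNReal.ofReal p := by
    rw [← ENNReal.ofReal_one]; exact ENNReal.ofReal_le_ofReal he.one_le
  have hfm : Measurable fun z : unitCube d × Ω => f z.1 := hf.comp measurable_fst
  have hm : ∀ l, Measurable (Function.uncurry fun (x : unitCube d) (ω : Ω) =>
      f x * (startExp P X N α l β x ω * truncExp P X N α l J β x ω)) := fun l =>
    hfm.mul ((measurable_uncurry_startExp (P := P) h.fields N α l β).mul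
      (measurable_uncurry_truncExp (P := P) h.fields N α l J β))
  have hsum : chaos P X (N J) f β = ∑ l ∈ Finset.range (J + 1), fun ω =>
      ∫ x, f x * (startExp P X N α l β x ω * truncExp P X N α l J β x ω) ∂(cubeVolume d) := by
    ext ω
    rw [chaos_eq, Finset.sum_apply, ← integral_finsetSum]
    · refine integral_congr_ae (ae_of_all _ fun x => ?_)
      simp only [blockExp_eq_sum h hN.mono α J β x ω, Finset.mul_sum]
    · intro l hl
      exact hb.integrable_startExp_mul_truncExp h hN.mono he.toExponents
        (Nat.lt_succ_iff.1 (Finset.mem_range.1 hl)) hf hfΦ ω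
  rw [hsum]
  have hmeas : ∀ l, AEStronglyMeasurable (fun ω => ∫ x, f x * (startExp P X N α l β x ω *
      truncExp P X N α l J β x ω) ∂(cubeVolume d)) P := fun l => by
    simpa only [setIntegral_univ] using aestronglyMeasurable_setIntegral (P := P) (hm l) Set.univ
  refine (eLpNorm_sum_le (fun l _ => hmeas l) hp1).trans ((Finset.sum_le_sum fun l hl =>
    hlev he (Nat.lt_succ_iff.1 (Finset.mem_range.1 hl)) hf hfΦ).trans ?_)
  rw [← Finset.mul_sum, ← ENNReal.ofReal_sum_of_nonneg (fun _ _ => by positivity), mul_comm]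
  refine mul_le_mul_left ?_ _
  refine ENNReal.ofReal_le_ofReal ?_
  rw [← Finset.mul_sum]
  refine mul_le_mul_of_nonneg_left ?_ hK
  have hr : Real.exp (-c₁ / 4) < 1 := Real.exp_lt_one_iff.2 (by linarith)
  rw [← tsum_geometric_of_lt_one (Real.exp_pos _).le hr]
  refine (Finset.sum_congr rfl fun l _ => ?_).trans_le
    ((summable_geometric_of_lt_one (Real.exp_pos _).le hr).sum_le_tsum _ fun _ _ => by positivity)
  rw [← Real.exp_nat_mul]
  ring_nf

end LevelSum

end Chaos

namespace Chaos

/-! ### Choice of the exponents near a subcritical real point. -/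

section Neighborhood

variable {d : ℕ} {Ω : Type*} [mΩ : MeasurableSpace Ω] {P : Measure Ω}
  {X : ℕ → unitCube d → Ω → ℝ}

/-- Near a subcritical real parameter all the exponents are admissible. -/
lemma exists_momentExponents {b : ℝ} (hb : 0 < b) (hbd : b < Real.sqrt (2 * d)) :
    ∃ (B η κ c : ℝ), 0 ≤ B ∧ 0 ≤ κ ∧ κ < d ∧ 0 < c ∧ ∀ τ : ℝ, 0 < τ → τ ≤ 1 →
      ∃ p : ℝ, 1 < p ∧ ∃ V : Set ℂ, IsOpen V ∧ (b : ℂ) ∈ V ∧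
        ∀ β ∈ V, MomentExponents B τ (b + η) η κ c c p β := by
  have hb2 : b ^ 2 / 2 < d := by
    have := (Real.lt_sqrt hb.le).1 hbd
    linarith
  obtain ⟨η, hη0, hη1, hη⟩ : ∃ η : ℝ, 0 < η ∧ η ≤ 1 ∧ b ^ 2 / 2 + b * η < d := by
    refine ⟨min 1 ((d - b ^ 2 / 2) / (2 * b)), lt_min one_pos
      (div_pos (by linarith) (by linarith)), min_le_left _ _, ?_⟩
    have h1 : b * min 1 ((d - b ^ 2 / 2) / (2 * b)) ≤ b * ((d - b ^ 2 / 2) / (2 * b)) :=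
      mul_le_mul_of_nonneg_left (min_le_right _ _) hb.le
    have h2 : b * ((d - b ^ 2 / 2) / (2 * b)) = (d - b ^ 2 / 2) / 2 := by field_simp
    linarith
  -- At `β = b`, `p = 1`, `α = b + η` the energy is `b² / 2 + b η < d`, and the escape and
  -- high-value exponents both equal `-η² / 2`. The midpoint with `d` and the rate `η² / 4` make all
  -- inequalities strict, so they persist nearby.
  refine ⟨4 * b + 2, η, (b ^ 2 / 2 + b * η + d) / 2, η ^ 2 / 4, by positivity, by positivity,
    by linarith, by positivity, fun τ hτ hτ1 => ?_⟩
  have hev : ∀ᶠ z in 𝓝 ((b : ℂ), (1 : ℝ)), 0 < z.1.re ∧ ‖z.1‖ < 4 * b + 2 ∧ |z.1.im| < τ ∧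
      z.1.re + η < 4 * b + 2 ∧ z.1.re * (b + η) - z.1.re ^ 2 / 2 + z.1.im ^ 2
        < (b ^ 2 / 2 + b * η + d) / 2 ∧
      z.1.re ^ 2 / 2 + (z.1.re + η) ^ 2 / 2 - η * (b + η) - (z.1.re ^ 2 - z.1.im ^ 2)
        < -(η ^ 2 / 4) ∧ z.2 < 2 ∧ 4 * z.1.re < 4 * b + 2 ∧ z.2 * z.1.re + η < 4 * b + 2 ∧
      (z.2 * z.1.re + η) ^ 2 / 2 - η * (b + η) - z.2 * (z.1.re ^ 2 - z.1.im ^ 2) / 2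
        < -(η ^ 2 / 4) := by
    have hη2 : 0 < η ^ 2 := by positivity
    have key : ∀ {f g : ℂ × ℝ → ℝ}, Continuous f → Continuous g →
        f ((b : ℂ), (1 : ℝ)) < g ((b : ℂ), (1 : ℝ)) → ∀ᶠ z in 𝓝 ((b : ℂ), (1 : ℝ)), f z < g z :=
      fun hf hg h => hf.continuousAt.eventually_lt hg.continuousAt h
    have hre : Continuous fun z : ℂ × ℝ => z.1.re := Complex.continuous_re.comp continuous_fst
    have him : Continuous fun z : ℂ × ℝ => z.1.im := Complex.continuous_im.comp continuous_fst
    simp only [eventually_and]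
    refine ⟨key continuous_const hre ?_, key (continuous_norm.comp continuous_fst) continuous_const ?_,
      key him.abs continuous_const ?_, key (by fun_prop) continuous_const ?_,
      key (by fun_prop) continuous_const ?_, key (by fun_prop) continuous_const ?_,
      key continuous_snd continuous_const ?_, key (by fun_prop) continuous_const ?_,
      key (by fun_prop) continuous_const ?_, key (by fun_prop) continuous_const ?_⟩ <;>
    simp only [Complex.ofReal_re, Complex.ofReal_im, Complex.norm_real,
      Real.norm_eq_abs, abs_of_pos hb, abs_zero]
    all_goals nlinarith
  -- A product neighbourhood of `(b, 1)` provides one exponent `p > 1` valid for every `β` in `V`.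
  rw [nhds_prod_eq, eventually_prod_iff] at hev
  obtain ⟨pa, hpa, pb, hpb, hgood⟩ := hev
  obtain ⟨p, hp, hp1⟩ := ((hpb.filter_mono (nhdsWithin_le_nhds (s := Set.Ioi 1))).and
    self_mem_nhdsWithin).exists
  obtain ⟨V, hV, hVo, hbV⟩ := mem_nhds_iff.1 hpa
  refine ⟨p, hp1, V, hVo, hbV, fun β hβ => ?_⟩
  obtain ⟨h1, h2, h3, h4, h5, h6, h7, h8, h9, h10⟩ := hgood (hV hβ) hp
  exact { re_nonneg := h1.le, norm_le := h2.le, im_le := h3.le, eta_nonneg := hη0.le,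
          re_add_le := h4.le, decay_pos := by positivity, energy := h5.le,
          kappa_nonneg := by positivity, escape := h6.le, one_le := le_of_lt hp1, le_two := h7.le,
          four_le := h8.le, im_le_one := h3.le.trans hτ1, high_le := h9.le, high := h10.le }

/-- Near a subcritical real parameter the normalizers are bounded below and the chaos is bounded in
`L^p` along a sequence. -/
lemma IsLogCorrelatedSequence.exists_neighborhood [IsProbabilityMeasure P]
    (hd : 1 ≤ d) (h : IsLogCorrelatedSequence P X)
    {b : ℝ} (hb : 0 < b) (hbd : b < Real.sqrt (2 * d)) :
    ∃ V : Set ℂ, IsOpen V ∧ (b : ℂ) ∈ V ∧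
      (∃ B, ∀ β ∈ V, ‖β‖ ≤ B) ∧ (∀ n, ∃ c > 0, ∀ β ∈ V, ∀ x, c ≤ ‖normalizer P X n β x‖) ∧
      ∃ p : ℝ, 1 < p ∧ ∃ K : ℝ≥0, ∃ N : ℕ → ℕ, (∀ n, ∃ j, n ≤ N j) ∧ ∀ β ∈ V,
        ∀ (j : ℕ) (f : C(unitCube d, ℂ)),
        eLpNorm (chaos P X (N j) f β) (ENNReal.ofReal p) P ≤ K * ‖f‖₊ := by
  obtain ⟨B, η, κ, c, hB, hκ0, hκ, hc, hex⟩ := exists_momentExponents hb hbd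
  obtain ⟨δ, hδ, hδ1, hbb⟩ := h.exists_blockBounds
  obtain ⟨τ, C, hτ, hτ1, hblock⟩ := hbb B hB
  obtain ⟨p, hp, V, hVo, hbV, hV⟩ := hex τ hτ hτ1
  obtain ⟨N, A, hN⟩ := h.exists_levels
  obtain ⟨K, hK⟩ := hblock.exists_eLpNorm_chaos_le hd h hδ hδ1 hN hκ0 hκ c hc
  refine ⟨V, hVo, hbV, ⟨B, fun β hβ => (hV β hβ).norm_le⟩, fun n => ?_, p, hp, K, N, hN.unbounded, fun β hβ j f => hK (hV β hβ) j f⟩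
  have hC := hblock.one_le
  refine ⟨Real.exp (-(B ^ 2 + 1) * varSum P X n) / C, by positivity, fun β hβ x => ?_⟩
  have he := hV β hβ
  have h1 := hblock.lower 0 n (Nat.zero_le n) x β he.re_le he.im_le
  rw [varSum_zero, sub_zero] at h1
  rw [normalizer_eq_laplace, Finset.range_eq_Ico, div_le_iff₀ (by linarith), mul_comm _ C]
  refine le_trans (Real.exp_le_exp.2 ?_) h1
  have hv := varSum_nonneg (P := P) (X := X) n
  have him : β.im ^ 2 ≤ 1 := by
    rw [← sq_abs]; exact pow_le_one₀ (abs_nonneg _) he.im_le_one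
  have h3 : -(B ^ 2 + 1) ≤ (β.re ^ 2 - β.im ^ 2) / 2 := by nlinarith [sq_nonneg β.re]
  have := mul_le_mul_of_nonneg_right h3 hv
  linarith

end Neighborhood

end Chaos

namespace Chaos

/-! ### Martingale property of the chaos. -/

lemma stronglyMeasurable_integral_exp {d : ℕ} {Ω : Type*} {m : MeasurableSpace Ω}
    {S : unitCube d → Ω → ℝ}
    (hS : Measurable fun z : unitCube d × Ω => S z.1 z.2) {f L : unitCube d → ℂ}
    (hf : Measurable f) (hL : Measurable L) (β : ℂ) :
    StronglyMeasurable fun ω => ∫ x, f x * (Complex.exp (β * (S x ω : ℂ)) / L x)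
      ∂(cubeVolume d) := by
  have : Measurable fun z : unitCube d × Ω =>
      f z.1 * (Complex.exp (β * (S z.1 z.2 : ℂ)) / L z.1) := by fun_prop
  exact this.stronglyMeasurable.integral_prod_left'

section Martingale

variable {d : ℕ} {Ω : Type*} [mΩ : MeasurableSpace Ω] {P : Measure Ω}
  {X : ℕ → unitCube d → Ω → ℝ}

/-- Used both to justify Fubini and to dominate the chaos uniformly over bounded sets of parameters.
-/
lemma integrable_prod_exp_abs [IsProbabilityMeasure P] (h : IsLogCorrelatedSequence P X) {B : ℝ}
    (hB : 0 ≤ B) (n : ℕ) :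
    Integrable (fun z : unitCube d × Ω => Real.exp (B * |fieldSum X (Finset.Ico 0 n) z.1 z.2|))
      ((cubeVolume d).prod P) := by
  obtain ⟨δ, hδ, hδ1, hbb⟩ := h.exists_blockBounds
  obtain ⟨τ, C, hτ, hτ1, hb⟩ := hbb B hB
  have hC := hb.one_le
  have hS := measurable_uncurry_fieldSum' h.fields (Finset.Ico 0 n)
  have hm : Measurable fun z : unitCube d × Ω =>
      Real.exp (B * |fieldSum X (Finset.Ico 0 n) z.1 z.2|) := by fun_prop
  refine ⟨hm.aestronglyMeasurable, ?_⟩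
  rw [hasFiniteIntegral_iff_ofReal (ae_of_all _ fun _ => (Real.exp_pos _).le),
    lintegral_prod _ hm.ennreal_ofReal.aemeasurable]
  have hx : ∀ x, ∫⁻ ω, ENNReal.ofReal (Real.exp (B * |fieldSum X (Finset.Ico 0 n) x ω|)) ∂P
      ≤ ENNReal.ofReal (2 * (C * Real.exp (B ^ 2 * varSum P X n / 2))) := by
    intro x
    have hSx := measurable_fieldSum' h.fields (Finset.Ico 0 n) x
    have h1 := hb.lintegral_exp_le h (Nat.zero_le n) x (a := B) (by rw [abs_of_nonneg hB]) 0
    have h2 := hb.lintegral_exp_le h (Nat.zero_le n) x (a := -B)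
      (by rw [abs_neg, abs_of_nonneg hB]) 0
    simp only [add_zero, varSum_zero, sub_zero, neg_sq] at h1 h2
    refine le_trans (lintegral_mono fun ω => ?_) ((lintegral_add_left (by fun_prop) _).trans_le
      ((add_le_add h1 h2).trans_eq ?_))
    · rw [← ENNReal.ofReal_add (by positivity) (by positivity)]
      refine ENNReal.ofReal_le_ofReal ?_
      rcases abs_cases (fieldSum X (Finset.Ico 0 n) x ω) with ⟨e, -⟩ | ⟨e, -⟩ <;> rw [e]
      · linarith [Real.exp_pos (-B * fieldSum X (Finset.Ico 0 n) x ω)]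
      · rw [← neg_mul_comm]
        linarith [Real.exp_pos (B * fieldSum X (Finset.Ico 0 n) x ω)]
    · rw [← ENNReal.ofReal_add (by positivity) (by positivity), two_mul]
  refine (lintegral_mono hx).trans_lt ?_
  rw [lintegral_const]
  exact ENNReal.mul_lt_top ENNReal.ofReal_lt_top (measure_lt_top _ _)

/-- A bounded open set of parameters on which the normalizers are uniformly bounded below. -/
structure IsChaosDomain (P : Measure Ω) (X : ℕ → unitCube d → Ω → ℝ) (V : Set ℂ) (B : ℝ) :
    Prop where
  isOpen : IsOpen V
  norm_le : ∀ β ∈ V, ‖β‖ ≤ B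
  lower : ∀ n, ∃ c > 0, ∀ β ∈ V, ∀ x, c ≤ ‖normalizer P X n β x‖

lemma laplace_Ico_zero (n : ℕ) (β : ℂ) (x : unitCube d) :
    laplace P X (Finset.Ico 0 n) β x = normalizer P X n β x := by
  rw [normalizer_eq_laplace, Finset.range_eq_Ico]

lemma IsChaosDomain.normalizer_ne_zero {V : Set ℂ} {B : ℝ} (hV : IsChaosDomain P X V B) {β : ℂ}
    (hβ : β ∈ V) (n : ℕ) (x : unitCube d) : normalizer P X n β x ≠ 0 := by
  obtain ⟨c, hc, hlow⟩ := hV.lower n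
  exact norm_pos_iff.1 (hc.trans_le (hlow β hβ x))

lemma norm_cexp_mul_le {B : ℝ} {β : ℂ} (hβ : ‖β‖ ≤ B) (s : ℝ) :
    ‖Complex.exp (β * (s : ℂ))‖ ≤ Real.exp (B * |s|) := by
  rw [Complex.norm_exp, Complex.re_mul_ofReal, Real.exp_le_exp]
  refine (le_abs_self _).trans ?_
  rw [abs_mul]
  exact mul_le_mul_of_nonneg_right ((Complex.abs_re_le_norm β).trans hβ) (abs_nonneg s)

lemma IsChaosDomain.exists_norm_blockExp_le {V : Set ℂ} {B : ℝ} (hV : IsChaosDomain P X V B)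
    (n : ℕ) : ∃ c : ℝ, 0 ≤ c ∧ ∀ β ∈ V, ∀ x ω, ‖blockExp P X 0 n β x ω‖
      ≤ c * Real.exp (B * |fieldSum X (Finset.Ico 0 n) x ω|) := by
  obtain ⟨c, hc, hlow⟩ := hV.lower n
  refine ⟨c⁻¹, by positivity, fun β hβ x ω => ?_⟩
  rw [blockExp, norm_div, laplace_Ico_zero, div_eq_inv_mul]
  exact mul_le_mul (inv_anti₀ hc (hlow β hβ x)) (norm_cexp_mul_le (hV.norm_le β hβ) _)
    (norm_nonneg _) (by positivity)

lemma integral_blockExp [IsProbabilityMeasure P] {m n : ℕ} {β : ℂ} {x : unitCube d}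
    (hne : laplace P X (Finset.Ico m n) β x ≠ 0) : ∫ ω, blockExp P X m n β x ω ∂P = 1 := by
  simp only [blockExp]
  rw [integral_div]
  exact div_self hne

/-- The integral of the norm of an integrand is dominated uniformly over the domain. -/
lemma IsChaosDomain.exists_dominating [IsProbabilityMeasure P] (h : IsLogCorrelatedSequence P X)
    {V : Set ℂ} {B : ℝ} (hB : 0 ≤ B) (hV : IsChaosDomain P X V B) (n : ℕ) (f : C(unitCube d, ℂ)) :
    ∃ D : Ω → ℝ, Integrable D P ∧ ∀ β ∈ V, ∀ ω, ‖chaos P X n f β ω‖ ≤ D ω := by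
  obtain ⟨c, hc, hle⟩ := hV.exists_norm_blockExp_le n
  refine ⟨fun ω => ∫ x, ‖f‖ * (c * Real.exp (B * |fieldSum X (Finset.Ico 0 n) x ω|))
    ∂(cubeVolume d), ?_, fun β hβ ω => ?_⟩
  · exact (((integrable_prod_exp_abs h hB n).const_mul c).const_mul ‖f‖).integral_prod_right
  · rw [chaos_eq]
    have hcont := continuous_fieldSum h.fields (Finset.Ico 0 n) ω
    have hc' : Continuous fun x =>
      ‖f‖ * (c * Real.exp (B * |fieldSum X (Finset.Ico 0 n) x ω|)) := by fun_prop
    obtain ⟨M, hM⟩ := isCompact_univ.exists_bound_of_continuousOn hc'.continuousOn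
    refine norm_integral_le_of_norm_le ((integrable_const M).mono' hc'.aestronglyMeasurable
      (ae_of_all _ fun x => hM x (Set.mem_univ x))) (ae_of_all _ fun x => ?_)
    rw [norm_mul]
    exact mul_le_mul (f.norm_coe_le_norm x) (hle β hβ x ω) (norm_nonneg _) (norm_nonneg _)

lemma stronglyMeasurable_chaos [SFinite P] (hX : IsContinuousFields X) (n : ℕ)
    (f : C(unitCube d, ℂ)) (β : ℂ) :
    StronglyMeasurable[fieldFiltration hX n] (chaos P X n f β) :=
  stronglyMeasurable_integral_exp (m := fieldFiltration hX n)
    (S := fieldSum X (Finset.range n))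
    (measurable_uncurry_fieldSum (t := Set.Iio n) hX (by intro k hk; simpa using hk))
    f.continuous.measurable (measurable_laplace hX (Finset.range n) β) β

lemma IsChaosDomain.integrable_chaos [IsProbabilityMeasure P] (h : IsLogCorrelatedSequence P X)
    {V : Set ℂ} {B : ℝ} (hB : 0 ≤ B) (hV : IsChaosDomain P X V B) {β : ℂ} (hβ : β ∈ V) (n : ℕ)
    (f : C(unitCube d, ℂ)) : Integrable (chaos P X n f β) P := by
  obtain ⟨D, hD, hle⟩ := hV.exists_dominating h hB n f
  exact hD.mono' ((stronglyMeasurable_chaos h.fields n f β).mono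
    ((fieldFiltration h.fields).le n)).aestronglyMeasurable (ae_of_all _ (hle β hβ))

/-- Fubini reduces the claim to a fixed point of the cube. There the exponential up to `j` is the
one up to `i` times an independent factor, which has mean one because its normalizer does not
vanish. -/
lemma IsChaosDomain.martingale_chaos [IsProbabilityMeasure P] (h : IsLogCorrelatedSequence P X)
    {V : Set ℂ} {B : ℝ} (hB : 0 ≤ B) (hV : IsChaosDomain P X V B) {β : ℂ} (hβ : β ∈ V)
    (f : C(unitCube d, ℂ)) :
    Martingale (fun n => chaos P X n f β) (fieldFiltration h.fields) P := by
  refine ⟨fun n => stronglyMeasurable_chaos h.fields n f β, fun i j hij => ?_⟩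
  refine (ae_eq_condExp_of_forall_setIntegral_eq ((fieldFiltration h.fields).le i)
    (hV.integrable_chaos h hB hβ j f)
    (fun s _ _ => (hV.integrable_chaos h hB hβ i f).integrableOn) (fun s hs _ => ?_)
    (stronglyMeasurable_chaos h.fields i f β).aestronglyMeasurable).symm
  have hs' : MeasurableSet s := (fieldFiltration h.fields).le i s hs
  have hfm : Measurable fun z : unitCube d × Ω => f z.1 :=
    f.continuous.measurable.comp measurable_fst
  have hint : ∀ n, Integrable (fun z : unitCube d × Ω => f z.1 * blockExp P X 0 n β z.1 z.2)
      ((cubeVolume d).prod (P.restrict s)) := by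
    intro n
    obtain ⟨c, hc, hle⟩ := hV.exists_norm_blockExp_le n
    have hm := measurable_uncurry_blockExp (P := P) h.fields 0 n β
    have h1 := ((integrable_prod_exp_abs h hB n).const_mul c).const_mul ‖f‖
    have h2 : Integrable (fun z : unitCube d × Ω => f z.1 * blockExp P X 0 n β z.1 z.2)
        ((cubeVolume d).prod P) := by
      refine h1.mono' (hfm.mul hm).aestronglyMeasurable (ae_of_all _ fun z => ?_)
      rw [norm_mul]
      exact mul_le_mul (f.norm_coe_le_norm _) (hle β hβ _ _) (norm_nonneg _) (norm_nonneg _)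
    rw [← Measure.restrict_univ (μ := cubeVolume d), Measure.prod_restrict]
    exact h2.integrableOn
  have hswap : ∀ n, ∫ ω in s, chaos P X n f β ω ∂P
      = ∫ x, f x * ∫ ω in s, blockExp P X 0 n β x ω ∂P ∂(cubeVolume d) := by
    intro n
    simp only [chaos_eq, ← integral_const_mul]
    exact (integral_integral_swap (hint n)).symm
  rw [hswap, hswap]
  refine integral_congr_ae (ae_of_all _ fun x => ?_)
  beta_reduce
  congr 1
  have hne : laplace P X (Finset.Ico i j) β x ≠ 0 := by
    have h1 := hV.normalizer_ne_zero hβ j x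
    rw [← laplace_Ico_zero, ← laplace_mul h (Nat.zero_le i) hij] at h1
    exact right_ne_zero_of_mul h1
  rw [← integral_indicator hs', ← integral_indicator hs']
  have hdis : Disjoint (Set.Iio i) (Set.Ico i j) := by
    rw [Set.disjoint_left]; intro a ha hb; exact absurd hb.1 (not_le.2 ha)
  have key := integral_mul_of_disjoint h.fields h.indep hdis
    (F := s.indicator (blockExp P X 0 i β x)) (G := blockExp P X i j β x)
    ((measurable_blockExp (by intro k hk; exact hk.2) β x).indicator hs)
    (measurable_blockExp le_rfl β x)
  rw [integral_blockExp hne, mul_one] at key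
  rw [← key]
  refine integral_congr_ae (ae_of_all _ fun ω => ?_)
  by_cases hω : ω ∈ s
  · simp only [Set.indicator_of_mem hω, blockExp_mul h (Nat.zero_le i) hij]
  · simp only [Set.indicator_of_notMem hω, zero_mul]

/-- Bounds along a subsequence extend to all indices. -/
lemma eLpNorm_chaos_le_of_martingale [IsProbabilityMeasure P] (hX : IsContinuousFields X)
    {f : C(unitCube d, ℂ)} {β : ℂ}
    (hM : Martingale (fun n => chaos P X n f β) (fieldFiltration hX) P) {p : ℝ≥0∞} (hp : 1 ≤ p)
    {N : ℕ → ℕ} (hN : ∀ n, ∃ j, n ≤ N j) {K : ℝ≥0∞} (hK : ∀ j, eLpNorm (chaos P X (N j) f β) p P ≤ K)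
    (n : ℕ) : eLpNorm (chaos P X n f β) p P ≤ K := by
  obtain ⟨j, hj⟩ := hN n
  rw [← eLpNorm_congr_ae (hM.2 n (N j) hj)]
  exact (eLpNorm_condExp_le_eLpNorm _ hp).trans (hK j)

end Martingale

end Chaos

namespace Chaos

/-! ### Holomorphic dependence on the parameter under the integral sign. -/

section HolomorphicIntegral

/-- Integrals of holomorphic functions with an integrable bound are holomorphic. -/
lemma differentiableOn_integral_of_norm_le {α : Type*} [MeasurableSpace α] {ν : Measure α}
    {g : ℂ → α → ℂ} {V : Set ℂ} (hV : IsOpen V) (hm : ∀ β ∈ V, AEStronglyMeasurable (g β) ν)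
    (hd : ∀ a, DifferentiableOn ℂ (fun β => g β a) V) {bound : α → ℝ}
    (hbound : Integrable bound ν) (hle : ∀ β ∈ V, ∀ a, ‖g β a‖ ≤ bound a) :
    DifferentiableOn ℂ (fun β => ∫ a, g β a ∂ν) V := by
  intro β₀ hβ₀
  obtain ⟨r, hr, hrV⟩ := Metric.isOpen_iff.1 hV β₀ hβ₀
  have hr2 : 0 < r / 4 := by positivity
  have hsub : ∀ β ∈ Metric.ball β₀ (r / 4), Metric.closedBall β (r / 4) ⊆ V := by
    intro β hβ z hz
    refine hrV (Metric.mem_ball.2 ?_)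
    have h1 := dist_triangle z β β₀
    have h2 := Metric.mem_ball.1 hβ
    have h3 := Metric.mem_closedBall.1 hz
    linarith
  have hda : ∀ a, ∀ β ∈ V, HasDerivAt (fun β => g β a) (deriv (fun β => g β a) β) β :=
    fun a β hβ => ((hd a β hβ).differentiableAt (hV.mem_nhds hβ)).hasDerivAt
  -- Difference quotients along this sequence exhibit the derivative as a measurable function of
  -- `a`.
  set u : ℕ → ℂ := fun n => β₀ + ((r / 4 * (1 / ((n : ℝ) + 1)) : ℝ) : ℂ) with hu
  have hu_tendsto : Tendsto u atTop (𝓝[≠] β₀) := by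
    refine tendsto_nhdsWithin_iff.2 ⟨?_, Eventually.of_forall fun n => ?_⟩
    · have h1 : Tendsto (fun n : ℕ => ((r / 4 * (1 / ((n : ℝ) + 1)) : ℝ) : ℂ)) atTop (𝓝 0) := by
        have := (tendsto_one_div_add_atTop_nhds_zero_nat (𝕜 := ℝ)).const_mul (r / 4)
        rw [mul_zero] at this
        exact_mod_cast (Complex.continuous_ofReal.tendsto 0).comp this
      have h2 := h1.const_add β₀
      rwa [add_zero] at h2
    · simp only [hu, Set.mem_compl_iff, Set.mem_singleton_iff, add_eq_left, Complex.ofReal_eq_zero]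
      positivity
  have huV : ∀ n, u n ∈ V := by
    intro n
    refine hsub β₀ (Metric.mem_ball_self hr2) ?_
    rw [Metric.mem_closedBall, dist_eq_norm, hu, add_sub_cancel_left, Complex.norm_real,
      Real.norm_of_nonneg (by positivity)]
    refine mul_le_of_le_one_right hr2.le ?_
    rw [div_le_one (by positivity)]
    linarith [Nat.cast_nonneg (α := ℝ) n]
  have hmeas : AEStronglyMeasurable (fun a => deriv (fun β => g β a) β₀) ν := by
    refine aestronglyMeasurable_of_tendsto_ae atTop
      (f := fun n a => slope (fun β => g β a) β₀ (u n)) (fun n => ?_) (ae_of_all _ fun a => ?_)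
    · simp only [slope_def_module]
      exact ((hm _ (huV n)).sub (hm _ hβ₀)).const_smul (u n - β₀)⁻¹
    · exact ((hasDerivAt_iff_tendsto_slope.1 (hda a β₀ hβ₀)).comp hu_tendsto)
  have := hasDerivAt_integral_of_dominated_loc_of_deriv_le (μ := ν) (F := g)
    (F' := fun β a => deriv (fun β => g β a) β) (x₀ := β₀) (bound := fun a => bound a / (r / 4))
    (s := Metric.ball β₀ (r / 4)) (Metric.ball_mem_nhds _ hr2)
    (by filter_upwards [hV.mem_nhds hβ₀] with β hβ using hm β hβ)
    (hbound.mono' (hm _ hβ₀) (ae_of_all _ (hle _ hβ₀))) hmeas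
    (ae_of_all _ fun a β hβ => ?_) (hbound.div_const _)
    (ae_of_all _ fun a β hβ => hda a β (hsub β hβ (Metric.mem_closedBall_self hr2.le)))
  · exact this.2.differentiableAt.differentiableWithinAt
  -- Cauchy's estimate on a circle of radius `r / 4` turns the bound on `g` into one on its
  -- derivative.
  · refine Complex.norm_deriv_le_of_forall_mem_sphere_norm_le hr2 ?_ fun z hz =>
      hle z (hsub β hβ (Metric.sphere_subset_closedBall hz)) a
    exact ((hd a).mono (hsub β hβ)).diffContOnCl_ball subset_rfl

end HolomorphicIntegral

/-! ### A Vitali theorem from bounded circle means. -/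

section Vitali

/-- The mean of the norm over a circle bounds a holomorphic function inside. -/
lemma norm_le_of_integral_circle_le {F : ℂ → ℂ} {c : ℂ} {R C : ℝ} (hR : 0 < R)
    (hF : DiffContOnCl ℂ F (Metric.ball c R))
    (hC : ∫ θ in Set.Ioc 0 (2 * Real.pi), ‖F (circleMap c R θ)‖ ≤ C) {w : ℂ}
    (hw : w ∈ Metric.closedBall c (R / 2)) : ‖F w‖ ≤ C := by
  have hwR : w ∈ Metric.ball c R := Metric.closedBall_subset_ball (by linarith) hw
  have key := hF.circleIntegral_sub_inv_smul hwR
  have hcirc : ∀ θ, circleMap c R θ ∈ Metric.closedBall c R := fun θ =>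
    circleMap_mem_closedBall c hR.le θ
  have hcont : Continuous fun θ => F (circleMap c R θ) :=
    hF.continuousOn_ball.comp_continuous (continuous_circleMap c R) hcirc
  have hlow : ∀ θ, R / 2 ≤ ‖circleMap c R θ - w‖ := by
    intro θ
    have h1 : ‖circleMap c R θ - c‖ = R := by
      simp [abs_of_pos hR]
    have h2 : ‖w - c‖ ≤ R / 2 := by simpa [dist_eq_norm] using hw
    have h3 := norm_sub_norm_le (circleMap c R θ - c) (w - c)
    rw [sub_sub_sub_cancel_right] at h3
    linarith
  have h2 : 2 * Real.pi * ‖F w‖ = ‖(2 * Real.pi * Complex.I : ℂ) • F w‖ := by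
    rw [norm_smul]
    simp [abs_of_pos Real.pi_pos]
  -- On the circle the speed is `R` and the distance to `w` is at least `R / 2`, whence the factor
  -- `2`; the factor `2π` in Cauchy's formula more than compensates.
  have h3 : ‖∮ z in C(c, R), (z - w)⁻¹ • F z‖ ≤ 2 * C := by
    rw [circleIntegral, intervalIntegral.integral_of_le Real.two_pi_pos.le]
    refine (norm_integral_le_of_norm_le (g := fun θ => 2 * ‖F (circleMap c R θ)‖) ?_
      (ae_of_all _ fun θ => ?_)).trans ?_
    · exact (continuous_const.mul hcont.norm).integrableOn_Ioc
    · rw [norm_smul, norm_smul, norm_inv, ← mul_assoc]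
      refine mul_le_mul_of_nonneg_right ?_ (norm_nonneg _)
      have h4 : ‖deriv (circleMap c R) θ‖ = R := by simp [abs_of_pos hR]
      rw [h4, ← div_eq_mul_inv, div_le_iff₀ (by linarith [hlow θ])]
      linarith [hlow θ]
    · rw [integral_const_mul]
      linarith
  rw [key, ← h2] at h3
  have h5 := Real.pi_gt_three
  nlinarith [norm_nonneg (F w)]

/-- A uniformly Lipschitz sequence which converges on a dense subset is uniformly Cauchy. -/
lemma uniformCauchySeqOn_of_lipschitz {E : Type*} [PseudoMetricSpace E] {F : ℕ → E → ℂ}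
    {D Q : Set E} (hD : TotallyBounded D) {L : ℝ} (hL0 : 0 ≤ L)
    (hL : ∀ n, ∀ x ∈ D, ∀ y ∈ D, ‖F n x - F n y‖ ≤ L * dist x y) (hQ : D ⊆ closure (D ∩ Q))
    (hc : ∀ q ∈ D ∩ Q, CauchySeq fun n => F n q) : UniformCauchySeqOn F atTop D := by
  rw [Metric.uniformCauchySeqOn_iff]
  intro ε hε
  have hL1 : 0 < L + 1 := by linarith
  set r := ε / (4 * (L + 1)) with hr
  have hr0 : 0 < r := by positivity
  obtain ⟨t, htD, htf, ht⟩ := Metric.finite_approx_of_totallyBounded hD (r / 2) (by positivity)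
  have hq : ∀ y ∈ t, ∃ q ∈ D ∩ Q, dist y q < r / 2 := fun y hy =>
    Metric.mem_closure_iff.1 (hQ (htD hy)) (r / 2) (by positivity)
  choose! q hqD hqd using hq
  have hN : ∀ᶠ N in atTop, ∀ y ∈ t, ∀ m ≥ N, ∀ n ≥ N, dist (F m (q y)) (F n (q y)) < ε / 2 := by
    refine (eventually_all_finite htf).2 fun y hy => ?_
    obtain ⟨N, hN⟩ := Metric.cauchySeq_iff.1 (hc _ (hqD y hy)) (ε / 2) (by positivity)
    filter_upwards [eventually_ge_atTop N] with N' hN' m hm n hn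
    exact hN m (hN'.trans hm) n (hN'.trans hn)
  obtain ⟨N, hN⟩ := hN.exists
  refine ⟨N, fun m hm n hn x hx => ?_⟩
  obtain ⟨y, hy, hxy⟩ := Set.mem_iUnion₂.1 (ht hx)
  have hxq : dist x (q y) ≤ r := by
    have := dist_triangle x y (q y)
    have := hqd y hy
    have := Metric.mem_ball.1 hxy
    linarith
  have hLr : L * r ≤ ε / 4 := by
    rw [hr, mul_div_assoc', div_le_div_iff₀ (by positivity) (by positivity)]
    nlinarith
  have h1 : ∀ k, dist (F k x) (F k (q y)) ≤ ε / 4 := fun k => by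
    rw [dist_eq_norm]
    exact (hL k x hx _ (hqD y hy).1).trans ((mul_le_mul_of_nonneg_left hxq hL0).trans hLr)
  have h2 := hN y hy m hm n hn
  have h3 := dist_triangle4 (F m x) (F m (q y)) (F n (q y)) (F n x)
  have h4 := h1 m
  have h5 := h1 n
  rw [dist_comm] at h5
  linarith

/-- A sequence of holomorphic functions which is bounded in the mean on a circle and converges on
a dense subset is uniformly Cauchy near the centre. -/
lemma uniformCauchySeqOn_of_integral_circle_le {F : ℕ → ℂ → ℂ} {c : ℂ} {R C : ℝ} (hR : 0 < R)
    (hF : ∀ n, DiffContOnCl ℂ (F n) (Metric.ball c R))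
    (hC : ∀ n, ∫ θ in Set.Ioc 0 (2 * Real.pi), ‖F n (circleMap c R θ)‖ ≤ C) {Q : Set ℂ}
    (hQ : Dense Q) (hc : ∀ q ∈ Metric.ball c R ∩ Q, CauchySeq fun n => F n q) :
    UniformCauchySeqOn F atTop (Metric.ball c (R / 4)) := by
  have hR4 : 0 < R / 4 := by positivity
  have hC0 : 0 ≤ C := (integral_nonneg fun _ => norm_nonneg _).trans (hC 0)
  have hdist : ∀ z ∈ Metric.ball c (R / 4), Metric.closedBall z (R / 4)
      ⊆ Metric.closedBall c (R / 2) := by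
    intro z hz w hw
    have h1 := dist_triangle w z c
    have h2 := Metric.mem_ball.1 hz
    have h3 := Metric.mem_closedBall.1 hw
    exact Metric.mem_closedBall.2 (by linarith)
  have hdiff : ∀ n, ∀ z ∈ Metric.ball c (R / 4), DifferentiableAt ℂ (F n) z := fun n z hz =>
    (hF n).differentiableAt Metric.isOpen_ball (Metric.ball_subset_ball (by linarith) hz)
  -- The functions are bounded by `C` on the disc of radius `R / 2`, so Cauchy's estimate at
  -- distance `R / 4` gives a common Lipschitz constant on the disc of radius `R / 4`.
  refine uniformCauchySeqOn_of_lipschitz (L := C / (R / 4)) (Q := Q)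
    ((isCompact_closedBall c (R / 4)).totallyBounded.subset Metric.ball_subset_closedBall) (by positivity) (fun n x hx y hy => ?_)
    (hQ.open_subset_closure_inter Metric.isOpen_ball)
    fun q hq => hc q ⟨Metric.ball_subset_ball (by linarith) hq.1, hq.2⟩
  rw [dist_eq_norm]
  refine (convex_ball c (R / 4)).norm_image_sub_le_of_norm_deriv_le (f := F n) (hdiff n)
    (fun z hz => ?_) hy hx
  refine Complex.norm_deriv_le_of_forall_mem_sphere_norm_le hR4 ?_ fun w hw =>
    norm_le_of_integral_circle_le hR (hF n) (hC n) (hdist z hz (Metric.sphere_subset_closedBall hw))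
  refine (hF n).mono fun w hw => ?_
  exact Metric.closedBall_subset_ball (by linarith) (hdist z hz (Metric.ball_subset_closedBall hw))

end Vitali

end Chaos

namespace Chaos

/-! ### Almost sure and `L^p` convergence of martingales with a parameter. -/

section MartingaleFamilies

variable {Ω : Type*} [mΩ : MeasurableSpace Ω] {P : Measure Ω}
  {ℱ : Filtration ℕ mΩ}

/-- Conditional Jensen for the norm, in integrated form so that it can be averaged over a parameter
by Fubini. -/
lemma setIntegral_norm_le_of_martingale [IsProbabilityMeasure P]
    {M : ℕ → Ω → ℂ} (hM : Martingale M ℱ P) {i j : ℕ}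
    (hij : i ≤ j) {s : Set Ω} (hs : MeasurableSet[ℱ i] s) :
    ∫ ω in s, ‖M i ω‖ ∂P ≤ ∫ ω in s, ‖M j ω‖ ∂P := by
  have h1 : (fun ω => ‖M i ω‖) ≤ᵐ[P] P[(fun ω => ‖M j ω‖)|ℱ i] := by
    filter_upwards [hM.2 i j hij, norm_condExp_le (μ := P) (m := ℱ i) (M j)] with ω h1 h2
    rwa [← h1]
  rw [← setIntegral_condExp (ℱ.le i) (hM.integrable j).norm hs]
  exact setIntegral_mono_ae (hM.integrable i).norm.integrableOn integrable_condExp.integrableOn h1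

/-- An `L¹`-bounded complex martingale is almost surely Cauchy. -/
lemma ae_cauchySeq_of_martingale [IsProbabilityMeasure P]
    {M : ℕ → Ω → ℂ} (hM : Martingale M ℱ P) {R : ℝ≥0}
    (hR : ∀ n, eLpNorm (M n) 1 P ≤ R) : ∀ᵐ ω ∂P, CauchySeq fun n => M n ω := by
  -- Real and imaginary parts are real martingales, to which Doob's convergence theorem applies.
  have key : ∀ L : ℂ →L[ℝ] ℝ, (∀ z, ‖L z‖ ≤ ‖z‖) →
      ∀ᵐ ω ∂P, ∃ c, Tendsto (fun n => L (M n ω)) atTop (𝓝 c) := by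
    intro L hL
    have hmart : Martingale (fun n ω => L (M n ω)) ℱ P := by
      refine ⟨fun n => L.continuous.comp_stronglyMeasurable (hM.1 n), fun i j hij => ?_⟩
      filter_upwards [hM.2 i j hij, L.comp_condExp_comm (m := ℱ i) (hM.integrable j)] with ω h1 h2
      rw [← h1]
      exact h2.symm
    refine hmart.submartingale.exists_ae_tendsto_of_bdd (R := R) fun n => ?_
    exact (eLpNorm_mono fun ω => hL _).trans (hR n)
  filter_upwards [key Complex.reCLM fun z => Complex.abs_re_le_norm z,
    key Complex.imCLM fun z => Complex.abs_im_le_norm z] with ω ⟨a, ha⟩ ⟨b, hb⟩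
  have : Tendsto (fun n => ((Complex.reCLM (M n ω) : ℝ) : ℂ)
      + (Complex.imCLM (M n ω) : ℝ) * Complex.I) atTop (𝓝 ((a : ℂ) + b * Complex.I)) :=
    ((Complex.continuous_ofReal.tendsto a).comp ha).add
      (((Complex.continuous_ofReal.tendsto b).comp hb).mul_const _)
  simp only [Complex.reCLM_apply, Complex.imCLM_apply, Complex.re_add_im] at this
  exact this.cauchySeq

/-- The integrated norms of an `L¹`-bounded family of martingales are almost surely bounded. -/
lemma ae_exists_integral_norm_le [IsProbabilityMeasure P]
    {Θ : Type*} [MeasurableSpace Θ] {ν : Measure Θ}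
    [IsFiniteMeasure ν] {H : ℕ → Θ → Ω → ℂ} (hM : ∀ θ, Martingale (fun n => H n θ) ℱ P)
    (hm : ∀ n, Measurable[Prod.instMeasurableSpace (m₂ := ℱ n)] (fun z : Θ × Ω => H n z.1 z.2))
    (hD : ∀ n, ∃ D : Ω → ℝ, Integrable D P ∧ ∀ θ ω, ‖H n θ ω‖ ≤ D ω) {R : ℝ≥0}
    (hR : ∀ n θ, eLpNorm (H n θ) 1 P ≤ R) :
    ∀ᵐ ω ∂P, ∃ C, ∀ n, ∫ θ, ‖H n θ ω‖ ∂ν ≤ C := by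
  have hadapt : ∀ n, StronglyMeasurable[ℱ n] fun ω => ∫ θ, ‖H n θ ω‖ ∂ν := by
    intro n
    have aux : ∀ {m : MeasurableSpace Ω}, Measurable (fun z : Θ × Ω => H n z.1 z.2) →
        StronglyMeasurable fun ω => ∫ θ, ‖H n θ ω‖ ∂ν := fun hm =>
      hm.norm.stronglyMeasurable.integral_prod_left'
    exact aux (m := ℱ n) (hm n)
  have hm' : ∀ n, Measurable (fun z : Θ × Ω => H n z.1 z.2) := fun n =>
    (hm n).mono (sup_le_sup le_rfl (MeasurableSpace.comap_mono (ℱ.le n))) le_rfl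
  have hint : ∀ n, Integrable (fun z : Θ × Ω => ‖H n z.1 z.2‖) (ν.prod P) := by
    intro n
    obtain ⟨D, hD, hle⟩ := hD n
    exact (hD.comp_snd ν).mono' (hm' n).norm.aestronglyMeasurable
      (ae_of_all _ fun z => by rw [norm_norm]; exact hle _ _)
  have hswap : ∀ n (s : Set Ω), ∫ ω in s, ∫ θ, ‖H n θ ω‖ ∂ν ∂P
      = ∫ θ, ∫ ω in s, ‖H n θ ω‖ ∂P ∂ν := by
    intro n s
    refine (integral_integral_swap ?_).symm
    rw [← Measure.restrict_univ (μ := ν), Measure.prod_restrict]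
    exact (hint n).integrableOn
  have hinner : ∀ n (s : Set Ω), Integrable (fun θ => ∫ ω in s, ‖H n θ ω‖ ∂P) ν := by
    intro n s
    have : Integrable (fun z : Θ × Ω => ‖H n z.1 z.2‖) (ν.prod (P.restrict s)) := by
      rw [← Measure.restrict_univ (μ := ν), Measure.prod_restrict]
      exact (hint n).integrableOn
    exact this.integral_prod_left
  -- Averaging over `θ` gives one submartingale, whose almost sure convergence involves a single
  -- null set instead of one for each `θ`.
  have hsub : Submartingale (fun n ω => ∫ θ, ‖H n θ ω‖ ∂ν) ℱ P := by
    refine submartingale_of_setIntegral_le hadapt (fun n => (hint n).integral_prod_right)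
      fun i j hij s hs => ?_
    rw [hswap, hswap]
    exact integral_mono (hinner i s) (hinner j s) fun θ =>
      setIntegral_norm_le_of_martingale (hM θ) hij hs
  have hbdd : ∀ n, eLpNorm (fun ω => ∫ θ, ‖H n θ ω‖ ∂ν) 1 P ≤ (ν.real Set.univ * R).toNNReal := by
    intro n
    rw [eLpNorm_one_eq_lintegral_enorm, ← ofReal_integral_norm_eq_lintegral_enorm
      (hint n).integral_prod_right]
    refine ENNReal.ofReal_le_ofReal ?_
    simp only [Real.norm_of_nonneg (integral_nonneg fun _ => norm_nonneg _)]
    have h1 := hswap n Set.univ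
    have h2 := hinner n Set.univ
    simp only [setIntegral_univ] at h1 h2
    rw [h1]
    refine (integral_mono h2 (integrable_const (R : ℝ)) fun θ => ?_).trans_eq (by simp)
    have h3 := hR n θ
    rw [eLpNorm_one_eq_lintegral_enorm, ← ofReal_integral_norm_eq_lintegral_enorm
      ((hM θ).integrable n)] at h3
    exact ENNReal.ofReal_le_iff_le_toReal ENNReal.coe_ne_top |>.1 h3
  filter_upwards [hsub.exists_ae_tendsto_of_bdd hbdd] with ω ⟨c, hc⟩
  obtain ⟨C, hC⟩ := hc.bddAbove_range
  exact ⟨C, fun n => hC ⟨n, rfl⟩⟩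

/-- Almost sure convergence together with a bound in `L^q` implies convergence in `L^p`, `p < q`. -/
lemma tendsto_eLpNorm_of_bdd [IsProbabilityMeasure P]
    {p q : ℝ} (hp : 1 ≤ p) (hpq : p < q) {M : ℕ → Ω → ℂ} {g : Ω → ℂ}
    (hm : ∀ n, AEStronglyMeasurable (M n) P) {R : ℝ≥0}
    (hR : ∀ n, eLpNorm (M n) (ENNReal.ofReal q) P ≤ R)
    (hg : ∀ᵐ ω ∂P, Tendsto (fun n => M n ω) atTop (𝓝 (g ω))) :
    MemLp g (ENNReal.ofReal p) P ∧
      Tendsto (fun n => eLpNorm (M n - g) (ENNReal.ofReal p) P) atTop (𝓝 0) := by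
  have hp0 : 0 < p := by linarith
  have hq0 : 0 < q := by linarith
  have hp1 : 1 ≤ ENNReal.ofReal p := by
    rw [← ENNReal.ofReal_one]; exact ENNReal.ofReal_le_ofReal hp
  have hpq' : ENNReal.ofReal p ≤ ENNReal.ofReal q := ENNReal.ofReal_le_ofReal hpq.le
  set e := 1 / p - 1 / q with he
  have he0 : 0 < e := sub_pos.2 (one_div_lt_one_div_of_lt hp0 hpq)
  have hui : UnifIntegrable M (ENNReal.ofReal p) P := by
    intro ε hε
    -- Hölder on `s` bounds the `L^p` norm by `R * P(s)^(1/p - 1/q)`; the threshold is chosen so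
    -- that this is at most `ε`.
    refine ⟨(ε / (R + 1)) ^ (1 / e), by positivity, fun n s hs hsδ => ?_⟩
    rw [eLpNorm_indicator_eq_eLpNorm_restrict hs]
    refine (eLpNorm_le_eLpNorm_mul_rpow_measure_univ hpq' (hm n).restrict).trans ?_
    rw [ENNReal.toReal_ofReal hp0.le, ENNReal.toReal_ofReal hq0.le, Measure.restrict_apply_univ]
    calc _ ≤ (R : ℝ≥0∞) * (ENNReal.ofReal ((ε / (R + 1)) ^ (1 / e))) ^ e := by
          refine mul_le_mul' ((eLpNorm_mono_measure _ Measure.restrict_le_self).trans (hR n))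
            (ENNReal.rpow_le_rpow hsδ he0.le)
      _ = ENNReal.ofReal (R * (ε / (R + 1))) := by
          rw [ENNReal.ofReal_rpow_of_nonneg (by positivity) he0.le, ← Real.rpow_mul (by positivity),
            one_div_mul_cancel he0.ne', Real.rpow_one, ENNReal.ofReal_mul (by positivity),
            ENNReal.ofReal_coe_nnreal]
      _ ≤ _ := by
          refine ENNReal.ofReal_le_ofReal ?_
          rw [mul_div_assoc', div_le_iff₀ (by positivity)]
          nlinarith [R.2]
  have hUI : UniformIntegrable M (ENNReal.ofReal p) P :=
    ⟨hm, hui, R, fun n => (eLpNorm_le_eLpNorm_of_exponent_le hpq' (hm n)).trans (hR n)⟩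
  have hgm : MemLp g (ENNReal.ofReal p) P := hUI.memLp_of_ae_tendsto hg
  exact ⟨hgm, tendsto_Lp_finite_of_tendsto_ae hp1 ENNReal.ofReal_ne_top hm hgm hui hg⟩

end MartingaleFamilies

/-! ### Analyticity in the parameter and local uniform Cauchy property. -/

section Convergence

variable {d : ℕ} {Ω : Type*} [mΩ : MeasurableSpace Ω] {P : Measure Ω}
  {X : ℕ → unitCube d → Ω → ℝ}

lemma IsLogCorrelatedSequence.integrable_exp_abs_fieldSum [IsProbabilityMeasure P]
    (h : IsLogCorrelatedSequence P X)
    (B : ℝ) (s : Finset ℕ) (x : unitCube d) :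
    Integrable (fun ω => Real.exp (B * |fieldSum X s x ω|)) P := by
  have hm := measurable_fieldSum' h.fields s x
  refine ((h.integrable_exp_fieldSum B s x).add (h.integrable_exp_fieldSum (-B) s x)).mono'
    (by fun_prop) (ae_of_all _ fun ω => ?_)
  rw [Real.norm_eq_abs, Real.abs_exp, Pi.add_apply]
  rcases abs_cases (fieldSum X s x ω) with ⟨e, -⟩ | ⟨e, -⟩ <;> rw [e]
  · linarith [Real.exp_pos (-B * fieldSum X s x ω)]
  · rw [← neg_mul_comm]
    linarith [Real.exp_pos (B * fieldSum X s x ω)]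

lemma IsChaosDomain.differentiableOn_normalizer [IsProbabilityMeasure P]
    (h : IsLogCorrelatedSequence P X) {V : Set ℂ}
    {B : ℝ} (hV : IsChaosDomain P X V B) (n : ℕ) (x : unitCube d) :
    DifferentiableOn ℂ (fun β => normalizer P X n β x) V := by
  have hm := measurable_fieldSum' h.fields (Finset.range n) x
  refine differentiableOn_integral_of_norm_le (ν := P)
    (g := fun β ω => Complex.exp (β * (fieldSum X (Finset.range n) x ω : ℂ))) hV.isOpen
    (fun β _ => (measurable_cexp_mul β hm).aestronglyMeasurable) (fun ω => ?_)
    (h.integrable_exp_abs_fieldSum B (Finset.range n) x)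
    fun β hβ ω => norm_cexp_mul_le (hV.norm_le β hβ) _
  fun_prop

lemma IsChaosDomain.differentiableOn_chaos [IsProbabilityMeasure P]
    (h : IsLogCorrelatedSequence P X) {V : Set ℂ}
    {B : ℝ} (hV : IsChaosDomain P X V B) (n : ℕ) (f : C(unitCube d, ℂ)) (ω : Ω) :
    DifferentiableOn ℂ (fun β => chaos P X n f β ω) V := by
  obtain ⟨c, hc, hle⟩ := hV.exists_norm_blockExp_le n
  have hcont := continuous_fieldSum h.fields (Finset.Ico 0 n) ω
  have hc' : Continuous fun x =>
    ‖f‖ * (c * Real.exp (B * |fieldSum X (Finset.Ico 0 n) x ω|)) := by fun_prop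
  obtain ⟨M, hM⟩ := isCompact_univ.exists_bound_of_continuousOn hc'.continuousOn
  simp only [chaos_eq]
  refine differentiableOn_integral_of_norm_le hV.isOpen (fun β _ => ?_) (fun x => ?_)
    (integrable_const M) fun β hβ x => ?_
  · have h1 : Measurable fun x => blockExp P X 0 n β x ω :=
      (measurable_uncurry_blockExp (P := P) h.fields 0 n β).of_uncurry_right
    exact (f.continuous.measurable.mul h1).aestronglyMeasurable
  · refine DifferentiableOn.const_mul ?_ _
    simp only [blockExp, laplace_Ico_zero]
    refine DifferentiableOn.div (by fun_prop) (hV.differentiableOn_normalizer h n x)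
      fun β hβ => hV.normalizer_ne_zero hβ n x
  · rw [norm_mul]
    exact (mul_le_mul (f.norm_coe_le_norm x) (hle β hβ x ω) (norm_nonneg _)
      (norm_nonneg _)).trans ((le_abs_self _).trans (hM x (Set.mem_univ x)))

/-- Almost sure local uniform Cauchy property of the chaos in the parameter. -/
lemma IsChaosDomain.ae_uniformCauchySeqOn [IsProbabilityMeasure P]
    (h : IsLogCorrelatedSequence P X) {V : Set ℂ}
    {B : ℝ} (hB : 0 ≤ B) (hV : IsChaosDomain P X V B) (f : C(unitCube d, ℂ)) {K : ℝ≥0}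
    (hK : ∀ β ∈ V, ∀ n, eLpNorm (chaos P X n f β) 1 P ≤ K) {c : ℂ} {R : ℝ} (hR : 0 < R)
    (hcR : Metric.closedBall c R ⊆ V) :
    ∀ᵐ ω ∂P, UniformCauchySeqOn (fun n β => chaos P X n f β ω) atTop (Metric.ball c (R / 4)) := by
  have hcirc : ∀ θ, circleMap c R θ ∈ V := fun θ => hcR (circleMap_mem_closedBall c hR.le θ)
  have hdiff := fun n ω => hV.differentiableOn_chaos h n f ω
  have h1 := ae_exists_integral_norm_le (ν := (volume : Measure ℝ).restrict (Set.Ioc 0 (2 * Real.pi)))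
    (H := fun n θ => chaos P X n f (circleMap c R θ)) (P := P)
    (fun θ => hV.martingale_chaos h hB (hcirc θ) f) (fun n => ?_) (fun n => ?_)
    (fun n θ => hK _ (hcirc θ) n)
  · have hQ := TopologicalSpace.exists_countable_dense ℂ
    obtain ⟨Q, hQc, hQd⟩ := hQ
    have h2 : ∀ᵐ ω ∂P, ∀ q ∈ V ∩ Q, CauchySeq fun n => chaos P X n f q ω := by
      refine (ae_ball_iff (hQc.mono Set.inter_subset_right)).2 fun q hq => ?_
      exact ae_cauchySeq_of_martingale (hV.martingale_chaos h hB hq.1 f) (hK q hq.1)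
    filter_upwards [h1, h2] with ω ⟨C, hC⟩ h2
    refine uniformCauchySeqOn_of_integral_circle_le hR (fun n => ?_) hC hQd
      fun q hq => h2 q ⟨hcR (Metric.ball_subset_closedBall hq.1), hq.2⟩
    exact ((hdiff n ω).mono hcR).diffContOnCl_ball subset_rfl
  · have hcont : ∀ ω, Continuous fun θ => chaos P X n f (circleMap c R θ) ω := fun ω =>
      (hdiff n ω).continuousOn.comp_continuous (continuous_circleMap c R) hcirc
    exact measurable_uncurry_of_continuous_of_measurable
      (u := fun θ ω => chaos P X n f (circleMap c R θ) ω) hcont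
      fun θ => (stronglyMeasurable_chaos h.fields n f _).measurable
  · obtain ⟨D, hD, hle⟩ := hV.exists_dominating h hB n f
    exact ⟨D, hD, fun θ ω => hle _ (hcirc θ) ω⟩

end Convergence

end Chaos

namespace Chaos

/-! ### The region of parameters and the limit. -/

section Assembly

variable {d : ℕ} {Ω : Type*} [mΩ : MeasurableSpace Ω] {P : Measure Ω}
  {X : ℕ → unitCube d → Ω → ℝ}

/-- A domain of parameters on which the chaos is bounded in `L^p` for some `p > 1`. -/
structure IsMomentDomain (P : Measure Ω) (X : ℕ → unitCube d → Ω → ℝ) (V : Set ℂ) (B p : ℝ)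
    (K : ℝ≥0) : Prop extends IsChaosDomain P X V B where
  bound_nonneg : 0 ≤ B
  one_lt : 1 < p
  eLpNorm_le : ∀ β ∈ V, ∀ n (f : C(unitCube d, ℂ)),
    eLpNorm (chaos P X n f β) (ENNReal.ofReal p) P ≤ (K * ‖f‖₊ : ℝ≥0)

lemma IsLogCorrelatedSequence.exists_momentDomain [IsProbabilityMeasure P]
    (hd : 1 ≤ d) (h : IsLogCorrelatedSequence P X)
    {b : ℝ} (hb : 0 < b) (hbd : b < Real.sqrt (2 * d)) :
    ∃ V B p K, (b : ℂ) ∈ V ∧ IsMomentDomain P X V B p K := by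
  obtain ⟨V, hVo, hbV, ⟨B, hB⟩, hlow, p, hp, K, N, hN, hK⟩ := h.exists_neighborhood hd hb hbd
  have hV : IsChaosDomain P X V B := ⟨hVo, hB, hlow⟩
  have hB0 : 0 ≤ B := (norm_nonneg _).trans (hB _ hbV)
  refine ⟨V, B, p, K, hbV, ⟨hV, hB0, hp, fun β hβ n f => ?_⟩⟩
  have hp1 : 1 ≤ ENNReal.ofReal p := by
    rw [← ENNReal.ofReal_one]; exact ENNReal.ofReal_le_ofReal hp.le
  refine eLpNorm_chaos_le_of_martingale h.fields (hV.martingale_chaos h hB0 hβ f) hp1 hN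
    (fun j => ?_) n
  exact_mod_cast hK β hβ j f

/-- The union of all moment domains. -/
def momentRegion (P : Measure Ω) (X : ℕ → unitCube d → Ω → ℝ) : Set ℂ :=
  {β | ∃ V B p K, β ∈ V ∧ IsMomentDomain P X V B p K}

lemma IsMomentDomain.subset_momentRegion {V : Set ℂ} {B p : ℝ} {K : ℝ≥0}
    (hV : IsMomentDomain P X V B p K) : V ⊆ momentRegion P X :=
  fun _ hβ => ⟨V, B, p, K, hβ, hV⟩

lemma isOpen_momentRegion [IsProbabilityMeasure P] : IsOpen (momentRegion P X) := by
  refine isOpen_iff_mem_nhds.2 ?_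
  rintro β ⟨V, B, p, K, hβ, hV⟩
  exact mem_of_superset (hV.isOpen.mem_nhds hβ) hV.subset_momentRegion

lemma measurable_chaos [IsProbabilityMeasure P]
    (hX : IsContinuousFields X) (n : ℕ) (f : C(unitCube d, ℂ)) (β : ℂ) :
    Measurable (chaos P X n f β) :=
  ((stronglyMeasurable_chaos hX n f β).mono ((fieldFiltration hX).le n)).measurable

lemma eLpNorm_chaos_mono [IsProbabilityMeasure P]
    (hX : IsContinuousFields X) {p q : ℝ} (hpq : p ≤ q) (n : ℕ)
    (f : C(unitCube d, ℂ)) (β : ℂ) :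
    eLpNorm (chaos P X n f β) (ENNReal.ofReal p) P
      ≤ eLpNorm (chaos P X n f β) (ENNReal.ofReal q) P :=
  eLpNorm_le_eLpNorm_of_exponent_le (ENNReal.ofReal_le_ofReal hpq)
    (measurable_chaos hX n f β).aestronglyMeasurable

/-- Each point has a neighbourhood with its own exponent. Finitely many cover the compact set, and
on a probability space the smallest exponent serves them all. -/
lemma exists_eLpNorm_le_of_isCompact [IsProbabilityMeasure P]
    (hX : IsContinuousFields X) {K : Set ℂ} (hK : IsCompact K)
    (hKU : K ⊆ momentRegion P X) : ∃ p : ℝ, 1 < p ∧ ∃ C : ℝ≥0, ∀ β ∈ K, ∀ n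
      (f : C(unitCube d, ℂ)), eLpNorm (chaos P X n f β) (ENNReal.ofReal p) P ≤ (C * ‖f‖₊ : ℝ≥0) := by
  refine hK.induction_on (p := fun K => ∃ p : ℝ, 1 < p ∧ ∃ C : ℝ≥0, ∀ β ∈ K, ∀ n
      (f : C(unitCube d, ℂ)), eLpNorm (chaos P X n f β) (ENNReal.ofReal p) P ≤ (C * ‖f‖₊ : ℝ≥0))
    ⟨2, by norm_num, 0, by simp⟩ ?_ ?_ ?_
  · rintro s t hst ⟨p, hp, C, hC⟩
    exact ⟨p, hp, C, fun β hβ => hC β (hst hβ)⟩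
  · rintro s t ⟨p, hp, C, hC⟩ ⟨q, hq, D, hD⟩
    refine ⟨min p q, lt_min hp hq, C + D, fun β hβ n f => ?_⟩
    rcases hβ with hβ | hβ
    · refine (eLpNorm_chaos_mono hX (min_le_left p q) n f β).trans ((hC β hβ n f).trans ?_)
      exact_mod_cast mul_le_mul_left (le_add_of_nonneg_right (by exact bot_le)) _
    · refine (eLpNorm_chaos_mono hX (min_le_right p q) n f β).trans ((hD β hβ n f).trans ?_)
      exact_mod_cast mul_le_mul_left (le_add_of_nonneg_left (by exact bot_le)) _
  · intro β hβ
    obtain ⟨V, B, p, C, hβV, hV⟩ := hKU hβ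
    exact ⟨V, mem_nhdsWithin_of_mem_nhds (hV.isOpen.mem_nhds hβV), p, hV.one_lt, C, hV.eLpNorm_le⟩

/-- The limit of the chaos, as a function of the parameter. -/
noncomputable def chaosLimit (P : Measure Ω) (X : ℕ → unitCube d → Ω → ℝ) (f : C(unitCube d, ℂ))
    (β : ℂ) (ω : Ω) : ℂ :=
  limUnder atTop fun n => chaos P X n f β ω

/-- Discs with centres in a countable dense set and radii `1 / (m + 1)` suffice to reach every point
of the region, so the exceptional null sets are countably many. -/
lemma ae_tendstoLocallyUniformlyOn_chaosLimit [IsProbabilityMeasure P]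
    (h : IsLogCorrelatedSequence P X)
    (f : C(unitCube d, ℂ)) : ∀ᵐ ω ∂P, TendstoLocallyUniformlyOn (fun n β => chaos P X n f β ω)
      (fun β => chaosLimit P X f β ω) atTop (momentRegion P X) := by
  obtain ⟨Q, hQc, hQd⟩ := TopologicalSpace.exists_countable_dense ℂ
  have hae : ∀ᵐ ω ∂P, ∀ q ∈ Q, ∀ m : ℕ, (∃ V B p K, Metric.closedBall q (1 / ((m : ℝ) + 1)) ⊆ V ∧
      IsMomentDomain P X V B p K) → UniformCauchySeqOn (fun n β => chaos P X n f β ω) atTop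
        (Metric.ball q (1 / ((m : ℝ) + 1) / 4)) := by
    refine (ae_ball_iff hQc).2 fun q _ => ae_all_iff.2 fun m => ?_
    by_cases hex : ∃ V B p K, Metric.closedBall q (1 / ((m : ℝ) + 1)) ⊆ V ∧
      IsMomentDomain P X V B p K
    · obtain ⟨V, B, p, K, hVq, hV⟩ := hex
      have hp1 : 1 ≤ ENNReal.ofReal p := by
        rw [← ENNReal.ofReal_one]; exact ENNReal.ofReal_le_ofReal hV.one_lt.le
      filter_upwards [hV.toIsChaosDomain.ae_uniformCauchySeqOn h hV.bound_nonneg f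
        (K := K * ‖f‖₊) (fun β hβ n => (eLpNorm_le_eLpNorm_of_exponent_le hp1
          (measurable_chaos h.fields n f β).aestronglyMeasurable).trans (hV.eLpNorm_le β hβ n f))
        (by positivity) hVq] with ω hω _ using hω
    · exact ae_of_all _ fun ω hω => absurd hω hex
  filter_upwards [hae] with ω hω
  refine tendstoLocallyUniformlyOn_of_forall_exists_nhds ?_
  rintro β ⟨V, B, p, K, hβ, hV⟩
  obtain ⟨ε, hε, hεV⟩ := Metric.isOpen_iff.1 hV.isOpen β hβ
  obtain ⟨m, hm⟩ := exists_nat_one_div_lt (half_pos hε)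
  set R := 1 / ((m : ℝ) + 1) with hR
  have hR0 : 0 < R := by positivity
  obtain ⟨q, hqβ, hqQ⟩ := hQd.exists_mem_open Metric.isOpen_ball
    (Metric.nonempty_ball.2 (by positivity : 0 < R / 4) : (Metric.ball β (R / 4)).Nonempty)
  have hcauchy := hω q hqβ m ⟨V, B, p, K, fun z hz => hεV ?_, hV⟩
  · refine ⟨Metric.ball q (R / 4), mem_nhdsWithin_of_mem_nhds (Metric.isOpen_ball.mem_nhds ?_),
      hcauchy.tendstoUniformlyOn_of_tendsto fun z hz => ?_⟩
    · rwa [Metric.mem_ball, dist_comm]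
    -- `limUnder` is a genuine limit here; its default value matters only where the sequence
    -- diverges.
    · exact (hcauchy.cauchySeq hz).tendsto_limUnder
  · have h1 := dist_triangle z q β
    have h2 := Metric.mem_ball.1 hqQ
    have h3 := Metric.mem_closedBall.1 hz
    exact Metric.mem_ball.2 (by linarith)

end Assembly

end Chaos

theorem theorem1p2 {d : ℕ} (hd : 1 ≤ d) {Ω : Type*} [MeasurableSpace Ω]
    (P : Measure Ω) [IsProbabilityMeasure P]
    (X : ℕ → Chaos.unitCube d → Ω → ℝ)
    (hX : Chaos.IsContinuousFields X)
    (hindep : iIndepFun (fun k ω x => X k x ω) P)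
    (hcentered : ∀ k x, ∫ ω, X k x ω ∂P = 0)
    (hlog : Chaos.IsLocallyLogCorrelated P X)
    (hmoment : Chaos.MomentCondition P X)
    (hincr : Chaos.IncrementCondition P X)
    (hexp : Chaos.UniformExpMoments P X) :
    ∃ U : Set ℂ, IsOpen U ∧
      (∀ b : ℝ, 0 < b → b < Real.sqrt (2 * d) → (b : ℂ) ∈ U) ∧
      (∀ β ∈ U, ∀ n x, Chaos.normalizer P X n β x ≠ 0) ∧
      (∀ β ∈ U, ∀ f : C(Chaos.unitCube d, ℂ),
        Martingale (fun n => Chaos.chaos P X n f β) (Chaos.fieldFiltration hX) P) ∧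
      ∃ μ : C(Chaos.unitCube d, ℂ) → ℂ → Ω → ℂ,
        (∀ K ⊆ U, IsCompact K → ∃ p : ℝ, 1 < p ∧
          (∀ f : C(Chaos.unitCube d, ℂ), ∃ C : ℝ≥0, ∀ β ∈ K, ∀ n,
            eLpNorm (Chaos.chaos P X n f β) (ENNReal.ofReal p) P ≤ C) ∧
          (∀ β ∈ K, ∀ f : C(Chaos.unitCube d, ℂ),
            MemLp (μ f β) (ENNReal.ofReal p) P ∧
            Tendsto (fun n => eLpNorm (Chaos.chaos P X n f β - μ f β) (ENNReal.ofReal p) P)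
              atTop (𝓝 0))) ∧
        (∀ f : C(Chaos.unitCube d, ℂ), ∀ᵐ ω ∂P,
          AnalyticOnNhd ℂ (fun β => μ f β ω) U ∧
          ∀ K ⊆ U, IsCompact K →
            TendstoUniformlyOn (fun n β => Chaos.chaos P X n f β ω) (fun β => μ f β ω) atTop K) := by
  have h : Chaos.IsLogCorrelatedSequence P X :=
    ⟨hX, hindep, hcentered, hlog, hmoment, hincr, hexp⟩
  refine ⟨Chaos.momentRegion P X, Chaos.isOpen_momentRegion, fun b hb hbd => ?_, ?_, ?_,
    Chaos.chaosLimit P X, fun K hKU hK => ?_, fun f => ?_⟩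
  · obtain ⟨V, B, p, K, hbV, hV⟩ := h.exists_momentDomain hd hb hbd
    exact hV.subset_momentRegion hbV
  · rintro β ⟨V, B, p, K, hβ, hV⟩ n x
    exact hV.normalizer_ne_zero hβ n x
  · rintro β ⟨V, B, p, K, hβ, hV⟩ f
    exact hV.martingale_chaos h hV.bound_nonneg hβ f
  · obtain ⟨q, hq, C, hC⟩ := Chaos.exists_eLpNorm_le_of_isCompact hX hK hKU
    -- Any exponent strictly between `1` and `q` works: convergence in `L^p` is drawn from
    -- boundedness in the larger `L^q`.
    have hp : 1 < (1 + q) / 2 := by linarith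
    have hpq : (1 + q) / 2 < q := by linarith
    refine ⟨(1 + q) / 2, hp, fun f => ⟨C * ‖f‖₊, fun β hβ n =>
      (Chaos.eLpNorm_chaos_mono hX hpq.le n f β).trans (hC β hβ n f)⟩, fun β hβ f => ?_⟩
    refine Chaos.tendsto_eLpNorm_of_bdd hp.le hpq
      (fun n => (Chaos.measurable_chaos hX n f β).aestronglyMeasurable)
      (fun n => hC β hβ n f) ?_
    filter_upwards [Chaos.ae_tendstoLocallyUniformlyOn_chaosLimit h f] with ω hω
    exact hω.tendsto_at (hKU hβ)
  · filter_upwards [Chaos.ae_tendstoLocallyUniformlyOn_chaosLimit h f] with ω hω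
    refine ⟨?_, (tendstoLocallyUniformlyOn_iff_forall_isCompact Chaos.isOpen_momentRegion).1 hω⟩
    -- Weierstrass: a locally uniform limit of holomorphic functions is holomorphic.
    refine (hω.differentiableOn (Eventually.of_forall fun n => ?_)
      Chaos.isOpen_momentRegion).analyticOnNhd Chaos.isOpen_momentRegion
    rintro β ⟨V, B, p, K, hβ, hV⟩
    exact ((hV.differentiableOn_chaos h n f ω β hβ).differentiableAt
      (hV.isOpen.mem_nhds hβ)).differentiableWithinAt
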